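/- Notation. Write $e(z)=e^{2\pi i z}$, $q^\alpha=e(\alpha\tau)$, let $\{x\}\in[0,1)$ be the fractional part of $x\in\mathbf R/\mathbf Z$, and let $B_k$ be the $k$-th Bernoulli polynomial. For $\tau$ in the upper half-plane, an integer $k\ge 1$ and $\boldsymbol x=(x_1,x_2)\in(\mathbf R/\mathbf Z)^2$, put $$E^{(k)}_{\boldsymbol x}(\tau)=-\frac{(k-1)!}{(-2\pi i)^k}\,K_k(0,x_1\tau+x_2,k),\qquad K_k(0,x_0,s)=\sum_{\substack{w\in \mathbf Z+\tau\mathbf Z\\ w\ne 0}}\exp\Bigl(\frac{\pi}{\operatorname{Im}\tau}(w\overline{x_0}-\overline w x_0)\Bigr)\frac{\overline w^{\,k}}{|w|^{2s}},$$ where the series converges for $\operatorname{Re}(s)>1+\frac k2$ and $K_k(0,x_0,s)$ is continued analytically in $s$; and $$G^{(k)}_{\boldsymbol x}(\tau)=a_0(G^{(k)}_{\boldsymbol x})+\Bigl(\sum_{\substack{m,n\in\mathbf R_{>0}\\ (m,n)\equiv \boldsymbol x \bmod 1}}+(-1)^k\sum_{\substack{m,n\in\mathbf R_{>0}\\ (m,n)\equiv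 -\boldsymbol x \bmod 1}}\Bigr)m^{k-1}q^{mn},$$ where $a_0(G^{(1)}_{\boldsymbol x})$ is $-B_1(\{x_2\})$ if $x_1=0\neq x_2$, $-B_1(\{x_1\})$ if $x_1\ne0=x_2$, and $0$ otherwise, and, for $k\ge2$, $a_0(G^{(k)}_{\boldsymbol x})$ is $-B_k(\{x_1\})/k$ if $x_2=0$ and $0$ if $x_2\neq0$. A $C^\infty$ function $f$ on the half-axis $\{iy:y>0\}$ is admissible at $\infty$ if $f=f^\infty+f^0$ with $f^\infty\in\mathbf C[\tau]$ and $f^0(iy)=O(c^y)$ as $y\to+\infty$ for some $0<c<1$; its regularised value at $\infty$ is $f^\infty(0)$. A form $f(\tau)\,d\tau$ is admissible if both $f(\tau)$ and $f(-1/\tau)\tau^{-2}$ are admissible at $\infty$. In this case its regularised integral is $\int_0^\infty f\,d\tau=\int_0^{\tau_0}f\,d\tau+\int_{\tau_0}^\infty f\,d\tau$ for any $\tau_0$ on the half-axis, where $$\int_{\tau_0}^\infty f\,d\tau=\lim_{P\to+\infty}\Bigl(\int_{\tau_0}^{iP} f\,d\tau+\int_{iP}^0 f^\infty\,d\tau\Bigr),\qquad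 \int_0^{\tau_0}f\,d\tau=-\int_{-1/\tau_0}^\infty f(-1/\tau)\tau^{-2}\,d\tau,$$ and $\int_0^\infty f(iy)\,dy:=\frac1i\int_0^\infty f\,d\tau$. The Eichler integral $\widetilde E^{(\ell)}_{\boldsymbol v}$ is the unique primitive, on the half-axis, of $2\pi i\,E^{(\ell)}_{\boldsymbol v}(\tau)\,d\tau$ that is admissible at $\infty$ with regularised value $0$ there. Finally, the generalised Mellin transform $\mathcal M(f,s)=\int_0^\infty f(iy)y^s\frac{dy}{y}$ is the sum of the analytic continuations (holomorphic off a finite set of points) of $\int_0^1 f(iy)y^{s-1}dy$ from $\operatorname{Re}(s)\gg0$ and of $\int_1^\infty f(iy)y^{s-1}dy$ from $\operatorname{Re}(s)\ll0$. Theorem. Let $\ell\ge2$ be an integer, and let $\boldsymbol u=(u_1,u_2)$, $\boldsymbol v=(v_1,v_2)\in(\mathbf R/\mathbf Z)^2$ with $u_1,u_2,v_1,v_2$ all non-zero. Then $\widetilde E^{(\ell)}_{\boldsymbol v}$ exists, the form $E^{(2)}_{\boldsymbol u}\widetilde E^{(\ell)}_{\boldsymbol v}\,d\tau$ is admissible,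 the Mellin transform below is holomorphic at $s=0$, and $$\operatorname{Im}\Bigl(\int_0^\infty E^{(2)}_{\boldsymbol u}(iy)\,\widetilde E^{(\ell)}_{\boldsymbol v}(iy)\,dy\Bigr)=-\frac12\,\mathcal M\bigl(G^{(1)}_{u_1,v_2}G^{(\ell-1)}_{v_1,-u_2}-G^{(1)}_{u_1,-v_2}G^{(\ell-1)}_{v_1,u_2},\,0\bigr).$$ -/

import Mathlib

open scoped ContDiff Topology

namespace EisensteinRZ

noncomputable section

/-! ### Eisenstein series with parameters in `(ℝ/ℤ)²` -/

/-- `e(z) = exp(2πiz)`, so that `q^α = e(ατ)`. -/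
def e (z : ℂ) : ℂ := Complex.exp (2 * Real.pi * Complex.I * z)

/-- The fractional part `{x} ∈ [0,1)` of a class `x ∈ ℝ/ℤ`. -/
def frac (x : UnitAddCircle) : ℝ := (AddCircle.equivIco (1 : ℝ) 0 x : ℝ)

/-- `A(L) = (2πi)⁻¹ (ω̄₁ω₂ - ω₁ω̄₂)` for the lattice `L = ℤ + τℤ` with basis
`(ω₁, ω₂) = (1, τ)`. -/
def latticeA (τ : ℂ) : ℂ :=
  (2 * Real.pi * Complex.I)⁻¹ * (starRingEnd ℂ 1 * τ - 1 * starRingEnd ℂ τ)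

/-- The term of the Kronecker double series at the lattice point `w = mτ + n`, `p = (m, n)`;
the point `w = -x` is left out of the sum. -/
def kroneckerTerm (a : ℕ) (x x₀ τ s : ℂ) (p : ℤ × ℤ) : ℂ :=
  open Classical in
  if (p.1 * τ + p.2 : ℂ) = -x then 0
  else
    Complex.exp ((latticeA τ)⁻¹ *
        ((p.1 * τ + p.2) * starRingEnd ℂ x₀ - starRingEnd ℂ (p.1 * τ + p.2) * x₀)) *
      (starRingEnd ℂ (p.1 * τ + p.2) + starRingEnd ℂ x) ^ a /
        ((‖p.1 * τ + p.2 + x‖ : ℝ) : ℂ) ^ (2 * s)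

/-- `F` is an analytic continuation, to the half-plane `Re s > c`, of the function which for
`Re s > 1 + a/2` is the (absolutely convergent) Kronecker double series. -/
def IsKroneckerContinuation (a : ℕ) (x x₀ τ : ℂ) (c : ℝ) (F : ℂ → ℂ) : Prop :=
  DifferentiableOn ℂ F {s : ℂ | c < s.re} ∧
    ∀ s : ℂ, 1 + (a : ℝ) / 2 < s.re → F s = ∑' p : ℤ × ℤ, kroneckerTerm a x x₀ τ s p

/-- The function `K_a(x, x₀, s; τ)`, as a function of `s` defined by analytic continuation. The
value does not depend on the continuation used: see `kroneckerK_eq`. -/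
def kroneckerK (a : ℕ) (x x₀ s τ : ℂ) : ℂ :=
  open Classical in
  if h : ∃ F : ℂ → ℂ, ∃ c : ℝ, c < s.re ∧ IsKroneckerContinuation a x x₀ τ c F
  then h.choose s else 0

/-- `E^{(k)}_x(τ) = - (k-1)! / (-2πi)^k * K_k(0, x₁τ + x₂, k)`, for `k ≥ 1`. (Since `K_k(0, ·, s)`
is periodic with respect to `ℤ + τℤ`, any representatives of `x₁, x₂` can be used.) -/
def eisE (k : ℕ) (x : UnitAddCircle × UnitAddCircle) (τ : ℂ) : ℂ :=
  -((Nat.factorial (k - 1) : ℂ) / (-(2 * Real.pi * Complex.I)) ^ k) *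
    kroneckerK k 0 (frac x.1 * τ + frac x.2) k τ

/-- The constant term of `G^{(k)}_x`, for `k ≥ 1`; `bernoulliFun k` is the `k`-th Bernoulli
polynomial as a function. -/
def eisGConst (k : ℕ) (x : UnitAddCircle × UnitAddCircle) : ℝ :=
  open Classical in
  if k = 1 then
    if x.1 = 0 ∧ x.2 ≠ 0 then -bernoulliFun 1 (frac x.2)
    else if x.1 ≠ 0 ∧ x.2 = 0 then -bernoulliFun 1 (frac x.1)
    else 0
  else if x.2 = 0 then -(bernoulliFun k (frac x.1) / k) else 0

/-- `∑ m^{k-1} q^{mn}` over the real numbers `m, n > 0` with `(m, n) ≡ x mod 1`. -/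
def eisGSum (k : ℕ) (x : UnitAddCircle × UnitAddCircle) (τ : ℂ) : ℂ :=
  ∑' p : {p : ℝ × ℝ // 0 < p.1 ∧ 0 < p.2 ∧
      (p.1 : UnitAddCircle) = x.1 ∧ (p.2 : UnitAddCircle) = x.2},
    ((p.1.1 : ℝ) : ℂ) ^ (k - 1) * e ((p.1.1 : ℂ) * (p.1.2 : ℂ) * τ)

/-- The Eisenstein series `G^{(k)}_x`, for `k ≥ 1`. -/
def eisG (k : ℕ) (x : UnitAddCircle × UnitAddCircle) (τ : ℂ) : ℂ :=
  (eisGConst k x : ℂ) + (eisGSum k x τ + (-1) ^ k * eisGSum k (-x) τ)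

/-! ### Regularised integrals on the imaginary axis

A function `f` on the imaginary half-axis `{iy : y > 0}` is represented by the function
`y ↦ f(iy)` of the real variable `y > 0`; accordingly the differential form `f(τ) dτ` is
`f(iy) i dy`, and the involution `τ ↦ -1/τ` becomes `y ↦ 1/y`. -/

/-- Exponential decay at `∞`: `g = O(c^y)` for some `0 < c < 1`. -/
def ExpDecay (g : ℝ → ℂ) : Prop :=
  ∃ c : ℝ, 0 < c ∧ c < 1 ∧ g =O[Filter.atTop] fun y : ℝ => c ^ y

/-- `f = p + f⁰` with `p` a polynomial in `τ = iy` and `f⁰` of exponential decay at `∞`. -/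
def IsPolyPart (f : ℝ → ℂ) (p : Polynomial ℂ) : Prop :=
  ExpDecay fun y => f y - p.eval (Complex.I * y)

/-- Admissibility at `∞` of a function `f`, or of the form `f(τ) dτ`. -/
def AdmissibleAtInfty (f : ℝ → ℂ) : Prop :=
  ContDiffOn ℝ ∞ f (Set.Ioi 0) ∧ ∃ p, IsPolyPart f p

/-- The polynomial part `f^∞` of a function admissible at `∞`; it is unique: see `polyPart_eq`. -/
def polyPart (f : ℝ → ℂ) : Polynomial ℂ :=
  open Classical in if h : ∃ p, IsPolyPart f p then h.choose else 0

/-- The regularised value at `∞`: the constant term of the polynomial part. -/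
def regValueInfty (f : ℝ → ℂ) : ℂ := (polyPart f).coeff 0

/-- The pull-back under `τ ↦ -1/τ` of the form `f(τ) dτ`, namely `f(-1/τ) τ⁻² dτ`. -/
def pullbackForm (f : ℝ → ℂ) : ℝ → ℂ := fun y => f (1 / y) / (Complex.I * y) ^ 2

/-- Admissibility (at `0` and at `∞`) of the differential form `f(τ) dτ`. -/
def AdmissibleForm (f : ℝ → ℂ) : Prop :=
  AdmissibleAtInfty f ∧ AdmissibleAtInfty (pullbackForm f)

/-- The regularised integral `∫_τ^∞ f(τ₁) dτ₁`, `τ = iy`, of a form admissible at `∞`: the limit of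
`∫_{iy}^{iP} f(τ₁) dτ₁ + ∫_{iP}^0 f^∞(τ₁) dτ₁` as `P → +∞`. -/
def regIntegralToInfty (f : ℝ → ℂ) (y : ℝ) : ℂ :=
  Filter.limUnder Filter.atTop fun P : ℝ =>
    (∫ t in y..P, f t * Complex.I) +
      ∫ t in P..0, (polyPart f).eval (Complex.I * t) * Complex.I

/-- The regularised integral `∫_0^τ f(τ₁) dτ₁ = -∫_{-1/τ}^∞ f(-1/τ₁) τ₁⁻² dτ₁`, `τ = iy`. -/
def regIntegralFromZero (f : ℝ → ℂ) (y : ℝ) : ℂ :=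
  -regIntegralToInfty (pullbackForm f) (1 / y)

/-- The regularised integral `∫_0^∞ f(τ) dτ = ∫_0^{τ₀} f(τ) dτ + ∫_{τ₀}^∞ f(τ) dτ` of an admissible
form along the imaginary axis. It does not depend on `τ₀`; here `τ₀ = i`. -/
def regIntegral (f : ℝ → ℂ) : ℂ := regIntegralFromZero f 1 + regIntegralToInfty f 1

/-- The regularised integral `∫_0^∞ f(iy) dy = i⁻¹ ∫_0^∞ f(τ) dτ`. -/
def regIntegralDy (f : ℝ → ℂ) : ℂ := Complex.I⁻¹ * regIntegral f

/-- `F` is the Eichler integral of `f`: the primitive, along the imaginary axis, of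
`2πi f(τ) dτ` whose regularised value at `∞` is zero. -/
def IsEichlerIntegral (f F : ℝ → ℂ) : Prop :=
  (∀ y : ℝ, 0 < y →
      HasDerivAt F (2 * Real.pi * Complex.I * f y * Complex.I) y) ∧
    AdmissibleAtInfty F ∧ regValueInfty F = 0

/-! ### Generalised Mellin transform -/

/-- `M`, holomorphic off the finite set `S`, is the generalised Mellin transform of `f`, i.e. the sum
of the analytic continuations `B` and `A` (holomorphic off a finite set) of
`∫_0^1 f(iy) y^{s-1} dy` (convergent for `Re s` large) and of
`∫_1^∞ f(iy) y^{s-1} dy` (convergent for `-Re s` large). -/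
def IsMellinContinuation (f : ℝ → ℂ) (S : Set ℂ) (M : ℂ → ℂ) : Prop :=
  S.Finite ∧ DifferentiableOn ℂ M Sᶜ ∧
    ∃ (T : Set ℂ) (A B : ℂ → ℂ), T.Finite ∧
      DifferentiableOn ℂ A Tᶜ ∧ DifferentiableOn ℂ B Tᶜ ∧
      (∃ c : ℝ, ∀ s : ℂ, s.re < c →
        MeasureTheory.IntegrableOn (fun y : ℝ => f y * (y : ℂ) ^ (s - 1)) (Set.Ioi 1) ∧
          A s = ∫ y in Set.Ioi (1 : ℝ), f y * (y : ℂ) ^ (s - 1)) ∧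
      (∃ c : ℝ, ∀ s : ℂ, c < s.re →
        MeasureTheory.IntegrableOn (fun y : ℝ => f y * (y : ℂ) ^ (s - 1)) (Set.Ioc 0 1) ∧
          B s = ∫ y in Set.Ioc (0 : ℝ) 1, f y * (y : ℂ) ^ (s - 1)) ∧
      ∀ s : ℂ, s ∉ S → s ∉ T → M s = A s + B s

/-- The generalised Mellin transform of `f` exists and is holomorphic at `s`. -/
def MellinHolomorphicAt (f : ℝ → ℂ) (s : ℂ) : Prop :=
  ∃ (M : ℂ → ℂ) (S : Set ℂ), IsMellinContinuation f S M ∧ s ∉ S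

/-- The value at `s` of the generalised Mellin transform `ℳ(f, s) = ∫_0^∞ f(iy) y^s dy/y`. It does
not depend on choices: see `genMellin_eq`. -/
def genMellin (f : ℝ → ℂ) (s : ℂ) : ℂ :=
  open Classical in if h : MellinHolomorphicAt f s then h.choose s else 0

/-! ### The definitions by choice are independent of the choice -/

theorem kroneckerK_eq {a : ℕ} {x x₀ s τ : ℂ} {c : ℝ} {F : ℂ → ℂ} (hs : c < s.re)
    (hF : IsKroneckerContinuation a x x₀ τ c F) : kroneckerK a x x₀ s τ = F s := by
  have h : ∃ F : ℂ → ℂ, ∃ c : ℝ, c < s.re ∧ IsKroneckerContinuation a x x₀ τ c F :=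
    ⟨F, c, hs, hF⟩
  unfold kroneckerK
  rw [dif_pos h]
  obtain ⟨d, hd, hG⟩ := h.choose_spec
  set G := h.choose
  have hopen : ∀ r : ℝ, IsOpen {z : ℂ | r < z.re} := fun r =>
    isOpen_lt continuous_const Complex.continuous_re
  set b : ℝ := max c d
  have hsub : ∀ r : ℝ, r ≤ b → {z : ℂ | b < z.re} ⊆ {z : ℂ | r < z.re} := fun r hr z hz =>
    lt_of_le_of_lt hr hz
  have hFa : AnalyticOnNhd ℂ F {z : ℂ | b < z.re} :=
    (hF.1.mono (hsub _ (le_max_left _ _))).analyticOnNhd (hopen b)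
  have hGa : AnalyticOnNhd ℂ G {z : ℂ | b < z.re} :=
    (hG.1.mono (hsub _ (le_max_right _ _))).analyticOnNhd (hopen b)
  have hpc : IsPreconnected {z : ℂ | b < z.re} := (convex_halfSpace_re_gt b).isPreconnected
  set z₀ : ℂ := ((max b (1 + (a : ℝ) / 2) + 1 : ℝ) : ℂ)
  have hz₀ : z₀.re = max b (1 + (a : ℝ) / 2) + 1 := Complex.ofReal_re _
  have hb : b < z₀.re := by rw [hz₀]; linarith [le_max_left b (1 + (a : ℝ) / 2)]
  have ha : 1 + (a : ℝ) / 2 < z₀.re := by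
    rw [hz₀]; linarith [le_max_right b (1 + (a : ℝ) / 2)]
  have hev : G =ᶠ[𝓝 z₀] F := by
    filter_upwards [(hopen (1 + (a : ℝ) / 2)).mem_nhds ha] with z hz
    rw [hG.2 z hz, hF.2 z hz]
  exact hGa.eqOn_of_preconnected_of_eventuallyEq hFa hpc hb hev (max_lt hs hd)

theorem polyPart_eq {f : ℝ → ℂ} {p : Polynomial ℂ} (hp : IsPolyPart f p) : polyPart f = p := by
  have h : ∃ p, IsPolyPart f p := ⟨p, hp⟩
  unfold polyPart
  rw [dif_pos h]
  have hq := h.choose_spec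
  set q := h.choose
  have key : ∀ g : ℝ → ℂ, ExpDecay g → Filter.Tendsto g Filter.atTop (𝓝 0) := by
    rintro g ⟨c, hc0, hc1, hg⟩
    exact hg.trans_tendsto (tendsto_rpow_atTop_of_base_lt_one c (by linarith) hc1)
  have ht : Filter.Tendsto (fun y : ℝ => (q - p).eval (Complex.I * y)) Filter.atTop (𝓝 0) := by
    have := (key _ hp).sub (key _ hq)
    simpa using this
  have hn : Filter.Tendsto (fun y : ℝ => ‖Complex.I * (y : ℂ)‖) Filter.atTop Filter.atTop := by
    simpa using Filter.tendsto_abs_atTop_atTop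
  have hdeg : ¬ 0 < (q - p).degree := fun hd =>
    not_tendsto_atTop_of_tendsto_nhds ht.norm ((q - p).tendsto_norm_atTop hd hn)
  have hC := Polynomial.eq_C_of_degree_le_zero (not_lt.mp hdeg)
  rw [hC] at ht
  simp only [Polynomial.eval_C] at ht
  have h0 := tendsto_nhds_unique ht tendsto_const_nhds
  rw [← h0, Polynomial.C_0] at hC
  exact sub_eq_zero.mp hC

/-- Two functions holomorphic off a finite set which agree near a point off that set agree off
that set. -/
theorem eq_of_eventuallyEq_off_finite {S : Set ℂ} (hS : S.Finite) {F G : ℂ → ℂ}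
    (hF : DifferentiableOn ℂ F Sᶜ) (hG : DifferentiableOn ℂ G Sᶜ) {z₀ : ℂ} (hz₀ : z₀ ∉ S)
    (h : F =ᶠ[𝓝 z₀] G) : Set.EqOn F G Sᶜ := by
  have hconn : IsPreconnected Sᶜ :=
    (hS.countable.isPathConnected_compl_of_one_lt_rank
      (by rw [Complex.rank_real_complex]; norm_num)).isConnected.isPreconnected
  exact (hF.analyticOnNhd hS.isClosed.isOpen_compl).eqOn_of_preconnected_of_eventuallyEq
    (hG.analyticOnNhd hS.isClosed.isOpen_compl) hconn hz₀ h

theorem genMellin_eq {f : ℝ → ℂ} {S : Set ℂ} {M : ℂ → ℂ} {s : ℂ}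
    (hM : IsMellinContinuation f S M) (hs : s ∉ S) : genMellin f s = M s := by
  have h : MellinHolomorphicAt f s := ⟨M, S, hM, hs⟩
  unfold genMellin
  rw [dif_pos h]
  obtain ⟨S', hN, hs'⟩ := h.choose_spec
  set N := h.choose
  obtain ⟨hSf, hMd, T, A, B, hT, hA, hB, ⟨c, hAc⟩, ⟨d, hBd⟩, hsum⟩ := hM
  obtain ⟨hSf', hNd, T', A', B', hT', hA', hB', ⟨c', hAc'⟩, ⟨d', hBd'⟩, hsum'⟩ := hN
  have hTT : (T ∪ T').Finite := hT.union hT'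
  have hsub : (T ∪ T')ᶜ ⊆ Tᶜ := Set.compl_subset_compl.mpr Set.subset_union_left
  have hsub' : (T ∪ T')ᶜ ⊆ T'ᶜ := Set.compl_subset_compl.mpr Set.subset_union_right
  have exists_pt : ∀ U : Set ℂ, IsOpen U → U.Nonempty → ∀ Q : Set ℂ, Q.Finite →
      ∃ z ∈ U, z ∉ Q := by
    intro U hU hne Q hQ
    have hinf : U.Infinite := by
      obtain ⟨z, hz⟩ := hne
      exact infinite_of_mem_nhds z (hU.mem_nhds hz)
    exact hinf.exists_notMem_finite hQ
  have hAA : Set.EqOn A' A (T ∪ T')ᶜ := by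
    have hU : IsOpen {z : ℂ | z.re < min c c'} :=
      isOpen_lt Complex.continuous_re continuous_const
    obtain ⟨z, hz, hzQ⟩ := exists_pt _ hU
      ⟨((min c c' - 1 : ℝ) : ℂ), by rw [Set.mem_ofPred_eq, Complex.ofReal_re]; linarith⟩
      _ hTT
    refine eq_of_eventuallyEq_off_finite hTT (hA'.mono hsub') (hA.mono hsub) hzQ ?_
    filter_upwards [hU.mem_nhds hz] with w hw
    rw [(hAc w (lt_of_lt_of_le hw (min_le_left _ _))).2,
      (hAc' w (lt_of_lt_of_le hw (min_le_right _ _))).2]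
  have hBB : Set.EqOn B' B (T ∪ T')ᶜ := by
    have hU : IsOpen {z : ℂ | max d d' < z.re} :=
      isOpen_lt continuous_const Complex.continuous_re
    obtain ⟨z, hz, hzQ⟩ := exists_pt _ hU
      ⟨((max d d' + 1 : ℝ) : ℂ), by rw [Set.mem_ofPred_eq, Complex.ofReal_re]; linarith⟩
      _ hTT
    refine eq_of_eventuallyEq_off_finite hTT (hB'.mono hsub') (hB.mono hsub) hzQ ?_
    filter_upwards [hU.mem_nhds hz] with w hw
    rw [(hBd w (lt_of_le_of_lt (le_max_left _ _) hw)).2,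
      (hBd' w (lt_of_le_of_lt (le_max_right _ _) hw)).2]
  have hSS : (S ∪ S').Finite := hSf.union hSf'
  obtain ⟨z, -, hzQ⟩ := exists_pt Set.univ isOpen_univ Set.univ_nonempty _ (hSS.union hTT)
  have hzS : z ∉ S ∪ S' := fun h => hzQ (Or.inl h)
  have hev : N =ᶠ[𝓝 z] M := by
    filter_upwards [(hSS.union hTT).isClosed.isOpen_compl.mem_nhds hzQ] with w hw
    simp only [Set.mem_compl_iff, Set.mem_union, not_or] at hw
    obtain ⟨⟨h1, h2⟩, h3, h4⟩ := hw
    have hw' : w ∈ (T ∪ T')ᶜ := by simp [h3, h4]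
    rw [hsum' w h2 h4, hsum w h1 h3, hAA hw', hBB hw']
  exact eq_of_eventuallyEq_off_finite hSS
    (hNd.mono (Set.compl_subset_compl.mpr Set.subset_union_right))
    (hMd.mono (Set.compl_subset_compl.mpr Set.subset_union_left)) hzS hev
    (by simp [hs, hs'])

end

end EisensteinRZ

/-!
Write `τ = iy`, `a = {u}`, `b = {v}`, and let `E = E^{(2)}_u`, `F` the Eichler integral of
`E^{(ℓ)}_v`, `G_{x₁, x₂} = G^{(ℓ-1)}_{(x₁, x₂)}`. The theorem is an instance of the method of Rogers
and Zudilin: the frequencies of a product of two Eisenstein series, one taken at `τ` and the other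
at `-1/τ`, can be exchanged under the Mellin transform.

*Expansions.* The Kronecker series with a nontrivial character in one variable is continued to a
neighbourhood of `s = k` by summation by parts in that variable (`kroneckerCont`). At `s = k` it is
an iterated sum over the rows of the lattice, which Poisson summation in the form of the Lipschitz
formula (`hasSum_lipschitz`) turns into the `q`-expansion `eisE_eq`; as the continued function
determines `E`, the substitution `(m, n) ↦ (n, -m)` gives the inversion formula `eisE_inv`. For `G`
of weight at least two, the rows of a lattice sum give the `q`-expansion and its columns give the
expansion at the cusp `0` (`gEis_inv`). In weight one (`gEis_one_inv`) the difference of the two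
sides of the inversion formula has derivative zero in each parameter, by the formula in weight two,
and is odd under `(x₁, x₂) ↦ (1 - x₁, 1 - x₂)`. All the series concerned are of the form
`∑ α_m β_n exp(-2π(m + x)(n + z)y)`, and the estimates, the termwise differentiation and the Mellin
transforms are carried out for such a `doubleSeries`.

*Reduction.* By these formulas `E(iy) = -y⁻²(β - A(1/y))` and `F(iy) = -2πγy - B(y)` with constants
`β`, `γ` and exponentially small double series `A`, `B`. Hence
`y² Im(E F) = β Im B(y) - 2πγ y Im A(1/y) - Im(A(1/y) B(y))`. The imaginary part of the regularised
integral is the value at `-1` of the regularised Mellin transform of this function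
(`im_regIntegralDy`). The weight one inversion formula writes `y` times the product of the series
`G` on the right-hand side as
`-i cot(b₂)(G_{v₁, -u₂} + G_{v₁, u₂}) - i cot(a₁)(G_{v₁, -u₂} - G_{v₁, u₂}) + 2K(y)`,
where `cot` stands for `cotFun` and `K` is the `exchangeKernel`.

*Exchange.* The substitution `y ↦ ((n + a)/(r + 1)) y` in each term of the product of two double
series shows that `Im(A(1/y) B(y))` and `K` have the same Mellin transform at `-1`
(`mellin_im_eisTail_mul_eichTail`).

*Boundary terms.* At `-1` the transforms of `y Im A(1/y)` and of `y Im A(y)` agree, so there remain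
`β Im B - (i/2) cot(b₂)(G_{v₁, -u₂} + G_{v₁, u₂})` and
`-2πγ y Im A - (i/2) cot(a₁)(G_{v₁, -u₂} - G_{v₁, u₂})`. The Mellin transform of each is
`(2π)⁻ˢ Γ(s) T(s) V(s)`, where `T` and `V` are combinations of Hurwitz and exponential zeta
functions. Both `T` and `V` vanish at `-1`, by the special values `hurwitzZeta_neg_eq` and
`expZeta_zero`, while `Γ` has only a simple pole there; so the continued transforms vanish at `-1`
(`regMellin_boundary_eichTail`, `regMellin_boundary_eisTail`).
-/

namespace EisensteinRZ

noncomputable section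

open Filter Set MeasureTheory

/-! ### Double exponential series -/

/-- The sequence `α` grows at most like the `N`-th power of the frequency `m + x`. -/
def PolyBounded (x : ℝ) (N : ℕ) (α : ℕ → ℂ) : Prop := ∀ m : ℕ, ‖α m‖ ≤ (m + x) ^ N

/-- The general term of `doubleSeries`. -/
def doubleTerm (x z : ℝ) (α β : ℕ → ℂ) (w : ℂ) (p : ℕ × ℕ) : ℂ :=
  α p.1 * β p.2 * Complex.exp (-((2 * Real.pi * ((p.1 + x) * (p.2 + z)) : ℝ) : ℂ) * w)

/-- The series `∑ α_m β_n exp(-2π (m + x) (n + z) w)` over `m, n ≥ 0`. With `w = y` this is a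
`q`-series at `τ = iy`. -/
def doubleSeries (x z : ℝ) (α β : ℕ → ℂ) (w : ℂ) : ℂ := ∑' p, doubleTerm x z α β w p

theorem norm_doubleTerm (x z : ℝ) (α β : ℕ → ℂ) (w : ℂ) (p : ℕ × ℕ) :
    ‖doubleTerm x z α β w p‖ =
      ‖α p.1‖ * ‖β p.2‖ * Real.exp (-(2 * Real.pi * ((p.1 + x) * (p.2 + z))) * w.re) := by
  rw [doubleTerm, norm_mul, norm_mul, Complex.norm_exp, ← Complex.ofReal_neg,
    Complex.re_ofReal_mul]

theorem summable_shifted_inv_pow {x : ℝ} (hx : 0 < x) (N : ℕ) :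
    Summable fun m : ℕ => ((m + x) ^ (N + 2))⁻¹ := by
  have h := (Real.summable_one_div_nat_add_rpow x ((N + 2 : ℕ) : ℝ)).mpr (by push_cast; linarith)
  refine h.congr fun m => ?_
  rw [abs_of_pos (by positivity), Real.rpow_natCast, one_div]

theorem exp_neg_le_factorial_div_pow {t : ℝ} (ht : 0 < t) (K : ℕ) :
    Real.exp (-t) ≤ K.factorial / t ^ K := by
  have h := Real.pow_div_factorial_le_exp t ht.le K
  have hK : (0 : ℝ) < K.factorial := by positivity
  rw [Real.exp_neg, inv_le_comm₀ (Real.exp_pos _) (by positivity), inv_div]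
  exact h

theorem norm_doubleTerm_le {x z : ℝ} (hx : 0 < x) (hz : 0 < z) {N M : ℕ} {α β : ℕ → ℂ}
    (hα : PolyBounded x N α) (hβ : PolyBounded z M β) {w : ℂ} (hw : 0 < w.re) (p : ℕ × ℕ) :
    ‖doubleTerm x z α β w p‖ ≤
      ((N + M + 2).factorial / (Real.pi * w.re) ^ (N + M + 2) *
        Real.exp (-(Real.pi * (x * z)) * w.re)) *
      (((p.1 + x) ^ (M + 2))⁻¹ * ((p.2 + z) ^ (N + 2))⁻¹) := by
  have h1 : 0 < (p.1 + x : ℝ) := by positivity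
  have h2 : 0 < (p.2 + z : ℝ) := by positivity
  have hl : x * z ≤ (p.1 + x) * (p.2 + z) :=
    mul_le_mul (by simp) (by simp) hz.le h1.le
  set lam : ℝ := (p.1 + x) * (p.2 + z) with hlam
  have hlp : 0 < lam := mul_pos h1 h2
  rw [norm_doubleTerm, show -(2 * Real.pi * lam) * w.re =
    -(Real.pi * lam * w.re) + -(Real.pi * lam * w.re) by ring, Real.exp_add]
  have e1 : Real.exp (-(Real.pi * lam * w.re)) ≤
      (N + M + 2).factorial / (Real.pi * lam * w.re) ^ (N + M + 2) :=
    exp_neg_le_factorial_div_pow (by positivity) _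
  have e2 : Real.exp (-(Real.pi * lam * w.re)) ≤ Real.exp (-(Real.pi * (x * z)) * w.re) := by
    apply Real.exp_le_exp.mpr
    have : Real.pi * (x * z) * w.re ≤ Real.pi * lam * w.re := by gcongr
    linarith
  calc ‖α p.1‖ * ‖β p.2‖ * (Real.exp (-(Real.pi * lam * w.re)) *
        Real.exp (-(Real.pi * lam * w.re)))
      ≤ (p.1 + x) ^ N * (p.2 + z) ^ M *
        ((N + M + 2).factorial / (Real.pi * lam * w.re) ^ (N + M + 2) *
          Real.exp (-(Real.pi * (x * z)) * w.re)) := by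
        gcongr
        · exact hα _
        · exact hβ _
    _ = _ := by
        rw [hlam, mul_pow, mul_pow, mul_pow, mul_pow]
        generalize (p.1 + x : ℝ) = a at *
        generalize (p.2 + z : ℝ) = b at *
        have := hw.ne'
        field_simp
        ring

/-- The (constant) majorant of the series `doubleSeries`. -/
theorem summable_majorant {x z : ℝ} (hx : 0 < x) (hz : 0 < z) (N M : ℕ) :
    Summable fun p : ℕ × ℕ => ((p.1 + x) ^ (M + 2))⁻¹ * ((p.2 + z) ^ (N + 2))⁻¹ :=
  (summable_shifted_inv_pow hx M).mul_of_nonneg (summable_shifted_inv_pow hz N)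
    (fun m => by positivity) (fun m => by positivity)

theorem summable_norm_doubleTerm {x z : ℝ} (hx : 0 < x) (hz : 0 < z) {N M : ℕ} {α β : ℕ → ℂ}
    (hα : PolyBounded x N α) (hβ : PolyBounded z M β) {w : ℂ} (hw : 0 < w.re) :
    Summable fun p => ‖doubleTerm x z α β w p‖ :=
  Summable.of_nonneg_of_le (fun _ => norm_nonneg _) (norm_doubleTerm_le hx hz hα hβ hw)
    ((summable_majorant hx hz N M).mul_left _)

theorem hasSum_doubleSeries {x z : ℝ} (hx : 0 < x) (hz : 0 < z) {N M : ℕ} {α β : ℕ → ℂ}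
    (hα : PolyBounded x N α) (hβ : PolyBounded z M β) {w : ℂ} (hw : 0 < w.re) :
    HasSum (doubleTerm x z α β w) (doubleSeries x z α β w) :=
  (summable_norm_doubleTerm hx hz hα hβ hw).of_norm.hasSum

/-- The series is `O(y^{-K} e^{-δy})`, uniformly in `y > 0`, even after taking absolute values. -/
theorem exists_tsum_norm_doubleTerm_le {x z : ℝ} (hx : 0 < x) (hz : 0 < z) {N M : ℕ}
    {α β : ℕ → ℂ} (hα : PolyBounded x N α) (hβ : PolyBounded z M β) :
    ∃ C δ : ℝ, ∃ K : ℕ, 0 < C ∧ 0 < δ ∧ ∀ y : ℝ, 0 < y →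
      ∑' p, ‖doubleTerm x z α β y p‖ ≤ C * ((y ^ K)⁻¹ * Real.exp (-δ * y)) := by
  set S := ∑' p : ℕ × ℕ, ((p.1 + x) ^ (M + 2))⁻¹ * ((p.2 + z) ^ (N + 2))⁻¹ with hS
  have hS0 : 0 ≤ S := tsum_nonneg fun p => by positivity
  refine ⟨(N + M + 2).factorial / Real.pi ^ (N + M + 2) * S + 1, Real.pi * (x * z), N + M + 2,
    by positivity, by positivity, fun y hy => ?_⟩
  have hy' : 0 < ((y : ℂ)).re := by simpa using hy
  have h := Summable.tsum_le_tsum (norm_doubleTerm_le hx hz hα hβ hy')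
    (summable_norm_doubleTerm hx hz hα hβ hy') ((summable_majorant hx hz N M).mul_left _)
  rw [tsum_mul_left, ← hS] at h
  refine h.trans ?_
  rw [Complex.ofReal_re, mul_pow]
  have : (0 : ℝ) ≤ (y ^ (N + M + 2))⁻¹ * Real.exp (-(Real.pi * (x * z)) * y) := by positivity
  calc _ = ((N + M + 2).factorial / Real.pi ^ (N + M + 2) * S) *
        ((y ^ (N + M + 2))⁻¹ * Real.exp (-(Real.pi * (x * z)) * y)) := by
        field_simp
    _ ≤ _ := by nlinarith

theorem exists_norm_doubleSeries_le {x z : ℝ} (hx : 0 < x) (hz : 0 < z) {N M : ℕ}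
    {α β : ℕ → ℂ} (hα : PolyBounded x N α) (hβ : PolyBounded z M β) :
    ∃ C δ : ℝ, ∃ K : ℕ, 0 < C ∧ 0 < δ ∧ ∀ y : ℝ, 0 < y →
      ‖doubleSeries x z α β y‖ ≤ C * ((y ^ K)⁻¹ * Real.exp (-δ * y)) := by
  obtain ⟨C, δ, K, hC, hδ, h⟩ := exists_tsum_norm_doubleTerm_le hx hz hα hβ
  exact ⟨C, δ, K, hC, hδ, fun y hy => (norm_tsum_le_tsum_norm
    (summable_norm_doubleTerm hx hz hα hβ (by simpa using hy))).trans (h y hy)⟩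

theorem differentiable_doubleTerm (x z : ℝ) (α β : ℕ → ℂ) (p : ℕ × ℕ) :
    Differentiable ℂ fun w => doubleTerm x z α β w p := by
  unfold doubleTerm
  fun_prop

theorem norm_doubleTerm_le_of_le {x z : ℝ} (hx : 0 < x) (hz : 0 < z) (α β : ℕ → ℂ) {ε : ℝ}
    {w : ℂ} (hw : ε ≤ w.re) (p : ℕ × ℕ) :
    ‖doubleTerm x z α β w p‖ ≤ ‖doubleTerm x z α β ε p‖ := by
  rw [norm_doubleTerm, norm_doubleTerm, Complex.ofReal_re]
  have h1 : 0 < (p.1 + x : ℝ) := by positivity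
  have h2 : 0 < (p.2 + z : ℝ) := by positivity
  have : 0 < 2 * Real.pi * ((p.1 + x) * (p.2 + z)) := by positivity
  refine mul_le_mul_of_nonneg_left (Real.exp_le_exp.mpr ?_) (by positivity)
  nlinarith

/-- Termwise differentiation of the double series. -/
theorem hasDerivAt_doubleSeries {x z : ℝ} (hx : 0 < x) (hz : 0 < z) {N M : ℕ} {α β : ℕ → ℂ}
    (hα : PolyBounded x N α) (hβ : PolyBounded z M β) {w : ℂ} (hw : 0 < w.re) :
    HasDerivAt (doubleSeries x z α β)
      (-(2 * Real.pi) * doubleSeries x z (fun m => α m * (m + x)) (fun n => β n * (n + z)) w)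
      w := by
  set U : Set ℂ := {v : ℂ | w.re / 2 < v.re} with hU
  have hUo : IsOpen U := isOpen_lt continuous_const Complex.continuous_re
  have hwU : w ∈ U := show w.re / 2 < w.re by linarith
  have hs : Summable fun p => ‖doubleTerm x z α β ((w.re / 2 : ℝ) : ℂ) p‖ :=
    summable_norm_doubleTerm hx hz hα hβ (by rw [Complex.ofReal_re]; linarith)
  have hle : ∀ (p : ℕ × ℕ) (v : ℂ), v ∈ U →
      ‖doubleTerm x z α β v p‖ ≤ ‖doubleTerm x z α β ((w.re / 2 : ℝ) : ℂ) p‖ :=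
    fun p v hv => norm_doubleTerm_le_of_le hx hz α β (le_of_lt hv) p
  have hdiff : ∀ p : ℕ × ℕ, DifferentiableOn ℂ (fun v => doubleTerm x z α β v p) U :=
    fun p => (differentiable_doubleTerm x z α β p).differentiableOn
  have hd := Complex.differentiableOn_tsum_of_summable_norm hs hdiff hUo hle
  have hsum := Complex.hasSum_deriv_of_summable_norm hs hdiff hUo hle hwU
  have hda := (hd.differentiableAt (hUo.mem_nhds hwU)).hasDerivAt
  have heq : deriv (fun v => ∑' p, doubleTerm x z α β v p) w =
      -(2 * Real.pi) * doubleSeries x z (fun m => α m * (m + x)) (fun n => β n * (n + z)) w := by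
    rw [← hsum.tsum_eq, doubleSeries, ← tsum_mul_left]
    refine tsum_congr fun p => ?_
    have : HasDerivAt (fun v => doubleTerm x z α β v p)
        (α p.1 * β p.2 * (Complex.exp (-((2 * Real.pi * ((p.1 + x) * (p.2 + z)) : ℝ) : ℂ) * w) *
          (-((2 * Real.pi * ((p.1 + x) * (p.2 + z)) : ℝ) : ℂ) * 1))) w :=
      (((hasDerivAt_id w).const_mul _).cexp).const_mul _
    rw [this.deriv, doubleTerm]
    push_cast
    ring
  rw [heq] at hda
  exact hda

theorem differentiableOn_doubleSeries {x z : ℝ} (hx : 0 < x) (hz : 0 < z) {N M : ℕ}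
    {α β : ℕ → ℂ} (hα : PolyBounded x N α) (hβ : PolyBounded z M β) :
    DifferentiableOn ℂ (doubleSeries x z α β) {w : ℂ | 0 < w.re} := fun _ hw =>
  (hasDerivAt_doubleSeries hx hz hα hβ hw).differentiableAt.differentiableWithinAt

theorem contDiffOn_doubleSeries {x z : ℝ} (hx : 0 < x) (hz : 0 < z) {N M : ℕ}
    {α β : ℕ → ℂ} (hα : PolyBounded x N α) (hβ : PolyBounded z M β) :
    ContDiffOn ℝ ∞ (fun y : ℝ => doubleSeries x z α β y) (Ioi 0) := by
  have hopen : IsOpen {w : ℂ | 0 < w.re} := isOpen_lt continuous_const Complex.continuous_re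
  have h : ContDiffOn ℂ ∞ (doubleSeries x z α β) {w : ℂ | 0 < w.re} :=
    (differentiableOn_doubleSeries hx hz hα hβ).contDiffOn hopen
  exact (h.restrict_scalars ℝ).comp Complex.ofRealCLM.contDiff.contDiffOn
    fun y hy => by simpa using hy

theorem expDecay_of_norm_le {g : ℝ → ℂ} {C δ : ℝ} {K : ℕ} (hδ : 0 < δ)
    (h : ∀ y : ℝ, 0 < y → ‖g y‖ ≤ C * ((y ^ K)⁻¹ * Real.exp (-δ * y))) : ExpDecay g := by
  have hexp : ∀ y : ℝ, Real.exp (-δ) ^ y = Real.exp (-δ * y) := fun y => by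
    rw [← Real.exp_mul]
  refine ⟨Real.exp (-δ), Real.exp_pos _, Real.exp_lt_one_iff.mpr (by linarith),
    Asymptotics.IsBigO.of_bound |C| ?_⟩
  filter_upwards [eventually_ge_atTop 1] with y hy
  rw [hexp, Real.norm_of_nonneg (Real.exp_pos _).le]
  refine (h y (by linarith)).trans ?_
  have h1 : (y ^ K)⁻¹ ≤ 1 := inv_le_one_of_one_le₀ (one_le_pow₀ hy)
  have h2 : (0 : ℝ) ≤ (y ^ K)⁻¹ := by positivity
  have h3 := Real.exp_pos (-δ * y)
  calc C * ((y ^ K)⁻¹ * Real.exp (-δ * y)) ≤ |C| * ((y ^ K)⁻¹ * Real.exp (-δ * y)) := by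
        gcongr; exact le_abs_self C
    _ ≤ |C| * (1 * Real.exp (-δ * y)) := by gcongr
    _ = _ := by rw [one_mul]

theorem expDecay_doubleSeries {x z : ℝ} (hx : 0 < x) (hz : 0 < z) {N M : ℕ}
    {α β : ℕ → ℂ} (hα : PolyBounded x N α) (hβ : PolyBounded z M β) :
    ExpDecay fun y : ℝ => doubleSeries x z α β y := by
  obtain ⟨C, δ, K, -, hδ, h⟩ := exists_norm_doubleSeries_le hx hz hα hβ
  exact expDecay_of_norm_le hδ h

theorem conj_doubleSeries (x z : ℝ) (α β : ℕ → ℂ) (y : ℝ) :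
    starRingEnd ℂ (doubleSeries x z α β y) =
      doubleSeries x z (fun m => starRingEnd ℂ (α m)) (fun n => starRingEnd ℂ (β n)) y := by
  rw [doubleSeries, doubleSeries, Complex.conj_tsum]
  refine tsum_congr fun p => ?_
  simp only [doubleTerm, map_mul, ← Complex.exp_conj, map_neg, Complex.conj_ofReal]

theorem doubleSeries_swap (x z : ℝ) (α β : ℕ → ℂ) (w : ℂ) :
    doubleSeries x z α β w = doubleSeries z x β α w := by
  rw [doubleSeries, doubleSeries, ← (Equiv.prodComm ℕ ℕ).tsum_eq]
  refine tsum_congr fun p => ?_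
  simp only [doubleTerm, Equiv.prodComm_apply, Prod.fst_swap, Prod.snd_swap]
  rw [mul_comm (α p.2), mul_comm (p.2 + x : ℝ)]

/-! ### Functions of exponential decay -/

theorem ExpDecay.exists_exp {g : ℝ → ℂ} (hg : ExpDecay g) :
    ∃ δ : ℝ, 0 < δ ∧ g =O[atTop] fun y : ℝ => Real.exp (-δ * y) := by
  obtain ⟨c, h0, h1, h⟩ := hg
  refine ⟨-Real.log c, by linarith [Real.log_neg h0 h1], h.congr_right fun y => ?_⟩
  rw [neg_neg, Real.rpow_def_of_pos h0]

theorem expDecay_of_exp {g : ℝ → ℂ} {δ : ℝ} (hδ : 0 < δ)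
    (hg : g =O[atTop] fun y : ℝ => Real.exp (-δ * y)) : ExpDecay g :=
  ⟨Real.exp (-δ), Real.exp_pos _, Real.exp_lt_one_iff.mpr (by linarith),
    hg.congr_right fun y => by rw [← Real.exp_mul]⟩

theorem ExpDecay.add {f g : ℝ → ℂ} (hf : ExpDecay f) (hg : ExpDecay g) :
    ExpDecay fun y => f y + g y := by
  obtain ⟨a, ha, hfa⟩ := hf.exists_exp
  obtain ⟨b, hb, hgb⟩ := hg.exists_exp
  have key : ∀ c : ℝ, min a b ≤ c → (fun y : ℝ => Real.exp (-c * y)) =O[atTop]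
      fun y : ℝ => Real.exp (-min a b * y) := fun c hc => by
    refine Asymptotics.IsBigO.of_bound 1 ?_
    filter_upwards [eventually_ge_atTop 0] with y hy
    rw [one_mul, Real.norm_of_nonneg (Real.exp_pos _).le, Real.norm_of_nonneg (Real.exp_pos _).le]
    exact Real.exp_le_exp.mpr (by nlinarith)
  exact expDecay_of_exp (lt_min ha hb)
    ((hfa.trans (key a (min_le_left _ _))).add (hgb.trans (key b (min_le_right _ _))))

/-- Multiplication by a function of at most polynomial growth preserves exponential decay. -/
theorem ExpDecay.mul_of_isBigO {f g : ℝ → ℂ} (hf : ExpDecay f) {N : ℝ}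
    (hg : g =O[atTop] fun y : ℝ => y ^ N) : ExpDecay fun y => g y * f y := by
  obtain ⟨a, ha, hfa⟩ := hf.exists_exp
  have h1 : (fun y : ℝ => y ^ N) =O[atTop] fun y : ℝ => Real.exp (a / 2 * y) :=
    (isLittleO_rpow_exp_pos_mul_atTop N (by linarith)).isBigO
  refine expDecay_of_exp (half_pos ha) (((hg.trans h1).mul hfa).congr_right fun y => ?_)
  rw [← Real.exp_add]
  ring_nf

theorem ExpDecay.const_mul {f : ℝ → ℂ} (hf : ExpDecay f) (c : ℂ) :
    ExpDecay fun y => c * f y :=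
  hf.mul_of_isBigO (N := 0)
    (by simpa using Asymptotics.isBigO_const_const (α := ℝ) c (one_ne_zero (α := ℝ)) atTop)

theorem ExpDecay.neg {f : ℝ → ℂ} (hf : ExpDecay f) : ExpDecay fun y => -f y := by
  simpa using hf.const_mul (-1)

theorem ExpDecay.sub {f g : ℝ → ℂ} (hf : ExpDecay f) (hg : ExpDecay g) :
    ExpDecay fun y => f y - g y := by
  simpa [sub_eq_add_neg] using hf.add hg.neg

theorem ExpDecay.pow_mul {f : ℝ → ℂ} (hf : ExpDecay f) (n : ℕ) :
    ExpDecay fun y => (y : ℂ) ^ n * f y :=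
  hf.mul_of_isBigO (N := n) (Asymptotics.IsBigO.of_bound 1 (Eventually.of_forall fun y => by
    simp))

theorem ExpDecay.isBigO_one {f : ℝ → ℂ} (hf : ExpDecay f) :
    f =O[atTop] fun _ : ℝ => (1 : ℝ) := by
  obtain ⟨a, ha, hfa⟩ := hf.exists_exp
  refine hfa.trans (Asymptotics.IsBigO.of_bound 1 ?_)
  filter_upwards [eventually_ge_atTop 0] with y hy
  rw [Real.norm_of_nonneg (Real.exp_pos _).le, norm_one, one_mul]
  exact Real.exp_le_one_iff.mpr (by nlinarith)

theorem ExpDecay.mul {f g : ℝ → ℂ} (hf : ExpDecay f) (hg : ExpDecay g) :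
    ExpDecay fun y => f y * g y :=
  hg.mul_of_isBigO (N := 0) (by simpa using hf.isBigO_one)

theorem ExpDecay.congr {f g : ℝ → ℂ} (hf : ExpDecay f) (h : ∀ y : ℝ, 0 < y → g y = f y) :
    ExpDecay g := by
  obtain ⟨c, h0, h1, hf⟩ := hf
  refine ⟨c, h0, h1, hf.congr' ?_ EventuallyEq.rfl⟩
  filter_upwards [eventually_gt_atTop 0] with y hy
  exact (h y hy).symm

theorem ExpDecay.ofReal_im {f : ℝ → ℂ} (hf : ExpDecay f) :
    ExpDecay fun y => ((f y).im : ℂ) := by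
  obtain ⟨c, h0, h1, hf⟩ := hf
  refine ⟨c, h0, h1, (Asymptotics.IsBigO.of_bound 1 (Eventually.of_forall fun y => ?_)).trans hf⟩
  simpa using Complex.abs_im_le_norm (f y)

/-! ### The Lipschitz formula with a character -/

theorem integrableOn_pow_mul_cexp (n : ℕ) {r : ℂ} (hr : 0 < r.re) :
    IntegrableOn (fun t : ℝ => (t : ℂ) ^ n * Complex.exp (-r * t)) (Ioi 0) := by
  have h := integrableOn_rpow_mul_exp_neg_mul_rpow (p := 1) (s := n) (b := r.re)
    (by have : (0 : ℝ) ≤ n := by positivity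
        linarith) zero_lt_one hr
  refine Integrable.mono' h (by fun_prop) ?_
  filter_upwards [ae_restrict_mem measurableSet_Ioi] with t ht
  rw [norm_mul, norm_pow, Complex.norm_real, Complex.norm_exp, Real.norm_of_nonneg (le_of_lt ht),
    Real.rpow_natCast, Real.rpow_one]
  simp

theorem integral_pow_mul_cexp (n : ℕ) {r : ℂ} (hr : 0 < r.re) :
    ∫ t : ℝ in Ioi 0, (t : ℂ) ^ n * Complex.exp (-r * t) = n.factorial / r ^ (n + 1) := by
  have hr0 : r ≠ 0 := fun h => by simp [h] at hr
  induction n with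
  | zero =>
    have := integral_exp_mul_complex_Ioi (a := -r) (by simpa using hr) 0
    simp only [pow_zero, one_mul]
    rw [this]
    simp
  | succ n ih =>
    have hd : ∀ t : ℝ, HasDerivAt (fun t : ℝ => (t : ℂ) ^ (n + 1) * Complex.exp (-r * t))
        ((n + 1) * ((t : ℂ) ^ n * Complex.exp (-r * t)) -
          r * ((t : ℂ) ^ (n + 1) * Complex.exp (-r * t))) t := fun t => by
      have h1 : HasDerivAt (fun s : ℂ => s ^ (n + 1) * Complex.exp (-r * s))
          (((n + 1 : ℕ) : ℂ) * (t : ℂ) ^ n * Complex.exp (-r * t) +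
            (t : ℂ) ^ (n + 1) * (Complex.exp (-r * t) * (-r * 1))) (t : ℂ) :=
        (hasDerivAt_pow (n + 1) (t : ℂ)).mul (((hasDerivAt_id _).const_mul _).cexp)
      convert! h1.comp_ofReal using 1
      push_cast
      ring
    have ht : Tendsto (fun t : ℝ => (t : ℂ) ^ (n + 1) * Complex.exp (-r * t)) atTop (𝓝 0) := by
      rw [tendsto_zero_iff_norm_tendsto_zero]
      refine (tendsto_rpow_mul_exp_neg_mul_atTop_nhds_zero (n + 1 : ℕ) r.re hr).congr' ?_
      filter_upwards [eventually_gt_atTop 0] with t ht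
      rw [norm_mul, norm_pow, Complex.norm_real, Complex.norm_exp, Real.norm_of_nonneg ht.le,
        Real.rpow_natCast]
      simp
    have hi1 := (integrableOn_pow_mul_cexp n hr).const_mul ((n : ℂ) + 1)
    have hi2 := (integrableOn_pow_mul_cexp (n + 1) hr).const_mul r
    have key := integral_Ioi_of_hasDerivAt_of_tendsto' (a := 0) (fun t _ => hd t)
      (hi1.sub hi2) ht
    rw [integral_sub hi1 hi2, integral_const_mul, integral_const_mul, ih] at key
    have h2 : r * ∫ t : ℝ in Ioi 0, (t : ℂ) ^ (n + 1) * Complex.exp (-r * t) =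
        (n + 1) * (n.factorial / r ^ (n + 1)) := by
      have h0 : ((0 : ℝ) : ℂ) ^ (n + 1) * Complex.exp (-r * (0 : ℝ)) = 0 := by simp
      rw [h0] at key
      linear_combination -key
    rw [Nat.factorial_succ]
    push_cast
    field_simp at h2 ⊢
    linear_combination h2

/-- The function whose Poisson summation yields the Lipschitz formula. -/
def lipschitzFun (k : ℕ) (z : ℂ) (t : ℝ) : ℂ :=
  if 0 < t then (t : ℂ) ^ (k + 1) * e (t * z) else 0

theorem lipschitzFun_of_nonneg (k : ℕ) (z : ℂ) {t : ℝ} (ht : 0 ≤ t) :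
    lipschitzFun k z t = (t : ℂ) ^ (k + 1) * e (t * z) := by
  rcases ht.eq_or_lt with rfl | h
  · simp [lipschitzFun]
  · rw [lipschitzFun, if_pos h]

theorem continuous_lipschitzFun (k : ℕ) (z : ℂ) : Continuous (lipschitzFun k z) := by
  have h : lipschitzFun k z = fun t => ((max t 0 : ℝ) : ℂ) ^ (k + 1) * e ((max t 0 : ℝ) * z) := by
    ext t
    rcases le_or_gt t 0 with h | h
    · simp [lipschitzFun, h]
    · simp [lipschitzFun, h, h.le]
  rw [h]
  unfold e
  fun_prop

theorem fourier_lipschitzFun (k : ℕ) {z : ℂ} (hz : 0 < z.im) (w : ℝ) :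
    FourierTransform.fourier (lipschitzFun k z) w =
      (k + 1).factorial / (-(2 * Real.pi * Complex.I)) ^ (k + 2) * ((z - w) ^ (k + 2))⁻¹ := by
  have hr : 0 < (-(2 * Real.pi * Complex.I) * (z - w)).re := by
    have : (-(2 * Real.pi * Complex.I) * (z - w)).re = 2 * Real.pi * z.im := by simp
    rw [this]
    positivity
  have key : ∫ v : ℝ, Complex.exp (((-2 * Real.pi * v * w : ℝ) : ℂ) * Complex.I) •
      lipschitzFun k z v =
      ∫ t : ℝ in Ioi 0, (t : ℂ) ^ (k + 1) *
        Complex.exp (-(-(2 * Real.pi * Complex.I) * (z - w)) * t) := by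
    rw [← integral_indicator measurableSet_Ioi]
    congr 1
    ext v
    by_cases hv : 0 < v
    · rw [indicator_of_mem (show v ∈ Ioi 0 from hv), lipschitzFun, if_pos hv, smul_eq_mul, e,
        mul_left_comm, ← Complex.exp_add]
      push_cast
      ring_nf
    · rw [indicator_of_notMem (show v ∉ Ioi 0 from hv), lipschitzFun, if_neg hv, smul_zero]
  rw [Real.fourier_real_eq_integral_exp_smul, key,
    integral_pow_mul_cexp (k + 1) hr, mul_pow, ← div_eq_mul_inv, div_div]

theorem isBigO_lipschitzFun (k : ℕ) {z : ℂ} (hz : 0 < z.im) :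
    lipschitzFun k z =O[cocompact ℝ] fun t : ℝ => |t| ^ (-2 : ℝ) := by
  rw [cocompact_eq_atBot_atTop, Asymptotics.isBigO_sup]
  constructor
  · refine Asymptotics.IsBigO.of_bound 0 ?_
    filter_upwards [eventually_le_atBot 0] with t ht
    simp [lipschitzFun, not_lt.mpr ht]
  · have h := (isLittleO_exp_neg_mul_rpow_atTop (a := 2 * Real.pi * z.im) (by positivity)
      (-2 - (k + 1 : ℕ))).isBigO
    have h2 : (fun t : ℝ => t ^ (k + 1)) =O[atTop] fun t : ℝ => t ^ (k + 1) :=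
      Asymptotics.isBigO_refl _ _
    refine Asymptotics.IsBigO.trans (Asymptotics.IsBigO.of_bound 1 ?_)
      ((h2.mul h).congr' EventuallyEq.rfl ?_)
    · filter_upwards [eventually_gt_atTop 0] with t ht
      rw [lipschitzFun, if_pos ht, norm_mul, norm_pow, Complex.norm_real, e, Complex.norm_exp,
        one_mul, norm_mul, norm_pow, Real.norm_of_nonneg (Real.exp_pos _).le]
      simp
      ring_nf
      rfl
    · filter_upwards [eventually_gt_atTop 0] with t ht
      rw [abs_of_pos ht, ← Real.rpow_natCast t (k + 1), ← Real.rpow_add ht]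
      congr 1
      ring

theorem summable_inv_add_intCast_pow (z : ℂ) (k : ℕ) :
    Summable fun n : ℤ => ((z + n) ^ (k + 2))⁻¹ := by
  refine (EisensteinSeries.linear_right_summable z 1 (k := ((k + 2 : ℕ) : ℤ))
    (by simp)).congr fun n => ?_
  rw [zpow_natCast, Int.cast_one, one_mul]

/-- The Lipschitz formula twisted by the character `n ↦ e(-nx)`: Poisson summation applied to
`t ↦ t^{k+1} e(tz)` on the positive half-line. -/
theorem hasSum_lipschitz (k : ℕ) {z : ℂ} (hz : 0 < z.im) {x : ℝ} (hx : 0 < x) (hx1 : x ≤ 1) :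
    HasSum (fun n : ℤ => e (-(n * x)) * ((z + n) ^ (k + 2))⁻¹)
      ((-(2 * Real.pi * Complex.I)) ^ (k + 2) / (k + 1).factorial *
        ∑' n : ℕ, ((n : ℂ) + x) ^ (k + 1) * e (((n : ℂ) + x) * z)) := by
  have hpi : (-(2 * Real.pi * Complex.I)) ^ (k + 2) ≠ 0 := by
    simp [Real.pi_ne_zero, Complex.I_ne_zero]
  have hfac : ((k + 1).factorial : ℂ) ≠ 0 := by exact_mod_cast (k + 1).factorial_ne_zero
  have hsum := summable_inv_add_intCast_pow z k
  have hF : ∀ n : ℤ, FourierTransform.fourier (lipschitzFun k z) n =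
      (k + 1).factorial / (-(2 * Real.pi * Complex.I)) ^ (k + 2) * ((z - n) ^ (k + 2))⁻¹ :=
    fun n => by simpa using fourier_lipschitzFun k hz n
  have hsumF : Summable fun n : ℤ => FourierTransform.fourier (lipschitzFun k z) n := by
    simp only [hF]
    refine Summable.mul_left _ ?_
    simpa [Function.comp_def, sub_eq_add_neg] using (Equiv.neg ℤ).summable_iff.mpr hsum
  have hnorm : ∀ n : ℤ, ‖e (-(n * x))‖ = 1 := fun n => by
    rw [e, Complex.norm_exp]
    simp
  have hS : Summable fun n : ℤ => e (-(n * x)) * ((z + n) ^ (k + 2))⁻¹ := by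
    refine Summable.of_norm (hsum.norm.congr fun n => ?_)
    rw [norm_mul, hnorm, one_mul]
  have hP := Real.tsum_eq_tsum_fourier_of_rpow_decay_of_summable (continuous_lipschitzFun k z)
    one_lt_two (isBigO_lipschitzFun k hz) hsumF x
  have hL : ∑' n : ℤ, lipschitzFun k z (x + n) =
      ∑' n : ℕ, ((n : ℂ) + x) ^ (k + 1) * e (((n : ℂ) + x) * z) := by
    rw [← (Nat.cast_injective (R := ℤ)).tsum_eq]
    · refine tsum_congr fun n => ?_
      rw [lipschitzFun_of_nonneg k z (by positivity)]
      push_cast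
      rw [add_comm]
    · intro n hn
      by_contra h
      have hn0 : n < 0 := by
        by_contra h'
        exact h ⟨n.toNat, by simp [not_lt.mp h']⟩
      have hn1 : (n : ℝ) ≤ -1 := by exact_mod_cast Int.le_sub_one_of_lt hn0
      exact hn (by simp only [lipschitzFun]; rw [if_neg (by linarith)])
  have hR : ∑' n : ℤ, FourierTransform.fourier (lipschitzFun k z) n *
        fourier n (x : UnitAddCircle) =
      (k + 1).factorial / (-(2 * Real.pi * Complex.I)) ^ (k + 2) *
        ∑' n : ℤ, e (-(n * x)) * ((z + n) ^ (k + 2))⁻¹ := by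
    rw [← (Equiv.neg ℤ).tsum_eq, ← tsum_mul_left]
    refine tsum_congr fun n => ?_
    rw [Equiv.neg_apply, hF, fourier_coe_apply, e]
    push_cast
    rw [sub_neg_eq_add, div_one]
    ring_nf
  rw [hL, hR] at hP
  rw [hP]
  convert hS.hasSum using 1
  generalize ∑' n : ℤ, e (-(n * x)) * ((z + n) ^ (k + 2))⁻¹ = T
  field_simp

theorem norm_e_ofReal (x : ℝ) : ‖e x‖ = 1 := by
  rw [e, Complex.norm_exp]
  simp

theorem e_add (z w : ℂ) : e (z + w) = e z * e w := by
  rw [e, e, e, ← Complex.exp_add]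
  ring_nf

theorem e_intCast (n : ℤ) : e n = 1 := by
  rw [e, show 2 * (Real.pi : ℂ) * Complex.I * n = n * (2 * Real.pi * Complex.I) by ring]
  exact Complex.exp_int_mul_two_pi_mul_I n

theorem e_ne_zero (z : ℂ) : e z ≠ 0 := Complex.exp_ne_zero _

theorem e_neg (z : ℂ) : e (-z) = (e z)⁻¹ := by
  rw [e, e, ← Complex.exp_neg]
  ring_nf

theorem conj_e (x : ℝ) : starRingEnd ℂ (e x) = e (-x) := by
  rw [e, e, ← Complex.exp_conj]
  simp [map_ofNat]

/-- `e(a) ≠ 1` for `0 < a < 1`. -/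
theorem e_ne_one {a : ℝ} (h0 : 0 < a) (h1 : a < 1) : e a ≠ 1 := by
  intro h
  rw [e, Complex.exp_eq_one_iff] at h
  obtain ⟨n, hn⟩ := h
  have hp : (2 * Real.pi * Complex.I : ℂ) ≠ 0 := by simp [Real.pi_ne_zero, Complex.I_ne_zero]
  have h2 : (a : ℂ) = n := by
    have : (2 * Real.pi * Complex.I : ℂ) * a = (2 * Real.pi * Complex.I) * n := by
      rw [hn]; ring
    exact mul_left_cancel₀ hp this
  have h3 : a = n := by exact_mod_cast h2
  rw [h3] at h0 h1
  have h4 : (0 : ℤ) < n := by exact_mod_cast h0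
  have h5 : n < (1 : ℤ) := by exact_mod_cast h1
  omega

/-! ### Summation by parts over a lattice -/

theorem exists_mul_max_le_norm {τ : ℂ} (hτ : 0 < τ.im) :
    ∃ c : ℝ, 0 < c ∧ ∀ u v : ℝ, c * max |u| |v| ≤ ‖(u : ℂ) * τ + v‖ := by
  have hn : 0 < ‖τ‖ := lt_of_lt_of_le hτ ((le_abs_self _).trans (Complex.abs_im_le_norm τ))
  have hd : 0 < 1 + ‖τ‖ / τ.im := by positivity
  refine ⟨min τ.im (1 + ‖τ‖ / τ.im)⁻¹, lt_min hτ (inv_pos.mpr hd), fun u v => ?_⟩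
  have h1 : |u| * τ.im ≤ ‖(u : ℂ) * τ + v‖ := by
    have h := Complex.abs_im_le_norm ((u : ℂ) * τ + v)
    simpa [abs_mul, abs_of_pos hτ] using h
  have h2 : |v| ≤ ‖(u : ℂ) * τ + v‖ * (1 + ‖τ‖ / τ.im) := by
    have h3 : ‖(v : ℂ)‖ ≤ ‖(u : ℂ) * τ + v‖ + ‖(u : ℂ) * τ‖ := by
      have := norm_sub_le ((u : ℂ) * τ + v) ((u : ℂ) * τ)
      rwa [add_sub_cancel_left] at this
    rw [Complex.norm_real, norm_mul, Complex.norm_real, Real.norm_eq_abs, Real.norm_eq_abs] at h3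
    have h4 : |u| * ‖τ‖ ≤ ‖(u : ℂ) * τ + v‖ * (‖τ‖ / τ.im) := by
      rw [mul_div_assoc', le_div_iff₀ hτ]
      nlinarith
    linarith
  rcases max_cases |u| |v| with ⟨h, -⟩ | ⟨h, -⟩ <;> rw [h]
  · refine (mul_le_mul_of_nonneg_right (min_le_left _ _) (abs_nonneg _)).trans ?_
    linarith
  · refine (mul_le_mul_of_nonneg_right (min_le_right _ _) (abs_nonneg _)).trans ?_
    rw [inv_mul_le_iff₀ hd]
    linarith

theorem norm_int_prod (p : ℤ × ℤ) : ‖p‖ = max |(p.1 : ℝ)| |(p.2 : ℝ)| := by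
  rw [Prod.norm_def, Int.norm_eq_abs, Int.norm_eq_abs]

/-- Lower bound for the lattice points, shifted by `aτ` and moved back by at most one. -/
theorem exists_mul_norm_le_lattice {τ : ℂ} (hτ : 0 < τ.im) :
    ∃ c : ℝ, 0 < c ∧ ∀ a t : ℝ, 0 ≤ a → a ≤ 1 → -1 ≤ t → t ≤ 0 → ∀ p : ℤ × ℤ, 2 ≤ ‖p‖ →
      c * ‖p‖ ≤ ‖((p.1 : ℂ) + a) * τ + p.2 + t‖ := by
  obtain ⟨c, hc, h⟩ := exists_mul_max_le_norm hτ
  refine ⟨c / 2, by positivity, fun a t ha0 ha1 ht1 ht0 p hp => ?_⟩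
  have h1 := h (p.1 + a) (p.2 + t)
  have h2 : ‖p‖ / 2 ≤ max |(p.1 : ℝ) + a| |(p.2 : ℝ) + t| := by
    rw [norm_int_prod] at hp ⊢
    rcases max_cases |(p.1 : ℝ)| |(p.2 : ℝ)| with ⟨he, -⟩ | ⟨he, -⟩ <;> rw [he] at hp ⊢
    · refine le_max_of_le_left ?_
      cases abs_cases (p.1 : ℝ) <;> cases abs_cases ((p.1 : ℝ) + a) <;> linarith
    · refine le_max_of_le_right ?_
      cases abs_cases (p.2 : ℝ) <;> cases abs_cases ((p.2 : ℝ) + t) <;> linarith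
  push_cast at h1
  calc c / 2 * ‖p‖ = c * (‖p‖ / 2) := by ring
    _ ≤ c * max |(p.1 : ℝ) + a| |(p.2 : ℝ) + t| := by gcongr
    _ ≤ _ := by rw [add_assoc]; exact h1

theorem summable_norm_rpow_int_prod {ρ : ℝ} (hρ : 2 < ρ) :
    Summable fun p : ℤ × ℤ => ‖p‖ ^ (-ρ) := by
  have h := EisensteinSeries.summable_one_div_norm_rpow hρ
  rw [← (finTwoArrowEquiv ℤ).symm.summable_iff] at h
  refine h.congr fun p => ?_
  simp only [Function.comp_apply, finTwoArrowEquiv_symm_apply]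
  congr 1
  rw [EisensteinSeries.norm_eq_max_natAbs, norm_int_prod]
  simp [Nat.cast_natAbs]

/-- The points of `ℤ²` of sup norm less than two form a finite set. -/
theorem eventually_two_le_norm : ∀ᶠ p : ℤ × ℤ in cofinite, 2 ≤ ‖p‖ := by
  have h : Tendsto (fun p : ℤ × ℤ => ‖p‖) cofinite atTop := by
    rw [← cocompact_eq_cofinite]
    exact tendsto_norm_cocompact_atTop
  exact h.eventually_ge_atTop 2

theorem norm_e_sub (m n : ℤ) (b x : ℝ) : ‖e (m * b - n * x)‖ = 1 := by
  simpa using norm_e_ofReal (m * b - n * x)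

/-- Summation by parts for a summable two-sided sequence and a character of `ℤ`. -/
theorem tsum_char_mul_diff {f : ℤ → ℂ} (hf : Summable f) (x c : ℝ) :
    ∑' n : ℤ, e (c - n * x) * (f n - f (n - 1)) =
      (1 - e (-x)) * ∑' n : ℤ, e (c - n * x) * f n := by
  have hchar : ∀ n : ℤ, ‖e (c - n * x)‖ = 1 := fun n => by
    simpa using norm_e_ofReal (c - n * x)
  have hr : Summable fun n : ℤ => e (c - n * x) * f n := by
    refine Summable.of_norm (hf.norm.congr fun n => ?_)
    rw [norm_mul, hchar, one_mul]
  have hr' : Summable fun n : ℤ => e (c - n * x) * f (n - 1) := by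
    refine Summable.of_norm ((((Equiv.subRight (1 : ℤ)).summable_iff.mpr hf).norm).congr
      fun n => ?_)
    rw [norm_mul, hchar, one_mul]
    rfl
  have hshift : ∑' n : ℤ, e (c - n * x) * f (n - 1) =
      e (-x) * ∑' n : ℤ, e (c - n * x) * f n := by
    rw [← (Equiv.addRight (1 : ℤ)).tsum_eq, ← tsum_mul_left]
    refine tsum_congr fun n => ?_
    rw [Equiv.coe_addRight, add_sub_cancel_right, ← mul_assoc, ← e_add]
    push_cast
    ring_nf
  simp only [mul_sub]
  rw [hr.tsum_sub hr', hshift]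
  ring

/-- Summation by parts along the rows of a lattice sum: the rows of `h` are summable, and the
differences of consecutive terms of the rows are absolutely summable over the lattice. -/
theorem hasSum_rows_of_summable_diff {h : ℤ × ℤ → ℂ} {x : ℝ} (b : ℝ) (hx : e (-x) ≠ 1)
    (hrow : ∀ m : ℤ, Summable fun n : ℤ => h (m, n))
    (hdiff : Summable fun p : ℤ × ℤ => ‖h p - h (p.1, p.2 - 1)‖) :
    HasSum (fun m : ℤ => ∑' n : ℤ, e (m * b - n * x) * h (m, n))
      ((1 - e (-x))⁻¹ * ∑' p : ℤ × ℤ, e (p.1 * b - p.2 * x) * (h p - h (p.1, p.2 - 1))) := by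
  have hne : 1 - e (-x) ≠ 0 := sub_ne_zero.mpr (Ne.symm hx)
  have hs : Summable fun p : ℤ × ℤ => e (p.1 * b - p.2 * x) * (h p - h (p.1, p.2 - 1)) := by
    refine Summable.of_norm (hdiff.congr fun p => ?_)
    rw [norm_mul, norm_e_sub, one_mul]
  have h1 := (hs.hasSum.prod_fiberwise fun m => (hs.prod_factor m).hasSum).mul_left
    (1 - e (-x))⁻¹
  convert! h1 using 1
  ext m
  have h2 := tsum_char_mul_diff (hrow m) x (m * b)
  push_cast at h2
  rw [h2, inv_mul_cancel_left₀ hne]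

/-! ### Analytic continuation of the Kronecker series -/

/-- The function `w̄ᵏ |w|^{-2s}` summed by the Kronecker series. -/
def kroneckerFun (k : ℕ) (s w : ℂ) : ℂ := starRingEnd ℂ w ^ k / ((‖w‖ : ℝ) : ℂ) ^ (2 * s)

theorem kroneckerFun_zero {k : ℕ} (hk : k ≠ 0) (s : ℂ) : kroneckerFun k s 0 = 0 := by
  simp [kroneckerFun, hk]

theorem kroneckerFun_eq {k : ℕ} (s : ℂ) {w : ℂ} (hw : w ≠ 0) :
    kroneckerFun k s w =
      starRingEnd ℂ w ^ k * Complex.exp (-(s * (Real.log (Complex.normSq w) : ℝ))) := by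
  have h0 : ((‖w‖ : ℝ) : ℂ) ≠ 0 := by exact_mod_cast norm_ne_zero_iff.mpr hw
  rw [kroneckerFun, Complex.cpow_def_of_ne_zero h0, div_eq_mul_inv, ← Complex.exp_neg,
    ← Complex.ofReal_log (norm_nonneg w), Complex.normSq_eq_norm_sq, Real.log_pow]
  push_cast
  ring_nf

theorem norm_exp_neg_mul_log_normSq (s : ℂ) {w : ℂ} (hw : w ≠ 0) :
    ‖Complex.exp (-(s * (Real.log (Complex.normSq w) : ℝ)))‖ = ‖w‖ ^ (-2 * s.re) := by
  have h0 : 0 < ‖w‖ := norm_pos_iff.mpr hw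
  rw [Complex.norm_exp, Complex.normSq_eq_norm_sq, Real.log_pow, Real.rpow_def_of_pos h0]
  congr 1
  simp
  ring

theorem norm_kroneckerFun (k : ℕ) (s : ℂ) {w : ℂ} (hw : w ≠ 0) :
    ‖kroneckerFun k s w‖ = ‖w‖ ^ ((k : ℝ) - 2 * s.re) := by
  have h0 : 0 < ‖w‖ := norm_pos_iff.mpr hw
  rw [kroneckerFun_eq s hw, norm_mul, norm_exp_neg_mul_log_normSq s hw, norm_pow, RCLike.norm_conj,
    ← Real.rpow_natCast, ← Real.rpow_add h0]
  ring_nf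

theorem kroneckerFun_natCast {k : ℕ} (hk : k ≠ 0) (w : ℂ) :
    kroneckerFun k k w = (w ^ k)⁻¹ := by
  rcases eq_or_ne w 0 with rfl | hw
  · simp [kroneckerFun_zero hk, hk]
  · have h1 : starRingEnd ℂ w ≠ 0 := by simpa using hw
    rw [kroneckerFun, show (2 * (k : ℂ)) = ((2 * k : ℕ) : ℂ) by push_cast; ring,
      Complex.cpow_natCast, pow_mul, ← Complex.ofReal_pow, ← Complex.normSq_eq_norm_sq,
      ← Complex.mul_conj, mul_pow]
    field_simp

theorem differentiable_kroneckerFun {k : ℕ} (hk : k ≠ 0) (w : ℂ) :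
    Differentiable ℂ fun s => kroneckerFun k s w := by
  rcases eq_or_ne w 0 with rfl | hw
  · simp only [kroneckerFun_zero hk]
    fun_prop
  · simp only [kroneckerFun_eq _ hw]
    fun_prop

/-- The difference of two values of `w̄ᵏ|w|^{-2s}` gains one power of `|w|`. -/
theorem norm_kroneckerFun_sub_le {k : ℕ} (hk : k ≠ 0) (s : ℂ) {w : ℂ} {r : ℝ} (hr : 0 < r)
    (hw : ∀ t : ℝ, -1 ≤ t → t ≤ 0 → r ≤ ‖w + t‖) (hs : (k : ℝ) - 1 - 2 * s.re ≤ 0) :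
    ‖kroneckerFun k s w - kroneckerFun k s (w - 1)‖ ≤
      (k + 2 * ‖s‖) * r ^ ((k : ℝ) - 1 - 2 * s.re) := by
  have hne : ∀ t : ℝ, -1 ≤ t → t ≤ 0 → w + t ≠ 0 := fun t h1 h2 h => by
    have := hw t h1 h2
    rw [h, norm_zero] at this
    linarith
  set N : ℝ → ℝ := fun t => (w.re + t) ^ 2 + w.im ^ 2 with hN
  have hNs : ∀ t : ℝ, Complex.normSq (w + t) = N t := fun t => by
    simp [Complex.normSq_apply, hN]
    ring
  set f : ℝ → ℂ := fun t =>
    (starRingEnd ℂ w + t) ^ k * Complex.exp (-(s * (Real.log (N t) : ℝ))) with hf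
  have hfk : ∀ t : ℝ, -1 ≤ t → t ≤ 0 → f t = kroneckerFun k s (w + t) := fun t h1 h2 => by
    rw [kroneckerFun_eq s (hne t h1 h2), hNs]
    simp [hf]
  have hder : ∀ t ∈ Icc (-1 : ℝ) 0, HasDerivWithinAt f
      ((k * (starRingEnd ℂ w + t) ^ (k - 1)) * Complex.exp (-(s * (Real.log (N t) : ℝ))) +
        (starRingEnd ℂ w + t) ^ k * (Complex.exp (-(s * (Real.log (N t) : ℝ))) *
          (-(s * ((2 * (w.re + t) / N t : ℝ) : ℂ))))) (Icc (-1) 0) t := by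
    intro t ht
    have hN0 : N t ≠ 0 := by
      rw [← hNs]
      exact (Complex.normSq_pos.mpr (hne t ht.1 ht.2)).ne'
    have d1 : HasDerivAt (fun t : ℝ => (starRingEnd ℂ w + t) ^ k)
        (k * (starRingEnd ℂ w + t) ^ (k - 1) * 1) t :=
      (((hasDerivAt_id t).ofReal_comp).const_add (starRingEnd ℂ w)).pow k
    have d2 : HasDerivAt N (2 * (w.re + t)) t := by
      have := (((hasDerivAt_id t).const_add w.re).pow 2).add_const (w.im ^ 2)
      convert! this using 1
      simp
    have d3 := ((((d2.log hN0).ofReal_comp).const_mul s).neg).cexp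
    have := d1.mul d3
    rw [mul_one] at this
    exact this.hasDerivWithinAt
  have hbound : ∀ t ∈ Icc (-1 : ℝ) 0,
      ‖(k * (starRingEnd ℂ w + t) ^ (k - 1)) * Complex.exp (-(s * (Real.log (N t) : ℝ))) +
        (starRingEnd ℂ w + t) ^ k * (Complex.exp (-(s * (Real.log (N t) : ℝ))) *
          (-(s * ((2 * (w.re + t) / N t : ℝ) : ℂ))))‖ ≤
        (k + 2 * ‖s‖) * r ^ ((k : ℝ) - 1 - 2 * s.re) := by
    intro t ht
    have h0 : 0 < ‖w + t‖ := norm_pos_iff.mpr (hne t ht.1 ht.2)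
    have hc : ‖starRingEnd ℂ w + t‖ = ‖w + t‖ := by
      rw [← RCLike.norm_conj (w + t)]
      simp
    have hE : ‖Complex.exp (-(s * (Real.log (N t) : ℝ)))‖ = ‖w + t‖ ^ (-2 * s.re) := by
      rw [← hNs]
      exact norm_exp_neg_mul_log_normSq s (hne t ht.1 ht.2)
    have hD : ‖((2 * (w.re + t) / N t : ℝ) : ℂ)‖ ≤ 2 / ‖w + t‖ := by
      rw [Complex.norm_real, Real.norm_eq_abs, ← hNs, Complex.normSq_eq_norm_sq, abs_div,
        abs_of_pos (pow_pos h0 2), abs_mul, abs_two, div_le_div_iff₀ (pow_pos h0 2) h0]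
      have : |w.re + t| ≤ ‖w + t‖ := by simpa using Complex.abs_re_le_norm (w + t)
      nlinarith
    have hk1 : ‖w + t‖ ^ (k - 1) * ‖w + t‖ ^ (-2 * s.re) =
        ‖w + t‖ ^ ((k : ℝ) - 1 - 2 * s.re) := by
      rw [← Real.rpow_natCast, ← Real.rpow_add h0, Nat.cast_sub (Nat.one_le_iff_ne_zero.mpr hk)]
      congr 1
      push_cast
      ring
    have hk2 : ‖w + t‖ ^ k * (‖w + t‖ ^ (-2 * s.re) * (‖s‖ * (2 / ‖w + t‖))) =
        2 * ‖s‖ * ‖w + t‖ ^ ((k : ℝ) - 1 - 2 * s.re) := by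
      rw [← hk1]
      obtain ⟨j, rfl⟩ := Nat.exists_eq_succ_of_ne_zero hk
      rw [Nat.succ_eq_add_one, Nat.add_sub_cancel, pow_succ]
      field_simp
    have hmono : ‖w + t‖ ^ ((k : ℝ) - 1 - 2 * s.re) ≤ r ^ ((k : ℝ) - 1 - 2 * s.re) :=
      Real.rpow_le_rpow_of_nonpos hr (hw t ht.1 ht.2) hs
    refine (norm_add_le _ _).trans ?_
    rw [norm_mul, norm_mul, norm_mul, norm_mul, norm_neg, norm_mul, norm_pow, norm_pow, hc, hE,
      Complex.norm_natCast]
    calc _ ≤ k * (‖w + t‖ ^ (k - 1) * ‖w + t‖ ^ (-2 * s.re)) +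
          ‖w + t‖ ^ k * (‖w + t‖ ^ (-2 * s.re) * (‖s‖ * (2 / ‖w + t‖))) := by
          rw [mul_assoc]
          gcongr
      _ = (k + 2 * ‖s‖) * ‖w + t‖ ^ ((k : ℝ) - 1 - 2 * s.re) := by
          rw [hk1, hk2]
          ring
      _ ≤ _ := by gcongr
  have key := Convex.norm_image_sub_le_of_norm_hasDerivWithin_le hder hbound
    (convex_Icc (-1) 0) (x := -1) (y := 0) (by simp) (by simp)
  rw [hfk 0 (by norm_num) le_rfl, hfk (-1) le_rfl (by norm_num)] at key
  simpa [← sub_eq_add_neg] using key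

/-- Bound for the differences along the rows of the lattice `(ℤ + a)τ + ℤ`. -/
theorem exists_norm_kroneckerFun_diff_le {τ : ℂ} (hτ : 0 < τ.im) {k : ℕ} (hk : 2 ≤ k) {σ R : ℝ}
    (hσ : (k : ℝ) - 1 - 2 * σ ≤ 0) :
    ∃ C : ℝ, ∀ a : ℝ, 0 ≤ a → a ≤ 1 → ∀ s : ℂ, σ ≤ s.re → ‖s‖ ≤ R → ∀ p : ℤ × ℤ, 2 ≤ ‖p‖ →
      ‖kroneckerFun k s (((p.1 : ℂ) + a) * τ + p.2) -
        kroneckerFun k s (((p.1 : ℂ) + a) * τ + (p.2 - 1 : ℤ))‖ ≤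
        C * ‖p‖ ^ ((k : ℝ) - 1 - 2 * σ) := by
  obtain ⟨c, hc, h⟩ := exists_mul_norm_le_lattice hτ
  -- the factor `min c 1` allows the exponent `Re s` to be replaced by its lower bound `σ`
  set c' := min c (1 / 2) with hc'
  have hc'0 : 0 < c' := lt_min hc (by norm_num)
  refine ⟨(k + 2 * R) * c' ^ ((k : ℝ) - 1 - 2 * R), fun a ha0 ha1 s hs hsR p hp => ?_⟩
  have hp0 : 0 < ‖p‖ := by linarith
  have hsre : s.re ≤ R := (Complex.re_le_norm s).trans hsR
  have hb : ∀ t : ℝ, -1 ≤ t → t ≤ 0 → c' * ‖p‖ ≤ ‖((p.1 : ℂ) + a) * τ + p.2 + t‖ :=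
    fun t h1 h2 => (mul_le_mul_of_nonneg_right (min_le_left _ _) hp0.le).trans
      (h a t ha0 ha1 h1 h2 p hp)
  have h1 := norm_kroneckerFun_sub_le (k := k) (by omega) s (mul_pos hc'0 hp0) hb (by linarith)
  have he : ((p.1 : ℂ) + a) * τ + (p.2 - 1 : ℤ) = ((p.1 : ℂ) + a) * τ + p.2 - 1 := by
    push_cast
    ring
  rw [he]
  refine h1.trans ?_
  rw [Real.mul_rpow hc'0.le hp0.le, mul_assoc]
  have e1 : c' ^ ((k : ℝ) - 1 - 2 * s.re) ≤ c' ^ ((k : ℝ) - 1 - 2 * R) :=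
    Real.rpow_le_rpow_of_exponent_ge hc'0 ((min_le_right _ _).trans (by norm_num)) (by linarith)
  have e2 : ‖p‖ ^ ((k : ℝ) - 1 - 2 * s.re) ≤ ‖p‖ ^ ((k : ℝ) - 1 - 2 * σ) :=
    Real.rpow_le_rpow_of_exponent_le (by linarith) (by linarith)
  have hR : 0 ≤ R := (norm_nonneg s).trans hsR
  gcongr

/-- The differences of `w⁻ᵏ`, `k ≥ 2`, along the rows of the lattice `(ℤ + a)τ + ℤ` are absolutely
summable. -/
theorem summable_norm_inv_pow_diff {τ : ℂ} (hτ : 0 < τ.im) {k : ℕ} (hk : 2 ≤ k) {a : ℝ}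
    (ha0 : 0 ≤ a) (ha1 : a ≤ 1) :
    Summable fun p : ℤ × ℤ => ‖((((p.1 : ℂ) + a) * τ + p.2) ^ k)⁻¹ -
      ((((p.1 : ℂ) + a) * τ + (p.2 - 1 : ℤ)) ^ k)⁻¹‖ := by
  have hk2 : (2 : ℝ) ≤ k := by exact_mod_cast hk
  obtain ⟨C, hC⟩ := exists_norm_kroneckerFun_diff_le hτ hk (σ := k) (R := k)
    (by linarith)
  have hs : Summable fun p : ℤ × ℤ => C * ‖p‖ ^ (-((k : ℝ) + 1)) :=
    (summable_norm_rpow_int_prod (by linarith)).mul_left C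
  refine Summable.of_norm_bounded_eventually hs ?_
  filter_upwards [eventually_two_le_norm] with p hp
  have h := hC a ha0 ha1 k (by simp) (by simp) p hp
  rw [kroneckerFun_natCast (by omega), kroneckerFun_natCast (by omega)] at h
  rw [norm_norm]
  convert! h using 3
  ring

/-- The analytic continuation of the Kronecker series `K_k(0, x₁τ + x₂, s)` to
`Re s > k - 1/4`, obtained by summation by parts in the second lattice variable. -/
def kroneckerCont (k : ℕ) (x₁ x₂ : ℝ) (τ s : ℂ) : ℂ :=
  (1 - e (-x₁))⁻¹ * ∑' p : ℤ × ℤ, e (p.1 * x₂ - p.2 * x₁) *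
    (kroneckerFun k s (p.1 * τ + p.2) - kroneckerFun k s (p.1 * τ + (p.2 - 1 : ℤ)))

theorem differentiableOn_kroneckerCont {τ : ℂ} (hτ : 0 < τ.im) {k : ℕ} (hk : 2 ≤ k)
    (x₁ x₂ : ℝ) :
    DifferentiableOn ℂ (kroneckerCont k x₁ x₂ τ) {s : ℂ | (k : ℝ) - 1 / 4 < s.re} := by
  have hk2 : (2 : ℝ) ≤ k := by exact_mod_cast hk
  intro s₀ hs₀
  refine DifferentiableAt.differentiableWithinAt ?_
  set ε : ℝ := s₀.re - (k - 1 / 4) with hε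
  have hε0 : 0 < ε := sub_pos.mpr hs₀
  set U := Metric.ball s₀ ε with hU
  have hUre : ∀ s ∈ Metric.closedBall s₀ ε, (k : ℝ) - 1 / 4 ≤ s.re := fun s hs => by
    have h1 := (Complex.abs_re_le_norm (s - s₀)).trans (mem_closedBall_iff_norm.mp hs)
    rw [Complex.sub_re] at h1
    have h2 := (abs_le.mp h1).1
    rw [hε] at h2
    linarith
  have hUn : ∀ s ∈ Metric.closedBall s₀ ε, ‖s‖ ≤ ‖s₀‖ + ε := fun s hs => by
    have h1 := mem_closedBall_iff_norm.mp hs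
    have h2 := norm_add_le s₀ (s - s₀)
    rw [add_sub_cancel] at h2
    linarith
  obtain ⟨C, hC⟩ := exists_norm_kroneckerFun_diff_le hτ hk (σ := k - 1 / 4) (R := ‖s₀‖ + ε)
    (by linarith)
  set f : ℤ × ℤ → ℂ → ℂ := fun p s => e (p.1 * x₂ - p.2 * x₁) *
    (kroneckerFun k s (p.1 * τ + p.2) - kroneckerFun k s (p.1 * τ + (p.2 - 1 : ℤ))) with hf
  have hfd : ∀ p, Differentiable ℂ (f p) := fun p =>
    ((differentiable_kroneckerFun (by omega) _).sub
      (differentiable_kroneckerFun (by omega) _)).const_mul _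
  have hbd : ∀ p, ∃ B : ℝ, ∀ s ∈ Metric.closedBall s₀ ε, ‖f p s‖ ≤ B := fun p =>
    (isCompact_closedBall s₀ ε).exists_bound_of_continuousOn (hfd p).continuous.continuousOn
  choose B hB using hbd
  classical
  -- the estimate of the differences only holds away from the origin; compactness covers the rest
  set u : ℤ × ℤ → ℝ := fun p =>
    if 2 ≤ ‖p‖ then C * ‖p‖ ^ (-((k : ℝ) + 1 / 2)) else B p with hu
  have hus : Summable u := by
    have hs : Summable fun p : ℤ × ℤ => C * ‖p‖ ^ (-((k : ℝ) + 1 / 2)) :=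
      (summable_norm_rpow_int_prod (by linarith)).mul_left C
    refine Summable.of_norm_bounded_eventually hs.norm ?_
    filter_upwards [eventually_two_le_norm] with p hp
    rw [hu]
    simp only
    rw [if_pos hp]
  have hle : ∀ (p : ℤ × ℤ) (s : ℂ), s ∈ U → ‖f p s‖ ≤ u p := fun p s hs => by
    have hs' := Metric.ball_subset_closedBall hs
    rw [hu]
    simp only
    split_ifs with hp
    · have h := hC 0 le_rfl zero_le_one s (hUre s hs') (hUn s hs') p hp
      rw [hf]
      simp only
      rw [norm_mul, norm_e_sub, one_mul]
      simp only [Complex.ofReal_zero, add_zero] at h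
      convert! h using 3
      ring
    · exact hB p s hs'
  have hd := Complex.differentiableOn_tsum_of_summable_norm hus
    (fun p => (hfd p).differentiableOn) Metric.isOpen_ball hle
  exact (hd.differentiableAt (Metric.isOpen_ball.mem_nhds (Metric.mem_ball_self hε0))).const_mul _

theorem summable_norm_kroneckerFun {τ : ℂ} (hτ : 0 < τ.im) {k : ℕ} {s : ℂ}
    (hs : 1 + (k : ℝ) / 2 < s.re) :
    Summable fun p : ℤ × ℤ => ‖kroneckerFun k s (p.1 * τ + p.2)‖ := by
  obtain ⟨c, hc, h⟩ := exists_mul_norm_le_lattice hτ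
  have hsum : Summable fun p : ℤ × ℤ =>
      c ^ ((k : ℝ) - 2 * s.re) * ‖p‖ ^ (-(2 * s.re - k)) :=
    (summable_norm_rpow_int_prod (by linarith)).mul_left _
  refine Summable.of_norm_bounded_eventually hsum ?_
  filter_upwards [eventually_two_le_norm] with p hp
  have h1 := h 0 0 le_rfl zero_le_one (by norm_num) le_rfl p hp
  simp only [Complex.ofReal_zero, add_zero] at h1
  have hp0 : 0 < ‖p‖ := by linarith
  have hcp : 0 < c * ‖p‖ := by positivity
  rw [norm_norm, norm_kroneckerFun k s (norm_pos_iff.mp (hcp.trans_le h1)),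
    show -(2 * s.re - k) = (k : ℝ) - 2 * s.re by ring, ← Real.mul_rpow hc.le hp0.le]
  exact Real.rpow_le_rpow_of_nonpos hcp h1 (by linarith)

theorem kroneckerTerm_eq {τ : ℂ} (hτ : 0 < τ.im) {k : ℕ} (hk : k ≠ 0) (x₁ x₂ : ℝ) (s : ℂ)
    (p : ℤ × ℤ) :
    kroneckerTerm k 0 (x₁ * τ + x₂) τ s p =
      e (p.1 * x₂ - p.2 * x₁) * kroneckerFun k s (p.1 * τ + p.2) := by
  have hd : τ - starRingEnd ℂ τ ≠ 0 := by
    rw [Complex.sub_conj]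
    simp [hτ.ne', Complex.I_ne_zero]
  have hpi : (2 * Real.pi * Complex.I : ℂ) ≠ 0 := by simp [Real.pi_ne_zero, Complex.I_ne_zero]
  have hchar : Complex.exp ((latticeA τ)⁻¹ *
      ((p.1 * τ + p.2) * starRingEnd ℂ (x₁ * τ + x₂) -
        starRingEnd ℂ (p.1 * τ + p.2) * (x₁ * τ + x₂))) = e (p.1 * x₂ - p.2 * x₁) := by
    rw [e, latticeA]
    congr 1
    simp only [map_add, map_mul, Complex.conj_ofReal, map_intCast, map_one, one_mul]
    rw [mul_inv, inv_inv]
    field_simp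
    ring
  rw [kroneckerTerm]
  split_ifs with h0
  · rw [neg_zero] at h0
    rw [h0, kroneckerFun_zero hk, mul_zero]
  · rw [hchar, kroneckerFun, map_zero, add_zero, add_zero, mul_div_assoc]

theorem isKroneckerContinuation_kroneckerCont {τ : ℂ} (hτ : 0 < τ.im) {k : ℕ} (hk : 2 ≤ k)
    {x₁ : ℝ} (hx : e (-x₁) ≠ 1) (x₂ : ℝ) :
    IsKroneckerContinuation k 0 (x₁ * τ + x₂) τ (k - 1 / 4) (kroneckerCont k x₁ x₂ τ) := by
  refine ⟨differentiableOn_kroneckerCont hτ hk x₁ x₂, fun s hs => ?_⟩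
  have hne : 1 - e (-x₁) ≠ 0 := sub_ne_zero.mpr (Ne.symm hx)
  have hsum := summable_norm_kroneckerFun hτ hs
  let shift : ℤ × ℤ ≃ ℤ × ℤ := (Equiv.refl ℤ).prodCongr (Equiv.addRight 1)
  have h1 : Summable fun p : ℤ × ℤ =>
      e (p.1 * x₂ - p.2 * x₁) * kroneckerFun k s (p.1 * τ + p.2) := by
    refine Summable.of_norm (hsum.congr fun p => ?_)
    rw [norm_mul, norm_e_sub, one_mul]
  have h2 : ∀ p : ℤ × ℤ, e ((shift p).1 * x₂ - (shift p).2 * x₁) *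
        kroneckerFun k s ((shift p).1 * τ + ((shift p).2 - 1 : ℤ)) =
      e (-x₁) * (e (p.1 * x₂ - p.2 * x₁) * kroneckerFun k s (p.1 * τ + p.2)) := fun p => by
    simp only [shift, Equiv.prodCongr_apply, Prod.map_fst, Prod.map_snd, Equiv.refl_apply,
      Equiv.coe_addRight, add_sub_cancel_right]
    rw [← mul_assoc, ← e_add]
    push_cast
    ring_nf
  have h3 : Summable fun p : ℤ × ℤ =>
      e (p.1 * x₂ - p.2 * x₁) * kroneckerFun k s (p.1 * τ + (p.2 - 1 : ℤ)) := by
    rw [← shift.summable_iff]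
    exact (h1.mul_left (e (-x₁))).congr fun p => (h2 p).symm
  have h4 : ∑' p : ℤ × ℤ, e (p.1 * x₂ - p.2 * x₁) *
        kroneckerFun k s (p.1 * τ + (p.2 - 1 : ℤ)) =
      e (-x₁) * ∑' p : ℤ × ℤ, e (p.1 * x₂ - p.2 * x₁) * kroneckerFun k s (p.1 * τ + p.2) := by
    rw [← shift.tsum_eq, ← tsum_mul_left]
    exact tsum_congr h2
  simp only [kroneckerTerm_eq hτ (show k ≠ 0 by omega), kroneckerCont, mul_sub]
  rw [h1.tsum_sub h3, h4]
  generalize ∑' p : ℤ × ℤ, e (p.1 * x₂ - p.2 * x₁) * kroneckerFun k s (p.1 * τ + p.2) = T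
  field_simp

/-- At `s = k ≥ 2` the continued Kronecker series is the iterated sum, first along the rows. -/
theorem hasSum_kroneckerCont {τ : ℂ} (hτ : 0 < τ.im) {k : ℕ} (hk : 2 ≤ k)
    {x₁ : ℝ} (hx : e (-x₁) ≠ 1) (x₂ : ℝ) :
    HasSum (fun m : ℤ => ∑' n : ℤ, e (m * x₂ - n * x₁) * ((m * τ + n) ^ k)⁻¹)
      (kroneckerCont k x₁ x₂ τ k) := by
  obtain ⟨j, rfl⟩ := Nat.exists_eq_add_of_le' hk
  have hd := summable_norm_inv_pow_diff hτ hk le_rfl zero_le_one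
  simp only [Complex.ofReal_zero, add_zero] at hd
  have h := hasSum_rows_of_summable_diff (h := fun p : ℤ × ℤ => ((p.1 * τ + p.2) ^ (j + 2))⁻¹)
    x₂ hx (fun m => summable_inv_add_intCast_pow (m * τ) j) hd
  convert! h using 1
  rw [kroneckerCont]
  congr 2
  ext p
  rw [kroneckerFun_natCast (by omega), kroneckerFun_natCast (by omega)]

/-! ### The series `E` at `τ = iy`: expansion and inversion -/

theorem frac_nonneg (x : UnitAddCircle) : 0 ≤ frac x := (AddCircle.equivIco (1 : ℝ) 0 x).2.1

theorem frac_lt_one (x : UnitAddCircle) : frac x < 1 := by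
  exact (AddCircle.equivIco (1 : ℝ) 0 x).2.2.trans_eq (zero_add 1)

theorem coe_frac (x : UnitAddCircle) : ((frac x : ℝ) : UnitAddCircle) = x :=
  (AddCircle.equivIco (1 : ℝ) 0).symm_apply_apply x

theorem frac_coe {a : ℝ} (h0 : 0 ≤ a) (h1 : a < 1) : frac (a : UnitAddCircle) = a := by
  have h : (a : ℝ) ∈ Ico (0 : ℝ) (0 + 1) := ⟨h0, by rwa [zero_add]⟩
  rw [frac, AddCircle.equivIco_coe_eq h]

theorem frac_pos {x : UnitAddCircle} (hx : x ≠ 0) : 0 < frac x := by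
  refine lt_of_le_of_ne (frac_nonneg x) fun h => hx ?_
  rw [← coe_frac x, ← h, AddCircle.coe_zero]

theorem frac_neg {x : UnitAddCircle} (hx : x ≠ 0) : frac (-x) = 1 - frac x := by
  have h : -x = ((1 - frac x : ℝ) : UnitAddCircle) := by
    rw [AddCircle.coe_sub, coe_frac, AddCircle.coe_period, zero_sub]
  rw [h, frac_coe (by linarith [frac_lt_one x]) (by linarith [frac_pos hx])]

theorem polyBounded_pow {a : ℝ} (ha : 0 < a) (N : ℕ) :
    PolyBounded a N fun n => ((n : ℂ) + a) ^ N := fun n => by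
  rw [norm_pow, ← Complex.ofReal_natCast, ← Complex.ofReal_add, Complex.norm_real,
    Real.norm_of_nonneg (by positivity)]

theorem polyBounded_e (x b : ℝ) : PolyBounded x 0 fun m => e (((m : ℂ) + 1) * b) := fun m => by
  rw [pow_zero]
  exact (by exact_mod_cast norm_e_ofReal ((m + 1) * b) : ‖e (((m : ℂ) + 1) * b)‖ = 1).le

/-- The part `∑ e(mb) r^{k-1} q^{mr}`, over `m ≥ 1` and `r > 0` with `r ≡ a mod 1`, of the
`q`-expansion of `E^{(k)}_{(a, b)}`, at `τ = iw`. -/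
def eisSeries (k : ℕ) (a b : ℝ) (w : ℂ) : ℂ :=
  doubleSeries 1 a (fun m => e ((m + 1) * b)) (fun n => ((n : ℂ) + a) ^ (k - 1)) w

theorem im_I_mul {y : ℝ} (hy : 0 < y) : 0 < (Complex.I * (y : ℂ)).im := by simpa using hy

/-- Sum of one positive row of the lattice sum. -/
theorem tsum_row {y : ℝ} (hy : 0 < y) (j : ℕ) {a : ℝ} (ha0 : 0 < a) (ha1 : a ≤ 1) (b : ℝ)
    (m : ℕ) :
    ∑' n : ℤ, e (((m : ℂ) + 1) * b - n * a) *
        ((((m : ℂ) + 1) * (Complex.I * y) + n) ^ (j + 2))⁻¹ =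
      (-(2 * Real.pi * Complex.I)) ^ (j + 2) / (j + 1).factorial *
        ∑' n : ℕ, doubleTerm 1 a (fun m => e ((m + 1) * b)) (fun n => ((n : ℂ) + a) ^ (j + 1)) y
          (m, n) := by
  have hz : 0 < ((((m + 1) * y : ℝ) : ℂ) * Complex.I).im := by
    simp
    positivity
  have h := (hasSum_lipschitz j hz ha0 ha1).tsum_eq
  have e1 : ∀ n : ℤ, e (((m : ℂ) + 1) * b - n * a) *
        ((((m : ℂ) + 1) * (Complex.I * y) + n) ^ (j + 2))⁻¹ =
      e (((m : ℂ) + 1) * b) * (e (-(n * a)) *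
        (((((m + 1) * y : ℝ) : ℂ) * Complex.I + n) ^ (j + 2))⁻¹) := fun n => by
    rw [sub_eq_add_neg, e_add]
    push_cast
    ring_nf
  simp only [e1]
  rw [tsum_mul_left, h, mul_left_comm, ← tsum_mul_left]
  congr 1
  refine tsum_congr fun n => ?_
  rw [doubleTerm, mul_assoc]
  congr 2
  rw [e]
  congr 1
  push_cast
  linear_combination (2 * Real.pi * ((n : ℂ) + a) * ((m + 1) * y)) * Complex.I_sq

theorem summable_eisSeries_term {y : ℝ} (hy : 0 < y) (j : ℕ) {a : ℝ} (ha0 : 0 < a) (b : ℝ) :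
    Summable (doubleTerm 1 a (fun m => e ((m + 1) * b)) (fun n => ((n : ℂ) + a) ^ (j + 1)) y) :=
  (summable_norm_doubleTerm zero_lt_one ha0 (polyBounded_e 1 b) (polyBounded_pow ha0 (j + 1))
    (by simpa using hy)).of_norm

/-- The row through the origin gives the constant term. -/
theorem tsum_zero_row (j : ℕ) {a : ℝ} (ha0 : 0 ≤ a) (ha1 : a ≤ 1) :
    ∑' n : ℤ, e (-(n * a)) * ((n : ℂ) ^ (j + 2))⁻¹ =
      -((-(2 * Real.pi * Complex.I)) ^ (j + 2) / (j + 2).factorial * bernoulliFun (j + 2) a) := by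
  have h := (hasSum_one_div_pow_mul_fourier_mul_bernoulliFun (k := j + 2) (by omega)
    (x := a) ⟨ha0, ha1⟩).tsum_eq
  rw [← (Equiv.neg ℤ).tsum_eq]
  have e1 : ∀ n : ℤ, e (-((Equiv.neg ℤ n : ℤ) * a)) * (((Equiv.neg ℤ n : ℤ) : ℂ) ^ (j + 2))⁻¹ =
      (-1) ^ (j + 2) * (1 / (n : ℂ) ^ (j + 2) * fourier n (a : UnitAddCircle)) := fun n => by
    rw [Equiv.neg_apply, fourier_coe_apply, e]
    push_cast
    rw [neg_pow (n : ℂ), mul_inv, ← inv_pow, div_one]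
    norm_num
    ring_nf
  simp only [e1]
  rw [tsum_mul_left, h, neg_pow (2 * Real.pi * Complex.I : ℂ)]
  ring

/-- The `q`-expansion of `E^{(k)}_x`, `k ≥ 2`, at `τ = iy`. -/
theorem eisE_eq {y : ℝ} (hy : 0 < y) (j : ℕ) {x : UnitAddCircle × UnitAddCircle}
    (hx : x.1 ≠ 0) :
    eisE (j + 2) x (Complex.I * y) = bernoulliFun (j + 2) (frac x.1) / (j + 2 : ℕ) -
      (eisSeries (j + 2) (frac x.1) (frac x.2) y +
        (-1) ^ j * eisSeries (j + 2) (1 - frac x.1) (-frac x.2) y) := by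
  set a := frac x.1 with ha
  set b := frac x.2 with hb
  have ha0 : 0 < a := frac_pos hx
  have ha1 : a < 1 := frac_lt_one x.1
  have hτ := im_I_mul hy
  have hne : e (-a) ≠ 1 := by
    rw [e_neg, inv_ne_one]
    exact e_ne_one ha0 ha1
  have hK : kroneckerK (j + 2) 0 (a * (Complex.I * y) + b) ((j + 2 : ℕ) : ℂ) (Complex.I * y) =
      kroneckerCont (j + 2) a b (Complex.I * y) ((j + 2 : ℕ) : ℂ) :=
    kroneckerK_eq (by simp) (isKroneckerContinuation_kroneckerCont hτ (by omega) hne b)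
  have hS := hasSum_kroneckerCont hτ (k := j + 2) (by omega) hne b
  set f : ℤ → ℂ := fun m => ∑' n : ℤ, e (m * b - n * a) *
    ((m * (Complex.I * y) + n) ^ (j + 2))⁻¹ with hf
  have hpos : ∀ m : ℕ, f (m + 1) = (-(2 * Real.pi * Complex.I)) ^ (j + 2) / (j + 1).factorial *
      ∑' n : ℕ, doubleTerm 1 a (fun m => e ((m + 1) * b)) (fun n => ((n : ℂ) + a) ^ (j + 1)) y
        (m, n) := fun m => by
    rw [← tsum_row hy j ha0 ha1.le b m, hf]
    push_cast
    rfl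
  have hneg : ∀ m : ℕ, f (-((m : ℤ) + 1)) = (-(2 * Real.pi * Complex.I)) ^ (j + 2) /
      (j + 1).factorial * ((-1) ^ j *
      ∑' n : ℕ, doubleTerm 1 (1 - a) (fun m => e ((m + 1) * (-b : ℝ)))
        (fun n => ((n : ℂ) + (1 - a : ℝ)) ^ (j + 1)) y (m, n)) := fun m => by
    rw [mul_left_comm, ← tsum_row hy j (a := 1 - a) (by linarith) (by linarith) (-b) m, hf]
    simp only
    rw [← (Equiv.neg ℤ).tsum_eq, ← tsum_mul_left]
    refine tsum_congr fun n => ?_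
    have hA : e (((-((m : ℤ) + 1) : ℤ) : ℂ) * b - ((-n : ℤ) : ℂ) * a) =
        e (((m : ℂ) + 1) * ((-b : ℝ) : ℂ) - n * ((1 - a : ℝ) : ℂ)) := by
      have : ((m : ℂ) + 1) * ((-b : ℝ) : ℂ) - n * ((1 - a : ℝ) : ℂ) =
          (((-((m : ℤ) + 1) : ℤ) : ℂ) * b - ((-n : ℤ) : ℂ) * a) + ((-n : ℤ) : ℂ) := by
        push_cast
        ring
      rw [this, e_add, e_intCast, mul_one]
    have hB : ((-((m : ℤ) + 1) : ℤ) : ℂ) * (Complex.I * y) + ((-n : ℤ) : ℂ) =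
        -(((m : ℂ) + 1) * (Complex.I * y) + n) := by
      push_cast
      ring
    have hC : ((-1 : ℂ) ^ (j + 2))⁻¹ = (-1) ^ j := by
      rw [← inv_pow]
      norm_num [pow_add]
    rw [Equiv.neg_apply, hA, hB, neg_pow, mul_inv, hC]
    ring
  -- the row through the origin, where `0⁻¹ = 0` leaves out the point `0`
  have hzero : f 0 = -((-(2 * Real.pi * Complex.I)) ^ (j + 2) / (j + 2).factorial *
      bernoulliFun (j + 2) a) := by
    rw [← tsum_zero_row j ha0.le ha1.le, hf]
    simp
  have hs1 : Summable fun m : ℕ => f (m + 1) := by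
    refine hS.summable.comp_injective (i := fun m : ℕ => (m : ℤ) + 1) fun m n h => ?_
    simpa using h
  have hs2 : Summable fun m : ℕ => f (-((m : ℤ) + 1)) := by
    refine hS.summable.comp_injective (i := fun m : ℕ => -((m : ℤ) + 1)) fun m n h => ?_
    simpa using h
  have htot := tsum_of_add_one_of_neg_add_one hs1 hs2
  rw [hS.tsum_eq] at htot
  simp only [hpos, hneg, hzero] at htot
  rw [tsum_mul_left, tsum_mul_left, tsum_mul_left,
    ← (summable_eisSeries_term hy j ha0 b).tsum_prod,
    ← (summable_eisSeries_term hy j (a := 1 - a) (by linarith) (-b)).tsum_prod] at htot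
  have hpi : (-(2 * Real.pi * Complex.I)) ^ (j + 2) ≠ 0 := by
    simp [Real.pi_ne_zero, Complex.I_ne_zero]
  have hfac : ((j + 1).factorial : ℂ) ≠ 0 := by exact_mod_cast (j + 1).factorial_ne_zero
  have hj : ((j : ℂ) + 2) ≠ 0 := by exact_mod_cast (by omega : j + 2 ≠ 0)
  rw [eisE, ← ha, ← hb, hK, htot, eisSeries, eisSeries, doubleSeries, doubleSeries,
    show (j + 2).factorial = (j + 2) * (j + 1).factorial from Nat.factorial_succ _,
    show j + 2 - 1 = j + 1 from rfl]
  generalize (-(2 * Real.pi * Complex.I) : ℂ) ^ (j + 2) = P at *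
  generalize ∑' p, doubleTerm 1 a (fun m => e ((m + 1) * b)) (fun n => ((n : ℂ) + a) ^ (j + 1)) y p
    = S₁
  generalize ∑' p, doubleTerm 1 (1 - a) (fun m => e ((m + 1) * (-b : ℝ)))
    (fun n => ((n : ℂ) + (1 - a : ℝ)) ^ (j + 1)) y p = S₂
  push_cast
  field_simp
  ring

theorem norm_I_mul_ofReal {y : ℝ} (hy : 0 < y) (w : ℂ) :
    ‖Complex.I / y * w‖ = y⁻¹ * ‖w‖ := by
  rw [norm_mul, norm_div, Complex.norm_I, Complex.norm_real, Real.norm_of_nonneg hy.le, one_div]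

/-- The transformation of `E^{(k)}_x` under `τ ↦ -1/τ`. Both sides continue the same Kronecker
series, after the substitution `(m, n) ↦ (n, -m)`. -/
theorem eisE_inv {y : ℝ} (hy : 0 < y) {k : ℕ} (hk : 2 ≤ k) {x : UnitAddCircle × UnitAddCircle}
    (hx₁ : x.1 ≠ 0) :
    eisE k x (Complex.I * (1 / y : ℝ)) =
      (Complex.I * y) ^ k * eisE k (x.2, -x.1) (Complex.I * y) := by
  set a := frac x.1 with ha
  set b := frac x.2 with hb
  have ha0 : 0 < a := frac_pos hx₁
  have ha1 : a < 1 := frac_lt_one x.1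
  have hy0 : (y : ℂ) ≠ 0 := by exact_mod_cast hy.ne'
  have hτ := im_I_mul hy
  have hτ' := im_I_mul (y := 1 / y) (by positivity)
  have hne : e (-a) ≠ 1 := by
    rw [e_neg, inv_ne_one]
    exact e_ne_one ha0 ha1
  have hF := isKroneckerContinuation_kroneckerCont hτ' (k := k) hk hne b
  set F := kroneckerCont k a b (Complex.I * (1 / y : ℝ)) with hFdef
  have hK' : kroneckerK k 0 (a * (Complex.I * (1 / y : ℝ)) + b) k (Complex.I * (1 / y : ℝ)) = F k :=
    kroneckerK_eq (by simp) hF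
  have hG : IsKroneckerContinuation k 0 (b * (Complex.I * y) + (1 - a : ℝ)) (Complex.I * y)
      (k - 1 / 4) (fun s => (Complex.I / y) ^ (-(k : ℤ)) * (y : ℂ) ^ (-(2 * s)) * F s) := by
    refine ⟨?_, fun s hs => ?_⟩
    · refine DifferentiableOn.mul ?_ hF.1
      have : Differentiable ℂ fun s : ℂ => (Complex.I / y) ^ (-(k : ℤ)) * (y : ℂ) ^ (-(2 * s)) := by
        refine Differentiable.const_mul ?_ _
        exact Differentiable.const_cpow (by fun_prop) (Or.inl hy0)
      exact this.differentiableOn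
    · let σ : ℤ × ℤ ≃ ℤ × ℤ := (Equiv.prodComm ℤ ℤ).trans ((Equiv.refl ℤ).prodCongr (Equiv.neg ℤ))
      simp only
      rw [hF.2 s hs, ← σ.tsum_eq (fun p => kroneckerTerm k 0 (b * (Complex.I * y) + (1 - a : ℝ))
        (Complex.I * y) s p), ← tsum_mul_left]
      refine tsum_congr fun p => ?_
      rw [kroneckerTerm_eq hτ' (by omega), kroneckerTerm_eq hτ (by omega)]
      have hσ : σ p = (p.2, -p.1) := rfl
      rw [hσ]
      have hw : (p.1 : ℂ) * (Complex.I * (1 / y : ℝ)) + p.2 =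
          -(Complex.I / y) * (((p.2 : ℤ) : ℂ) * (Complex.I * y) + ((-p.1 : ℤ) : ℂ)) := by
        push_cast
        field_simp
        linear_combination ((p.2 : ℂ) * y) * Complex.I_sq
      have hchar : e (((p.2 : ℤ) : ℂ) * ((1 - a : ℝ) : ℂ) - ((-p.1 : ℤ) : ℂ) * b) =
          e (p.1 * b - p.2 * a) := by
        have : ((p.2 : ℤ) : ℂ) * ((1 - a : ℝ) : ℂ) - ((-p.1 : ℤ) : ℂ) * b =
            (p.1 * b - p.2 * a) + (p.2 : ℂ) := by
          push_cast
          ring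
        rw [this, e_add, e_intCast, mul_one]
      simp only [hchar]
      rw [hw]
      generalize ((p.2 : ℤ) : ℂ) * (Complex.I * y) + ((-p.1 : ℤ) : ℂ) = w
      have hnorm : ‖-(Complex.I / y) * w‖ = y⁻¹ * ‖w‖ := by
        rw [neg_mul, norm_neg, norm_I_mul_ofReal hy]
      have hconj : starRingEnd ℂ (-(Complex.I / y) * w) = Complex.I / y * starRingEnd ℂ w := by
        simp
        ring
      rw [kroneckerFun, kroneckerFun, hnorm, hconj, mul_pow, Complex.ofReal_mul,
        Complex.mul_cpow_ofReal_nonneg (by positivity) (norm_nonneg w), Complex.ofReal_inv,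
        Complex.inv_cpow _ _ (by rw [Complex.arg_ofReal_of_nonneg hy.le]; exact Real.pi_pos.ne),
        Complex.cpow_neg, zpow_neg, zpow_natCast]
      have h1 : (y : ℂ) ^ (2 * s) ≠ 0 := by simp [Complex.cpow_eq_zero_iff, hy0]
      have h2 : (Complex.I / (y : ℂ)) ^ k ≠ 0 := pow_ne_zero _ (div_ne_zero Complex.I_ne_zero hy0)
      field_simp
  have hK : kroneckerK k 0 (b * (Complex.I * y) + (1 - a : ℝ)) k (Complex.I * y) =
      (Complex.I / y) ^ (-(k : ℤ)) * (y : ℂ) ^ (-(2 * (k : ℂ))) * F k :=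
    kroneckerK_eq (by simp) hG
  rw [eisE, eisE, ← ha, ← hb, hK', frac_neg hx₁, ← ha, hK, zpow_neg, zpow_natCast,
    Complex.cpow_neg, show (2 * (k : ℂ)) = ((2 * k : ℕ) : ℂ) by push_cast; ring,
    Complex.cpow_natCast, div_pow, mul_pow]
  have hI : Complex.I ^ k ≠ 0 := pow_ne_zero _ Complex.I_ne_zero
  rw [show (y : ℂ) ^ (2 * k) = y ^ k * y ^ k by rw [two_mul, pow_add]]
  field_simp

/-! ### The series `G` of weight at least two: inversion -/

/-- The sum of `r^{k-1} q^{rs}` over `r, s > 0` with `(r, s) ≡ (a, b) mod 1`, at `τ = iw`. -/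
def gSeries (k : ℕ) (a b : ℝ) (w : ℂ) : ℂ :=
  doubleSeries a b (fun m => ((m : ℂ) + a) ^ (k - 1)) (fun _ => 1) w

/-- The Eisenstein series `G^{(k)}_{(a, b)}` at `τ = iw`, for `a, b ∈ (0, 1)`. -/
def gEis (k : ℕ) (a b : ℝ) (w : ℂ) : ℂ :=
  gSeries k a b w + (-1) ^ k * gSeries k (1 - a) (1 - b) w

/-- The double series `∑ e(ma + nb) n^{k-1} q^{mn}` over `m, n ≥ 1`, at `τ = iw`; it occurs in the
expansion of `G^{(k)}` at the cusp `0`. -/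
def jSeries (k : ℕ) (a b : ℝ) (w : ℂ) : ℂ :=
  doubleSeries 1 1 (fun m => e ((m + 1) * a)) (fun n => ((n : ℂ) + 1) ^ (k - 1) * e ((n + 1) * b)) w

theorem polyBounded_one (x : ℝ) : PolyBounded x 0 fun _ => 1 := fun m => by simp

theorem polyBounded_pow_mul_e (N : ℕ) (b : ℝ) :
    PolyBounded 1 N fun n => ((n : ℂ) + 1) ^ N * e ((n + 1) * b) := fun n => by
  have h1 := polyBounded_pow zero_lt_one N n
  have h2 := polyBounded_e 1 b n
  rw [norm_mul]
  rw [pow_zero] at h2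
  push_cast at h1
  calc _ ≤ ((n : ℝ) + 1) ^ N * 1 := by gcongr
    _ = _ := mul_one _

theorem summable_gSeries_term {y : ℝ} (hy : 0 < y) (j : ℕ) {a b : ℝ} (ha : 0 < a) (hb : 0 < b) :
    Summable (doubleTerm b a (fun _ => 1) (fun m => ((m : ℂ) + a) ^ j) y) :=
  (summable_norm_doubleTerm hb ha (polyBounded_one b) (polyBounded_pow ha j)
    (by simpa using hy)).of_norm

theorem summable_jSeries_term {y : ℝ} (hy : 0 < y) (j : ℕ) (a b : ℝ) :
    Summable (doubleTerm 1 1 (fun m => e ((m + 1) * a))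
      (fun n => ((n : ℂ) + 1) ^ j * e ((n + 1) * b)) y) :=
  (summable_norm_doubleTerm zero_lt_one zero_lt_one (polyBounded_e 1 a)
    (polyBounded_pow_mul_e j b) (by simpa using hy)).of_norm

theorem gSeries_eq_tsum {y : ℝ} (hy : 0 < y) (j : ℕ) {a b : ℝ} (ha : 0 < a) (hb : 0 < b) :
    gSeries (j + 1) a b y =
      ∑' n : ℕ, ∑' m : ℕ, doubleTerm b a (fun _ => 1) (fun m => ((m : ℂ) + a) ^ j) y (n, m) := by
  rw [gSeries, doubleSeries_swap, doubleSeries, Nat.add_sub_cancel]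
  exact (summable_gSeries_term hy j ha hb).tsum_prod

theorem tsum_gRow {y : ℝ} (hy : 0 < y) (j : ℕ) {a b : ℝ} (ha0 : 0 < a) (ha1 : a ≤ 1)
    (hb : 0 < b) (n : ℕ) :
    ∑' l : ℤ, e (-(l * a)) * (((((n : ℂ) + b) * (Complex.I * y) + l)) ^ (j + 2))⁻¹ =
      (-(2 * Real.pi * Complex.I)) ^ (j + 2) / (j + 1).factorial *
        ∑' m : ℕ, doubleTerm b a (fun _ => 1) (fun m => ((m : ℂ) + a) ^ (j + 1)) y (n, m) := by
  have hz : 0 < (((n : ℂ) + b) * (Complex.I * y)).im := by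
    simp
    positivity
  rw [(hasSum_lipschitz j hz ha0 ha1).tsum_eq]
  congr 1
  refine tsum_congr fun m => ?_
  rw [doubleTerm, one_mul]
  congr 1
  rw [e]
  congr 1
  push_cast
  linear_combination (2 * Real.pi * ((m : ℂ) + a) * ((n + b) * y)) * Complex.I_sq

theorem tsum_gCol {y : ℝ} (hy : 0 < y) (j : ℕ) (a b : ℝ) (r : ℕ) :
    e (((r : ℂ) + 1) * a) *
        ∑' n : ℤ, ((((b : ℂ) + ((r : ℂ) + 1) * Complex.I / y) + n) ^ (j + 2))⁻¹ =
      (-(2 * Real.pi * Complex.I)) ^ (j + 2) / (j + 1).factorial *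
        ∑' m : ℕ, doubleTerm 1 1 (fun m => e ((m + 1) * a))
          (fun n => ((n : ℂ) + 1) ^ (j + 1) * e ((n + 1) * b)) ((1 / y : ℝ) : ℂ) (r, m) := by
  have hz : 0 < ((b : ℂ) + ((r : ℂ) + 1) * Complex.I / y).im := by
    have : ((b : ℂ) + ((r : ℂ) + 1) * Complex.I / y).im = (r + 1) / y := by
      rw [← Complex.ofReal_natCast, ← Complex.ofReal_one, ← Complex.ofReal_add]
      simp [Complex.div_ofReal_im]
    rw [this]
    positivity
  have h := (hasSum_lipschitz j hz zero_lt_one le_rfl).tsum_eq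
  have h1 : ∀ n : ℤ, e (-(n * (1 : ℝ))) = 1 := fun n => by
    rw [Complex.ofReal_one, mul_one, ← Int.cast_neg]
    exact e_intCast _
  simp only [h1, one_mul] at h
  rw [h, mul_left_comm, ← tsum_mul_left]
  congr 1
  refine tsum_congr fun m => ?_
  rw [doubleTerm, mul_assoc, Complex.ofReal_one, mul_assoc]
  congr 2
  rw [mul_add, e_add]
  congr 1
  rw [e]
  congr 1
  push_cast
  linear_combination (2 * Real.pi * ((m : ℂ) + 1) * ((r + 1) / y)) * Complex.I_sq

/-- The constant term of `G^{(j+2)}_{(a, b)}` at the cusp `0`, up to a power of `τ`. -/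
def gConst (j : ℕ) (b : ℝ) : ℂ :=
  (j + 1).factorial / (-(2 * Real.pi * Complex.I)) ^ (j + 2) *
    ∑' n : ℤ, (((b : ℂ) + n) ^ (j + 2))⁻¹

/-- The general term of the lattice sum `∑ ((m + b)τ + n)⁻ᵏ`. -/
def latticeTerm (j : ℕ) (b : ℝ) (τ : ℂ) (p : ℤ × ℤ) : ℂ :=
  ((((p.1 : ℂ) + b) * τ + p.2) ^ (j + 2))⁻¹

theorem summable_norm_latticeTerm_diff {τ : ℂ} (hτ : 0 < τ.im) (j : ℕ) {b : ℝ} (hb0 : 0 ≤ b)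
    (hb1 : b ≤ 1) :
    Summable fun p : ℤ × ℤ => ‖latticeTerm j b τ p - latticeTerm j b τ (p.1, p.2 - 1)‖ :=
  summable_norm_inv_pow_diff hτ (by omega) hb0 hb1

theorem inv_neg_one_pow_add_two (j : ℕ) : ((-1 : ℂ) ^ (j + 2))⁻¹ = (-1) ^ j := by
  rw [← inv_pow]
  norm_num [pow_add]

/-- The lattice sum with character `(m, n) ↦ e(-na)`, regularised by summation by parts. -/
def latticeSum (j : ℕ) (a b : ℝ) (τ : ℂ) : ℂ :=
  (1 - e (-a))⁻¹ * ∑' p : ℤ × ℤ, e (p.1 * (0 : ℝ) - p.2 * a) *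
    (latticeTerm j b τ p - latticeTerm j b τ (p.1, p.2 - 1))

/-- Summation of the lattice sum along the rows. -/
theorem latticeSum_eq_gEis {y : ℝ} (hy : 0 < y) (j : ℕ) {a b : ℝ} (ha0 : 0 < a) (ha1 : a < 1)
    (hb0 : 0 < b) (hb1 : b < 1) :
    latticeSum j a b (Complex.I * y) =
      (-(2 * Real.pi * Complex.I)) ^ (j + 2) / (j + 1).factorial * gEis (j + 2) a b y := by
  have hτ := im_I_mul hy
  have hne : e (-a) ≠ 1 := by
    rw [e_neg, inv_ne_one]
    exact e_ne_one ha0 ha1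
  have hrow : ∀ m : ℤ, Summable fun n : ℤ => latticeTerm j b (Complex.I * y) (m, n) := fun m => by
    simp only [latticeTerm]
    exact summable_inv_add_intCast_pow (((m : ℂ) + b) * (Complex.I * y)) j
  have hS := hasSum_rows_of_summable_diff 0 hne hrow
    (summable_norm_latticeTerm_diff hτ j hb0.le hb1.le)
  set f : ℤ → ℂ := fun m =>
    ∑' n : ℤ, e (m * (0 : ℝ) - n * a) * latticeTerm j b (Complex.I * y) (m, n) with hf
  have hfpos : ∀ n : ℕ, f n = (-(2 * Real.pi * Complex.I)) ^ (j + 2) / (j + 1).factorial *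
      ∑' m : ℕ, doubleTerm b a (fun _ => 1) (fun m => ((m : ℂ) + a) ^ (j + 1)) y (n, m) :=
    fun n => by
      rw [← tsum_gRow hy j ha0 ha1.le hb0 n, hf]
      simp [latticeTerm]
  have hfneg : ∀ n : ℕ, f (-((n : ℤ) + 1)) =
      (-(2 * Real.pi * Complex.I)) ^ (j + 2) / (j + 1).factorial * ((-1) ^ j *
      ∑' m : ℕ, doubleTerm (1 - b) (1 - a) (fun _ => 1)
        (fun m => ((m : ℂ) + (1 - a : ℝ)) ^ (j + 1)) y (n, m)) := fun n => by
    rw [mul_left_comm, ← tsum_gRow hy j (a := 1 - a) (b := 1 - b) (by linarith) (by linarith)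
      (by linarith) n, hf]
    simp only
    rw [← (Equiv.neg ℤ).tsum_eq, ← tsum_mul_left]
    refine tsum_congr fun l => ?_
    have hA : e (((-((n : ℤ) + 1) : ℤ) : ℂ) * (0 : ℝ) - ((-l : ℤ) : ℂ) * a) =
        e (-((l : ℂ) * ((1 - a : ℝ) : ℂ))) := by
      have : -((l : ℂ) * ((1 - a : ℝ) : ℂ)) =
          (((-((n : ℤ) + 1) : ℤ) : ℂ) * (0 : ℝ) - ((-l : ℤ) : ℂ) * a) + ((-l : ℤ) : ℂ) := by
        push_cast
        ring
      rw [this, e_add, e_intCast, mul_one]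
    have hB : (((-((n : ℤ) + 1) : ℤ) : ℂ) + b) * (Complex.I * y) + ((-l : ℤ) : ℂ) =
        -(((n : ℂ) + (1 - b : ℝ)) * (Complex.I * y) + l) := by
      push_cast
      ring
    rw [Equiv.neg_apply, hA, latticeTerm]
    rw [hB, neg_pow, mul_inv, inv_neg_one_pow_add_two]
    ring
  have hs1 : Summable fun n : ℕ => f n :=
    hS.summable.comp_injective (i := fun n : ℕ => (n : ℤ)) Nat.cast_injective
  have hs2 : Summable fun n : ℕ => f (-((n : ℤ) + 1)) := by
    refine hS.summable.comp_injective (i := fun m : ℕ => -((m : ℤ) + 1)) fun m n h => ?_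
    simpa using h
  rw [latticeSum, ← hS.tsum_eq, tsum_of_nat_of_neg_add_one hs1 hs2]
  simp only [hfpos, hfneg]
  rw [tsum_mul_left, tsum_mul_left, tsum_mul_left, gEis,
    gSeries_eq_tsum hy (j + 1) ha0 hb0,
    gSeries_eq_tsum hy (j + 1) (a := 1 - a) (b := 1 - b) (by linarith) (by linarith), pow_add]
  ring

/-- Summation of the lattice sum along the columns. -/
theorem latticeSum_eq_jSeries {y : ℝ} (hy : 0 < y) (j : ℕ) {a b : ℝ} (ha0 : 0 < a) (ha1 : a < 1)
    (hb0 : 0 < b) (hb1 : b < 1) :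
    latticeSum j a b (Complex.I * y) = ((Complex.I * y) ^ (j + 2))⁻¹ *
      ((-(2 * Real.pi * Complex.I)) ^ (j + 2) / (j + 1).factorial *
      (gConst j b + (jSeries (j + 2) a b (1 / y : ℝ) +
        (-1) ^ j * jSeries (j + 2) (-a) (-b) (1 / y : ℝ)))) := by
  have hτ := im_I_mul hy
  have hne : e (-a) ≠ 1 := by
    rw [e_neg, inv_ne_one]
    exact e_ne_one ha0 ha1
  have hy0 : (y : ℂ) ≠ 0 := by exact_mod_cast hy.ne'
  have hyi : 0 < 1 / y := by positivity
  set Q : ℂ := (-(2 * Real.pi * Complex.I)) ^ (j + 2) / (j + 1).factorial with hQ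
  have hpi : (-(2 * Real.pi * Complex.I)) ^ (j + 2) ≠ 0 := by
    simp [Real.pi_ne_zero, Complex.I_ne_zero]
  have hfac : ((j + 1).factorial : ℂ) ≠ 0 := by exact_mod_cast (j + 1).factorial_ne_zero
  have hdiff := summable_norm_latticeTerm_diff hτ j hb0.le hb1.le
  set h := latticeTerm j b (Complex.I * y) with hh
  set C : ℤ → ℂ := fun l => ∑' n : ℤ, h (n, l) with hC
  have hcolz : ∀ n l : ℤ, h (n, l) = ((Complex.I * y) ^ (j + 2))⁻¹ *
      ((((b : ℂ) + -(l * Complex.I / y)) + n) ^ (j + 2))⁻¹ := fun n l => by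
    have hI := Complex.I_ne_zero
    rw [hh, latticeTerm, ← mul_inv, ← mul_pow]
    congr 2
    field_simp
    linear_combination (l : ℂ) * Complex.I_sq
  have hcol : ∀ l : ℤ, Summable fun n : ℤ => h (n, l) := fun l => by
    simp only [hcolz]
    exact (summable_inv_add_intCast_pow ((b : ℂ) + -(l * Complex.I / y)) j).mul_left _
  have hC0 : C 0 = ((Complex.I * y) ^ (j + 2))⁻¹ * (Q * gConst j b) := by
    rw [hC]
    simp only [hcolz]
    rw [tsum_mul_left, gConst, hQ]
    simp only [Int.cast_zero, zero_mul, zero_div, neg_zero, add_zero]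
    generalize ∑' n : ℤ, (((b : ℂ) + n) ^ (j + 2))⁻¹ = T
    field_simp
  have hCneg : ∀ r : ℕ, e (-((-((r : ℤ) + 1) : ℤ) * a)) * C (-((r : ℤ) + 1)) =
      ((Complex.I * y) ^ (j + 2))⁻¹ * (Q * ∑' m : ℕ, doubleTerm 1 1 (fun m => e ((m + 1) * a))
        (fun n => ((n : ℂ) + 1) ^ (j + 1) * e ((n + 1) * b)) ((1 / y : ℝ) : ℂ) (r, m)) :=
    fun r => by
      rw [hQ, ← tsum_gCol hy j a b r, hC]
      simp only [hcolz]
      rw [tsum_mul_left, mul_left_comm]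
      congr 2
      · congr 1
        push_cast
        ring
      · refine tsum_congr fun n => ?_
        congr 3
        push_cast
        ring
  have hCpos : ∀ r : ℕ, e (-(((r : ℤ) + 1 : ℤ) * a)) * C ((r : ℤ) + 1) =
      ((Complex.I * y) ^ (j + 2))⁻¹ * (Q * ((-1) ^ j *
        ∑' m : ℕ, doubleTerm 1 1 (fun m => e ((m + 1) * (-a : ℝ)))
        (fun n => ((n : ℂ) + 1) ^ (j + 1) * e ((n + 1) * (-b : ℝ))) ((1 / y : ℝ) : ℂ) (r, m))) :=
    fun r => by
      rw [mul_left_comm Q, hQ, ← tsum_gCol hy j (-a) (-b) r, hC]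
      simp only [hcolz]
      rw [tsum_mul_left, mul_left_comm]
      congr 1
      rw [mul_left_comm]
      congr 1
      · congr 1
        push_cast
        ring
      · rw [← (Equiv.neg ℤ).tsum_eq, ← tsum_mul_left]
        refine tsum_congr fun n => ?_
        have : (b : ℂ) + -((((r : ℤ) + 1 : ℤ) : ℂ) * Complex.I / y) + ((Equiv.neg ℤ n : ℤ) : ℂ) =
            -(((-b : ℝ) : ℂ) + ((r : ℂ) + 1) * Complex.I / y + n) := by
          rw [Equiv.neg_apply]
          push_cast
          ring
        rw [this, neg_pow, mul_inv, inv_neg_one_pow_add_two]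
  have hj1 := summable_jSeries_term hyi (j + 1) a b
  have hj2 := summable_jSeries_term hyi (j + 1) (-a) (-b)
  have ht1 : Summable fun r : ℕ => e (-(((r : ℤ) + 1 : ℤ) * a)) * C ((r : ℤ) + 1) := by
    simp only [hCpos]
    exact ((hj2.prod.mul_left _).mul_left _).mul_left _
  have ht2 : Summable fun r : ℕ => e (-((-((r : ℤ) + 1) : ℤ) * a)) * C (-((r : ℤ) + 1)) := by
    simp only [hCneg]
    exact (hj1.prod.mul_left _).mul_left _
  have hnorm : ∀ n : ℤ, ‖e (-(n * a))‖ = 1 := fun n => by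
    simpa using norm_e_sub 0 n 0 a
  have hCsum : Summable C := by
    have := (Summable.of_add_one_of_neg_add_one (f := fun l : ℤ => e (-(l * a)) * C l) ht1 ht2).norm
    refine Summable.of_norm (this.congr fun l => ?_)
    rw [norm_mul, hnorm, one_mul]
  -- the differences are absolutely summable, so that the columns may be summed first; as the column
  -- sums `C` are summable, the summation by parts can then be undone
  have hcols : latticeSum j a b (Complex.I * y) = ∑' l : ℤ, e (-(l * a)) * C l := by
    have hs : Summable fun p : ℤ × ℤ => e (p.1 * (0 : ℝ) - p.2 * a) *
        (h p - h (p.1, p.2 - 1)) := by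
      refine Summable.of_norm (hdiff.congr fun p => ?_)
      rw [norm_mul, norm_e_sub, one_mul]
    have hs' := (Equiv.prodComm ℤ ℤ).summable_iff.mpr hs
    have hne' : 1 - e (-a) ≠ 0 := sub_ne_zero.mpr (Ne.symm hne)
    have hpart := tsum_char_mul_diff hCsum a 0
    rw [latticeSum, inv_mul_eq_iff_eq_mul₀ hne']
    simp only [Complex.ofReal_zero, zero_sub] at hpart
    rw [← hpart, ← (Equiv.prodComm ℤ ℤ).tsum_eq]
    refine hs'.tsum_prod.trans (tsum_congr fun l => ?_)
    simp only [Function.comp_apply, Equiv.prodComm_apply, Prod.swap_prod_mk, Complex.ofReal_zero,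
      mul_zero, zero_sub]
    rw [tsum_mul_left, (hcol l).tsum_sub (hcol (l - 1))]
  have hz : e (-(((0 : ℤ) : ℂ) * a)) = 1 := by simp [e]
  have hJ : ∀ a b : ℝ, ∑' (r : ℕ) (m : ℕ), doubleTerm 1 1 (fun m => e ((m + 1) * a))
      (fun n => ((n : ℂ) + 1) ^ (j + 1) * e ((n + 1) * b)) ((1 / y : ℝ) : ℂ) (r, m) =
      jSeries (j + 2) a b (1 / y : ℝ) := fun a b =>
    (summable_jSeries_term hyi (j + 1) a b).tsum_prod.symm
  have htot := tsum_of_add_one_of_neg_add_one (f := fun l : ℤ => e (-(l * a)) * C l) ht1 ht2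
  rw [hcols, htot, hz, one_mul, hC0, tsum_congr hCpos, tsum_congr hCneg]
  simp only [tsum_mul_left]
  rw [hJ, hJ]
  ring

/-- Expansion at the cusp `0` of `G^{(k)}`, `k ≥ 2`: the double series over `ℤ²` obtained from the
Lipschitz formula in the first variable is summed in the other order, where the Lipschitz formula
applies to the second variable. -/
theorem gEis_inv {y : ℝ} (hy : 0 < y) (j : ℕ) {a b : ℝ} (ha0 : 0 < a) (ha1 : a < 1)
    (hb0 : 0 < b) (hb1 : b < 1) :
    gEis (j + 2) a b y = ((Complex.I * y) ^ (j + 2))⁻¹ *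
      (gConst j b + (jSeries (j + 2) a b (1 / y : ℝ) +
        (-1) ^ j * jSeries (j + 2) (-a) (-b) (1 / y : ℝ))) := by
  have hpi : (-(2 * Real.pi * Complex.I)) ^ (j + 2) ≠ 0 := by
    simp [Real.pi_ne_zero, Complex.I_ne_zero]
  have hfac : ((j + 1).factorial : ℂ) ≠ 0 := by exact_mod_cast (j + 1).factorial_ne_zero
  apply mul_left_cancel₀ (div_ne_zero hpi hfac)
  rw [← latticeSum_eq_gEis hy j ha0 ha1 hb0 hb1, latticeSum_eq_jSeries hy j ha0 ha1 hb0 hb1,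
    mul_left_comm]

/-! ### The series `G` of weight one: inversion -/

/-- The odd function `e(b)/(1 - e(b)) + 1/2 = (i/2) cot(πb)`. -/
def cotFun (b : ℝ) : ℂ := e b / (1 - e b) + 1 / 2

theorem e_one_sub (b : ℝ) : e ((1 - b : ℝ) : ℂ) = (e b)⁻¹ := by
  have := e_add (-(b : ℂ)) ((1 : ℤ) : ℂ)
  rw [e_intCast, mul_one, e_neg] at this
  rw [← this]
  congr 1
  push_cast
  ring

theorem cotFun_one_sub {b : ℝ} (h0 : 0 < b) (h1 : b < 1) : cotFun (1 - b) = -cotFun b := by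
  have hne := sub_ne_zero.mpr (e_ne_one h0 h1).symm
  have hne' := sub_ne_zero.mpr (e_ne_one h0 h1)
  have h := e_ne_zero b
  rw [cotFun, cotFun, e_one_sub]
  have : 1 - (e b)⁻¹ ≠ 0 := by
    rw [sub_ne_zero, ne_comm, inv_ne_one]
    exact e_ne_one h0 h1
  field_simp
  ring

theorem hasDerivAt_e (b : ℝ) :
    HasDerivAt (fun b : ℝ => e b) (2 * Real.pi * Complex.I * e b) b := by
  have h : HasDerivAt (fun z : ℂ => e z) (e b * (2 * Real.pi * Complex.I * 1)) (b : ℂ) :=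
    ((hasDerivAt_id (b : ℂ)).const_mul (2 * (Real.pi : ℂ) * Complex.I)).cexp
  have := h.comp_ofReal
  rwa [mul_one, mul_comm] at this

theorem hasDerivAt_cotFun {b : ℝ} (h0 : 0 < b) (h1 : b < 1) :
    HasDerivAt cotFun (2 * Real.pi * Complex.I * (e b / (1 - e b) ^ 2)) b := by
  have hne := sub_ne_zero.mpr (e_ne_one h0 h1).symm
  have h := ((hasDerivAt_e b).div ((hasDerivAt_e b).const_sub 1) hne).add_const (1 / 2 : ℂ)
  refine h.congr_deriv ?_
  field_simp
  ring

/-- The Lipschitz formula of weight two on the real line, as a limit from the upper half-plane. -/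
theorem gConst_zero {b : ℝ} (h0 : 0 < b) (h1 : b < 1) : gConst 0 b = e b / (1 - e b) ^ 2 := by
  have hlim1 : Tendsto (fun ε : ℝ => ∑' n : ℤ, (((b : ℂ) + ε * Complex.I + n) ^ 2)⁻¹) (𝓝[>] 0)
      (𝓝 (∑' n : ℤ, (((b : ℂ) + n) ^ 2)⁻¹)) := by
    have hsum : Summable fun n : ℤ => ‖(((b : ℂ) + n) ^ 2)⁻¹‖ := by
      have h := (summable_inv_add_intCast_pow (b : ℂ) 0).norm
      rwa [zero_add] at h
    refine tendsto_tsum_of_dominated_convergence hsum (fun n => ?_)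
      (Eventually.of_forall fun ε n => ?_)
    · have hne : ((b : ℂ) + n) ^ 2 ≠ 0 := by
        refine pow_ne_zero 2 fun h => ?_
        have h' : b + n = 0 := by exact_mod_cast h
        have h2 : (-1 : ℝ) < n := by linarith
        have h3 : (n : ℝ) < 0 := by linarith
        have h4 : -1 < n := by exact_mod_cast h2
        have h5 : n < 0 := by exact_mod_cast h3
        omega
      have hc : Continuous fun ε : ℝ => ((b : ℂ) + ε * Complex.I + n) ^ 2 := by fun_prop
      have hc' := (hc.tendsto 0).mono_left (nhdsWithin_le_nhds (s := Ioi 0))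
      simp only [Complex.ofReal_zero, zero_mul, add_zero] at hc'
      exact hc'.inv₀ hne
    · rw [norm_inv, norm_inv, norm_pow, norm_pow]
      have hn : ‖(b : ℂ) + n‖ ≤ ‖(b : ℂ) + ε * Complex.I + n‖ := by
        have h := Complex.abs_re_le_norm ((b : ℂ) + ε * Complex.I + n)
        have e1 : (b : ℂ) + n = ((b + n : ℝ) : ℂ) := by push_cast; ring
        rw [e1, Complex.norm_real, Real.norm_eq_abs]
        simpa using h
      have hpos : 0 < ‖(b : ℂ) + n‖ := by
        rw [norm_pos_iff]
        intro h
        have h' : b + n = 0 := by exact_mod_cast h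
        have h2 : (-1 : ℝ) < n := by linarith
        have h3 : (n : ℝ) < 0 := by linarith
        have h4 : -1 < n := by exact_mod_cast h2
        have h5 : n < 0 := by exact_mod_cast h3
        omega
      gcongr
  have hlim2 : Tendsto (fun ε : ℝ => (-(2 * Real.pi * Complex.I)) ^ 2 *
      (e (b + ε * Complex.I) / (1 - e (b + ε * Complex.I)) ^ 2)) (𝓝[>] 0)
      (𝓝 ((-(2 * Real.pi * Complex.I)) ^ 2 * (e b / (1 - e b) ^ 2))) := by
    have hc : Continuous fun ε : ℝ => e (b + ε * Complex.I) := by unfold e; fun_prop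
    have hc' := (hc.tendsto 0).mono_left (nhdsWithin_le_nhds (s := Ioi 0))
    simp only [Complex.ofReal_zero, zero_mul, add_zero] at hc'
    exact (hc'.div ((hc'.const_sub 1).pow 2)
      (pow_ne_zero 2 (sub_ne_zero.mpr (e_ne_one h0 h1).symm))).const_mul _
  have heq : (fun ε : ℝ => ∑' n : ℤ, (((b : ℂ) + ε * Complex.I + n) ^ 2)⁻¹) =ᶠ[𝓝[>] 0]
      fun ε : ℝ => (-(2 * Real.pi * Complex.I)) ^ 2 *
      (e (b + ε * Complex.I) / (1 - e (b + ε * Complex.I)) ^ 2) := by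
    filter_upwards [self_mem_nhdsWithin] with ε hε
    have hε' : 0 < ε := hε
    have hz : 0 < ((b : ℂ) + ε * Complex.I).im := by simpa using hε'
    have h := (hasSum_lipschitz 0 hz zero_lt_one le_rfl).tsum_eq
    have hone : ∀ n : ℤ, e (-(n * (1 : ℝ))) = 1 := fun n => by
      rw [Complex.ofReal_one, mul_one, ← Int.cast_neg]
      exact e_intCast _
    simp only [hone, one_mul] at h
    have hq : ‖e (b + ε * Complex.I)‖ < 1 := by
      have hre : (2 * Real.pi * Complex.I * ((b : ℂ) + ε * Complex.I)).re = -(2 * Real.pi * ε) := by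
        simp
      rw [e, Complex.norm_exp, hre, Real.exp_lt_one_iff]
      have := Real.pi_pos
      nlinarith
    have hgeo := tsum_coe_mul_geometric_of_norm_lt_one hq
    have hs : Summable fun n : ℕ => (n : ℂ) * e (b + ε * Complex.I) ^ n := by
      simpa using summable_pow_mul_geometric_of_norm_lt_one 1 hq
    have hpow : ∀ (n : ℕ) (z : ℂ), e (n * z) = e z ^ n := fun n z => by
      rw [e, e, ← Complex.exp_nat_mul]
      ring_nf
    rw [hs.tsum_eq_zero_add] at hgeo
    rw [h]
    simp only [Nat.factorial_one, zero_add, Nat.cast_one, div_one, pow_one, Complex.ofReal_one]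
    rw [← hgeo]
    congr 1
    simp only [Nat.cast_zero, zero_mul, zero_add]
    refine tsum_congr fun n => ?_
    rw [← hpow]
    push_cast
    rfl
  have := tendsto_nhds_unique (hlim1.congr' heq) hlim2
  rw [gConst]
  simp only [zero_add, Nat.factorial_one, Nat.cast_one]
  rw [this]
  have hpi : (-(2 * Real.pi * Complex.I)) ≠ 0 := by
    simp [Real.pi_ne_zero, Complex.I_ne_zero]
  field_simp

theorem hasDerivAt_gSeries_one {y : ℝ} (hy : 0 < y) {a b : ℝ} (ha : 0 < a) (hb : 0 < b) :
    HasDerivAt (fun b : ℝ => gSeries 1 a b y) (-(2 * Real.pi * y) * gSeries 2 a b y) b := by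
  have hy' : 0 < ((y : ℂ)).re := by simpa using hy
  set u : ℕ × ℕ → ℝ := fun p => 2 * Real.pi * y *
    ‖doubleTerm a (b / 2) (fun m => ((m : ℂ) + a) ^ 1) (fun _ => 1) y p‖ with hu
  have hus : Summable u := (summable_norm_doubleTerm ha (by linarith) (polyBounded_pow ha 1)
    (polyBounded_one (b / 2)) hy').mul_left _
  have hderiv : ∀ (p : ℕ × ℕ) (t : ℝ), t ∈ Ioi (b / 2) →
      HasDerivAt (fun t : ℝ => doubleTerm a t (fun m => ((m : ℂ) + a) ^ (1 - 1)) (fun _ => 1) y p)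
        (-(2 * Real.pi * y) *
          doubleTerm a t (fun m => ((m : ℂ) + a) ^ (2 - 1)) (fun _ => 1) y p) t := fun p t _ => by
    have h1 : HasDerivAt (fun t : ℝ => -((2 * Real.pi * ((p.1 + a) * (p.2 + t)) : ℝ) : ℂ) * y)
        (-((2 * Real.pi * ((p.1 + a) * 1) : ℝ) : ℂ) * y) t :=
      ((((((hasDerivAt_id t).const_add (p.2 : ℝ)).const_mul (p.1 + a)).const_mul
        (2 * Real.pi)).ofReal_comp).neg).mul_const _
    refine (h1.cexp.const_mul _).congr_deriv ?_
    rw [doubleTerm]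
    push_cast
    ring
  have hle : ∀ (p : ℕ × ℕ) (t : ℝ), t ∈ Ioi (b / 2) → ‖-(2 * Real.pi * y) *
      doubleTerm a t (fun m => ((m : ℂ) + a) ^ (2 - 1)) (fun _ => 1) y p‖ ≤ u p := fun p t ht => by
    have ht' : b / 2 < t := ht
    have h1 : ‖(-(2 * Real.pi * y) : ℂ)‖ = 2 * Real.pi * y := by
      rw [norm_neg, show (2 * Real.pi * y : ℂ) = ((2 * Real.pi * y : ℝ) : ℂ) by push_cast; ring,
        Complex.norm_real, Real.norm_of_nonneg (by positivity)]
    rw [norm_mul, h1, hu]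
    simp only
    rw [norm_doubleTerm, norm_doubleTerm]
    have hpi := Real.pi_pos
    have hx : (0 : ℝ) < p.1 + a := by positivity
    gcongr
  have h0 : Summable fun p : ℕ × ℕ =>
      doubleTerm a b (fun m => ((m : ℂ) + a) ^ (1 - 1)) (fun _ => 1) y p :=
    (summable_norm_doubleTerm ha hb (polyBounded_pow ha 0) (polyBounded_one b) hy').of_norm
  have hmem : b ∈ Ioi (b / 2) := by
    rw [mem_Ioi]
    linarith
  have := hasDerivAt_tsum_of_isPreconnected hus isOpen_Ioi (convex_Ioi _).isPreconnected hderiv hle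
    hmem h0 hmem
  rw [tsum_mul_left] at this
  exact this

theorem hasDerivAt_gEis_one {y : ℝ} (hy : 0 < y) {a b : ℝ} (ha0 : 0 < a) (ha1 : a < 1)
    (hb0 : 0 < b) (hb1 : b < 1) :
    HasDerivAt (fun b : ℝ => gEis 1 a b y) (-(2 * Real.pi * y) * gEis 2 a b y) b := by
  have h1 := hasDerivAt_gSeries_one hy ha0 hb0
  have h2 := (hasDerivAt_gSeries_one hy (a := 1 - a) (b := 1 - b) (by linarith)
    (by linarith)).scomp b ((hasDerivAt_id b).const_sub 1)
  have h := h1.add (h2.const_mul ((-1 : ℂ) ^ 1))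
  refine h.congr_deriv ?_
  rw [gEis, neg_smul, one_smul]
  ring

theorem hasDerivAt_jSeries_one {y : ℝ} (hy : 0 < y) (a b : ℝ) :
    HasDerivAt (fun b : ℝ => jSeries 1 a b y) (2 * Real.pi * Complex.I * jSeries 2 a b y) b := by
  have hy' : 0 < ((y : ℂ)).re := by simpa using hy
  set u : ℕ × ℕ → ℝ := fun p => 2 * Real.pi *
    ‖doubleTerm 1 1 (fun m => e ((m + 1) * a)) (fun n => ((n : ℂ) + 1) ^ 1 * e ((n + 1) * b)) y p‖
    with hu
  have hus : Summable u := (summable_norm_doubleTerm zero_lt_one zero_lt_one (polyBounded_e 1 a)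
    (polyBounded_pow_mul_e 1 b) hy').mul_left _
  have hderiv : ∀ (p : ℕ × ℕ) (t : ℝ), t ∈ univ →
      HasDerivAt (fun t : ℝ => doubleTerm 1 1 (fun m => e ((m + 1) * a))
        (fun n => ((n : ℂ) + 1) ^ (1 - 1) * e ((n + 1) * t)) y p)
        (2 * Real.pi * Complex.I * doubleTerm 1 1 (fun m => e ((m + 1) * a))
          (fun n => ((n : ℂ) + 1) ^ (2 - 1) * e ((n + 1) * t)) y p) t := fun p t _ => by
    have h1 : HasDerivAt (fun t : ℝ => e (((p.2 : ℂ) + 1) * t))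
        (2 * Real.pi * Complex.I * (p.2 + 1) * e (((p.2 : ℂ) + 1) * t)) t := by
      have h : HasDerivAt (fun t : ℝ => 2 * Real.pi * Complex.I * (((p.2 : ℂ) + 1) * t))
          (2 * Real.pi * Complex.I * (((p.2 : ℂ) + 1) * 1)) t :=
        ((((hasDerivAt_id t).ofReal_comp).const_mul _).const_mul _)
      refine h.cexp.congr_deriv ?_
      rw [e]
      ring
    refine (((h1.const_mul _).const_mul _).mul_const _).congr_deriv ?_
    rw [doubleTerm]
    push_cast
    ring
  have hle : ∀ (p : ℕ × ℕ) (t : ℝ), t ∈ univ → ‖2 * Real.pi * Complex.I *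
      doubleTerm 1 1 (fun m => e ((m + 1) * a))
          (fun n => ((n : ℂ) + 1) ^ (2 - 1) * e ((n + 1) * t)) y p‖ ≤ u p := fun p t _ => by
    have h1 : ‖(2 * Real.pi * Complex.I : ℂ)‖ = 2 * Real.pi := by
      simp [Real.pi_pos.le]
    have h2 : ∀ t : ℝ, ‖e (((p.2 : ℂ) + 1) * t)‖ = 1 := fun t => by
      have := norm_e_ofReal ((p.2 + 1) * t)
      push_cast at this
      exact this
    rw [norm_mul, h1, hu]
    simp only
    rw [norm_doubleTerm, norm_doubleTerm, norm_mul, norm_mul, h2, h2]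
  have h0 : Summable fun p : ℕ × ℕ => doubleTerm 1 1 (fun m => e ((m + 1) * a))
        (fun n => ((n : ℂ) + 1) ^ (1 - 1) * e ((n + 1) * b)) y p :=
    summable_jSeries_term hy 0 a b
  have := hasDerivAt_tsum_of_isPreconnected hus isOpen_univ isPreconnected_univ hderiv hle
    (mem_univ b) h0 (mem_univ b)
  rw [tsum_mul_left] at this
  exact this

theorem gSeries_one_comm (a b : ℝ) (w : ℂ) : gSeries 1 a b w = gSeries 1 b a w := by
  rw [gSeries, gSeries, doubleSeries_swap]
  simp

theorem jSeries_one_comm (a b : ℝ) (w : ℂ) : jSeries 1 a b w = jSeries 1 b a w := by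
  rw [jSeries, jSeries, doubleSeries_swap]
  simp

theorem jSeries_one_sub (k : ℕ) (a b : ℝ) (w : ℂ) :
    jSeries k (1 - a) (1 - b) w = jSeries k (-a) (-b) w := by
  have h : ∀ (n : ℕ) (a : ℝ), e (((n : ℂ) + 1) * (1 - a : ℝ)) = e (((n : ℂ) + 1) * (-a : ℝ)) :=
    fun n a => by
      have : ((n : ℂ) + 1) * (1 - a : ℝ) = ((n : ℂ) + 1) * (-a : ℝ) + ((n + 1 : ℤ) : ℂ) := by
        push_cast
        ring
      rw [this, e_add, e_intCast, mul_one]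
  simp only [jSeries, h]

/-- The defect in the inversion formula for `G^{(1)}`; it vanishes by `gOneDefect_eq_zero`. -/
def gOneDefect (y a b : ℝ) : ℂ :=
  Complex.I * y * gEis 1 a b y -
    (cotFun a + cotFun b + (jSeries 1 a b (1 / y : ℝ) - jSeries 1 (-a) (-b) (1 / y : ℝ)))

theorem gOneDefect_comm (y a b : ℝ) : gOneDefect y a b = gOneDefect y b a := by
  rw [gOneDefect, gOneDefect, gEis, gEis, gSeries_one_comm a b, gSeries_one_comm (1 - a),
    jSeries_one_comm a b, jSeries_one_comm (-a)]
  ring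

theorem gOneDefect_one_sub {y a b : ℝ} (ha0 : 0 < a) (ha1 : a < 1) (hb0 : 0 < b) (hb1 : b < 1) :
    gOneDefect y (1 - a) (1 - b) = -gOneDefect y a b := by
  have h := jSeries_one_sub 1 (1 - a) (1 - b) ((1 / y : ℝ) : ℂ)
  rw [sub_sub_cancel, sub_sub_cancel] at h
  rw [gOneDefect, gOneDefect, gEis, gEis, jSeries_one_sub, cotFun_one_sub ha0 ha1,
    cotFun_one_sub hb0 hb1, sub_sub_cancel, sub_sub_cancel, ← h]
  ring

/-- The derivative of the defect in `b` vanishes by the inversion formula in weight two. -/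
theorem gOneDefect_const {y : ℝ} (hy : 0 < y) {a : ℝ} (ha0 : 0 < a) (ha1 : a < 1) :
    ∃ c, ∀ b ∈ Ioo (0 : ℝ) 1, gOneDefect y a b = c := by
  have hy0 : (y : ℂ) ≠ 0 := by exact_mod_cast hy.ne'
  have hyi : 0 < 1 / y := by positivity
  have hd : ∀ b ∈ Ioo (0 : ℝ) 1, HasDerivAt (fun b => gOneDefect y a b) 0 b := fun b hb => by
    have h1 := (hasDerivAt_gEis_one hy ha0 ha1 hb.1 hb.2).const_mul (Complex.I * y)
    have h2 := (hasDerivAt_cotFun hb.1 hb.2).const_add (cotFun a)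
    have h3 := hasDerivAt_jSeries_one hyi a b
    have h4 := (hasDerivAt_jSeries_one hyi (-a) (-b)).scomp b (hasDerivAt_neg b)
    refine (h1.sub (h2.add (h3.sub h4))).congr_deriv ?_
    rw [gEis_inv hy 0 ha0 ha1 hb.1 hb.2, gConst_zero hb.1 hb.2]
    simp only [neg_smul, one_smul, zero_add, pow_zero, one_mul]
    field_simp
    linear_combination (-(2 * Real.pi) * (e b / (1 - e b) ^ 2 + jSeries 2 a b (1 / y : ℝ) +
      jSeries 2 (-a) (-b) (1 / y : ℝ))) * Complex.I_sq
  exact isOpen_Ioo.exists_is_const_of_deriv_eq_zero (convex_Ioo 0 1).isPreconnected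
    (fun b hb => (hd b hb).differentiableAt.differentiableWithinAt) fun b hb => (hd b hb).deriv

/-- The defect does not depend on `b`, nor on `a` by symmetry, and changes sign under
`(a, b) ↦ (1 - a, 1 - b)`. -/
theorem gOneDefect_eq_zero {y : ℝ} (hy : 0 < y) {a b : ℝ} (ha : a ∈ Ioo (0 : ℝ) 1)
    (hb : b ∈ Ioo (0 : ℝ) 1) : gOneDefect y a b = 0 := by
  have key : ∀ a ∈ Ioo (0 : ℝ) 1, ∀ b ∈ Ioo (0 : ℝ) 1, ∀ b' ∈ Ioo (0 : ℝ) 1,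
      gOneDefect y a b = gOneDefect y a b' := fun a ha b hb b' hb' => by
    obtain ⟨c, hc⟩ := gOneDefect_const hy ha.1 ha.2
    rw [hc b hb, hc b' hb']
  have ha' : 1 - a ∈ Ioo (0 : ℝ) 1 := ⟨by linarith [ha.2], by linarith [ha.1]⟩
  have hb' : 1 - b ∈ Ioo (0 : ℝ) 1 := ⟨by linarith [hb.2], by linarith [hb.1]⟩
  have h : gOneDefect y a b = -gOneDefect y a b := by
    rw [← gOneDefect_one_sub ha.1 ha.2 hb.1 hb.2]
    rw [key a ha b hb (1 - b) hb', gOneDefect_comm, key (1 - b) hb' a ha (1 - a) ha',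
      gOneDefect_comm]
  exact self_eq_neg.mp h

/-- Expansion of `G^{(1)}` at the cusp `0`. -/
theorem gEis_one_inv {y : ℝ} (hy : 0 < y) {a b : ℝ} (ha : a ∈ Ioo (0 : ℝ) 1)
    (hb : b ∈ Ioo (0 : ℝ) 1) :
    gEis 1 a b y = (Complex.I * y)⁻¹ *
      (cotFun a + cotFun b + (jSeries 1 a b (1 / y : ℝ) - jSeries 1 (-a) (-b) (1 / y : ℝ))) := by
  have hy0 : Complex.I * (y : ℂ) ≠ 0 :=
    mul_ne_zero Complex.I_ne_zero (by exact_mod_cast hy.ne')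
  rw [eq_inv_mul_iff_mul_eq₀ hy0]
  exact sub_eq_zero.mp (gOneDefect_eq_zero hy ha hb)

/-! ### The Eisenstein series `G` as double series -/

theorem exists_nat_eq_add_frac {x : UnitAddCircle} {t : ℝ} (ht : 0 < t)
    (h : (t : UnitAddCircle) = x) : ∃ n : ℕ, (n : ℝ) + frac x = t := by
  have h1 : ((t - frac x : ℝ) : UnitAddCircle) = 0 := by
    rw [AddCircle.coe_sub, coe_frac, h, sub_self]
  obtain ⟨n, hn⟩ := (AddCircle.coe_eq_zero_iff (1 : ℝ)).mp h1
  rw [zsmul_eq_mul, mul_one] at hn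
  have h2 : (-1 : ℝ) < n := by linarith [frac_lt_one x]
  have h3 : -1 < n := by exact_mod_cast h2
  obtain ⟨m, rfl⟩ := Int.eq_ofNat_of_zero_le (by omega : 0 ≤ n)
  exact ⟨m, by rw [Int.cast_natCast] at hn; linarith⟩

theorem coe_natCast_add_frac (n : ℕ) (x : UnitAddCircle) :
    (((n : ℝ) + frac x : ℝ) : UnitAddCircle) = x := by
  rw [AddCircle.coe_add, coe_frac]
  have : ((n : ℝ) : UnitAddCircle) = 0 :=
    (AddCircle.coe_eq_zero_iff (1 : ℝ)).mpr ⟨n, by simp⟩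
  rw [this, zero_add]

theorem eisGSum_eq {k : ℕ} {x : UnitAddCircle × UnitAddCircle} (h1 : x.1 ≠ 0) (h2 : x.2 ≠ 0)
    (y : ℝ) : eisGSum k x (Complex.I * y) = gSeries k (frac x.1) (frac x.2) y := by
  have hp1 := frac_pos h1
  have hp2 := frac_pos h2
  let φ : ℕ × ℕ → {p : ℝ × ℝ // 0 < p.1 ∧ 0 < p.2 ∧
      (p.1 : UnitAddCircle) = x.1 ∧ (p.2 : UnitAddCircle) = x.2} := fun n =>
    ⟨((n.1 : ℝ) + frac x.1, (n.2 : ℝ) + frac x.2), by positivity, by positivity,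
      coe_natCast_add_frac _ _, coe_natCast_add_frac _ _⟩
  have hφ : Function.Bijective φ := by
    constructor
    · intro m n h
      have h' := congrArg Subtype.val h
      simp only [φ, Prod.mk.injEq, add_left_inj, Nat.cast_inj] at h'
      exact Prod.ext h'.1 h'.2
    · rintro ⟨⟨s, t⟩, hs, ht, hs', ht'⟩
      obtain ⟨m, hm⟩ := exists_nat_eq_add_frac hs hs'
      obtain ⟨n, hn⟩ := exists_nat_eq_add_frac ht ht'
      exact ⟨(m, n), Subtype.ext (Prod.ext hm hn)⟩
  rw [eisGSum, gSeries, doubleSeries, ← (Equiv.ofBijective φ hφ).tsum_eq]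
  refine tsum_congr fun n => ?_
  simp only [Equiv.ofBijective_apply, φ, doubleTerm, mul_one]
  rw [e]
  push_cast
  congr 2
  linear_combination (2 * Real.pi * ((n.1 + frac x.1) * (n.2 + frac x.2)) * y : ℂ) * Complex.I_sq

theorem eisG_eq {k : ℕ} {x : UnitAddCircle × UnitAddCircle} (h1 : x.1 ≠ 0) (h2 : x.2 ≠ 0)
    (y : ℝ) : eisG k x (Complex.I * y) = gEis k (frac x.1) (frac x.2) y := by
  have hc : eisGConst k x = 0 := by
    simp [eisGConst, h1, h2]
  have h1' : (-x).1 ≠ 0 := neg_ne_zero.mpr h1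
  have h2' : (-x).2 ≠ 0 := neg_ne_zero.mpr h2
  rw [eisG, hc, eisGSum_eq h1 h2, eisGSum_eq h1' h2', Prod.fst_neg, Prod.snd_neg, frac_neg h1,
    frac_neg h2, gEis, Complex.ofReal_zero, zero_add]

/-! ### Eichler integrals -/

/-- The non-constant part of the Fourier expansion of `-E^{(k)}_{(a, b)}`. -/
def eisTail (k : ℕ) (a b : ℝ) (w : ℂ) : ℂ :=
  eisSeries k a b w + (-1) ^ k * eisSeries k (1 - a) (-b) w

/-- The termwise primitive of `eisSeries`, up to the factor `-2π`. -/
def eichSeries (k : ℕ) (a b : ℝ) (w : ℂ) : ℂ :=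
  doubleSeries 1 a (fun m => e ((m + 1) * b) / (m + 1)) (fun n => ((n : ℂ) + a) ^ (k - 2)) w

/-- The exponentially small part of the Eichler integral of `-E^{(k)}_{(a, b)}`. -/
def eichTail (k : ℕ) (a b : ℝ) (w : ℂ) : ℂ :=
  eichSeries k a b w + (-1) ^ k * eichSeries k (1 - a) (-b) w

theorem polyBounded_e_div (b : ℝ) : PolyBounded 1 0 fun m => e (((m : ℂ) + 1) * b) / (m + 1) :=
  fun m => by
    have h := polyBounded_e 1 b m
    have h1 : (1 : ℝ) ≤ ‖(m : ℂ) + 1‖ := by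
      have : ‖(m : ℂ) + 1‖ = m + 1 := by
        exact_mod_cast Complex.norm_natCast (m + 1)
      rw [this]
      simp
    rw [pow_zero] at h ⊢
    rw [norm_div]
    exact div_le_one_of_le₀ (h.trans h1) (norm_nonneg _)

theorem eisE_eq_tail {y : ℝ} (hy : 0 < y) {k : ℕ} (hk : 2 ≤ k)
    {x : UnitAddCircle × UnitAddCircle} (hx : x.1 ≠ 0) :
    eisE k x (Complex.I * y) =
      ((bernoulliFun k (frac x.1) / k : ℝ) : ℂ) - eisTail k (frac x.1) (frac x.2) y := by
  obtain ⟨j, rfl⟩ := Nat.exists_eq_add_of_le' hk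
  rw [eisE_eq hy j hx, eisTail, pow_add]
  push_cast
  ring

theorem expDecay_eisTail (k : ℕ) {a : ℝ} (ha0 : 0 < a) (ha1 : a < 1) (b : ℝ) :
    ExpDecay fun y : ℝ => eisTail k a b y :=
  (expDecay_doubleSeries zero_lt_one ha0 (polyBounded_e 1 b) (polyBounded_pow ha0 _)).add
    ((expDecay_doubleSeries zero_lt_one (sub_pos.mpr ha1) (polyBounded_e 1 (-b))
      (polyBounded_pow (sub_pos.mpr ha1) _)).const_mul _)

theorem expDecay_eichTail (k : ℕ) {a : ℝ} (ha0 : 0 < a) (ha1 : a < 1) (b : ℝ) :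
    ExpDecay fun y : ℝ => eichTail k a b y :=
  (expDecay_doubleSeries zero_lt_one ha0 (polyBounded_e_div b) (polyBounded_pow ha0 _)).add
    ((expDecay_doubleSeries zero_lt_one (sub_pos.mpr ha1) (polyBounded_e_div (-b))
      (polyBounded_pow (sub_pos.mpr ha1) _)).const_mul _)

theorem contDiffOn_eisTail (k : ℕ) {a : ℝ} (ha0 : 0 < a) (ha1 : a < 1) (b : ℝ) :
    ContDiffOn ℝ ∞ (fun y : ℝ => eisTail k a b y) (Ioi 0) :=
  (contDiffOn_doubleSeries zero_lt_one ha0 (polyBounded_e 1 b) (polyBounded_pow ha0 _)).add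
    (contDiffOn_const.mul (contDiffOn_doubleSeries zero_lt_one (sub_pos.mpr ha1)
      (polyBounded_e 1 (-b)) (polyBounded_pow (sub_pos.mpr ha1) _)))

theorem contDiffOn_eichTail (k : ℕ) {a : ℝ} (ha0 : 0 < a) (ha1 : a < 1) (b : ℝ) :
    ContDiffOn ℝ ∞ (fun y : ℝ => eichTail k a b y) (Ioi 0) :=
  (contDiffOn_doubleSeries zero_lt_one ha0 (polyBounded_e_div b) (polyBounded_pow ha0 _)).add
    (contDiffOn_const.mul (contDiffOn_doubleSeries zero_lt_one (sub_pos.mpr ha1)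
      (polyBounded_e_div (-b)) (polyBounded_pow (sub_pos.mpr ha1) _)))

theorem hasDerivAt_eichSeries {y : ℝ} (hy : 0 < y) {k : ℕ} (hk : 2 ≤ k) {a : ℝ} (ha : 0 < a)
    (b : ℝ) :
    HasDerivAt (fun y : ℝ => eichSeries k a b y) (-(2 * Real.pi) * eisSeries k a b y) y := by
  have hy' : 0 < ((y : ℂ)).re := by simpa using hy
  have h := (hasDerivAt_doubleSeries zero_lt_one ha (polyBounded_e_div b)
    (polyBounded_pow ha (k - 2)) hy').comp_ofReal
  refine h.congr_deriv ?_
  rw [eisSeries]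
  congr 2
  · ext m
    have : (m : ℂ) + 1 ≠ 0 := by exact_mod_cast m.succ_ne_zero
    push_cast
    field_simp
  · ext n
    rw [← pow_succ]
    congr 1
    omega

theorem hasDerivAt_eichTail {y : ℝ} (hy : 0 < y) {k : ℕ} (hk : 2 ≤ k) {a : ℝ} (ha0 : 0 < a)
    (ha1 : a < 1) (b : ℝ) :
    HasDerivAt (fun y : ℝ => eichTail k a b y) (-(2 * Real.pi) * eisTail k a b y) y := by
  refine ((hasDerivAt_eichSeries hy hk ha0 b).add ((hasDerivAt_eichSeries hy hk
    (sub_pos.mpr ha1) (-b)).const_mul _)).congr_deriv ?_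
  rw [eisTail]
  ring

/-- The Eichler integral of `E^{(k)}_{(a, b)}` at `iy`. -/
def eichFun (k : ℕ) (a b y : ℝ) : ℂ :=
  -(2 * Real.pi) * (bernoulliFun k a / k : ℝ) * y - eichTail k a b y

theorem isPolyPart_eichFun (k : ℕ) {a : ℝ} (ha0 : 0 < a) (ha1 : a < 1) (b : ℝ) :
    IsPolyPart (eichFun k a b)
      (Polynomial.C (2 * Real.pi * Complex.I * (bernoulliFun k a / k : ℝ)) * Polynomial.X) := by
  refine (expDecay_eichTail k ha0 ha1 b).neg.congr fun y _ => ?_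
  simp only [eichFun, Polynomial.eval_mul, Polynomial.eval_C, Polynomial.eval_X]
  generalize (((bernoulliFun k a / k : ℝ)) : ℂ) = γ
  linear_combination (-(2 * Real.pi * γ * y) : ℂ) * Complex.I_sq

theorem hasDerivAt_eichFun {y : ℝ} (hy : 0 < y) {k : ℕ} (hk : 2 ≤ k)
    {x : UnitAddCircle × UnitAddCircle} (hx : x.1 ≠ 0) :
    HasDerivAt (eichFun k (frac x.1) (frac x.2))
      (2 * Real.pi * Complex.I * eisE k x (Complex.I * y) * Complex.I) y := by
  have h1 := ((hasDerivAt_id y).ofReal_comp).const_mul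
    (-(2 * Real.pi) * (bernoulliFun k (frac x.1) / k : ℝ) : ℂ)
  refine (h1.sub (hasDerivAt_eichTail hy hk (frac_pos hx) (frac_lt_one _) _)).congr_deriv ?_
  rw [eisE_eq_tail hy hk hx]
  generalize (((bernoulliFun k (frac x.1) / k : ℝ)) : ℂ) = γ
  push_cast
  linear_combination (-(2 * Real.pi * (γ - eisTail k (frac x.1) (frac x.2) y)) : ℂ) * Complex.I_sq

theorem contDiffOn_eichFun (k : ℕ) {a : ℝ} (ha0 : 0 < a) (ha1 : a < 1) (b : ℝ) :
    ContDiffOn ℝ ∞ (eichFun k a b) (Ioi 0) :=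
  (contDiff_const.mul Complex.ofRealCLM.contDiff).contDiffOn.sub (contDiffOn_eichTail k ha0 ha1 b)

theorem isEichlerIntegral_eichFun {k : ℕ} (hk : 2 ≤ k) {x : UnitAddCircle × UnitAddCircle}
    (hx : x.1 ≠ 0) :
    IsEichlerIntegral (fun y => eisE k x (Complex.I * y)) (eichFun k (frac x.1) (frac x.2)) := by
  have hp := isPolyPart_eichFun k (frac_pos hx) (frac_lt_one x.1) (frac x.2)
  refine ⟨fun y hy => hasDerivAt_eichFun hy hk hx,
    ⟨contDiffOn_eichFun k (frac_pos hx) (frac_lt_one _) _, _, hp⟩, ?_⟩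
  rw [regValueInfty, polyPart_eq hp]
  simp

/-- Uniqueness of the Eichler integral on the half-axis. -/
theorem IsEichlerIntegral.eq {f F F' : ℝ → ℂ} (h : IsEichlerIntegral f F)
    (h' : IsEichlerIntegral f F') {y : ℝ} (hy : 0 < y) : F y = F' y := by
  obtain ⟨hd, ⟨-, p, hp⟩, hv⟩ := h
  obtain ⟨hd', ⟨-, p', hp'⟩, hv'⟩ := h'
  have hD : ∀ t ∈ Ioi (0 : ℝ), HasDerivAt (fun t => F t - F' t) 0 t := fun t ht =>
    ((hd t ht).sub (hd' t ht)).congr_deriv (sub_self _)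
  obtain ⟨c, hc⟩ := isOpen_Ioi.exists_is_const_of_deriv_eq_zero
    (convex_Ioi (0 : ℝ)).isPreconnected
    (fun t ht => (hD t ht).differentiableAt.differentiableWithinAt) fun t ht => (hD t ht).deriv
  have hq : IsPolyPart F (p' + Polynomial.C c) := by
    refine ExpDecay.congr hp' fun t ht => ?_
    have := hc t ht
    rw [Polynomial.eval_add, Polynomial.eval_C, ← this]
    ring
  rw [regValueInfty, polyPart_eq hq, Polynomial.coeff_add, Polynomial.coeff_C_zero] at hv
  rw [regValueInfty, polyPart_eq hp'] at hv'
  rw [hv', zero_add] at hv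
  have := hc y hy
  rw [hv] at this
  exact sub_eq_zero.mp this

/-- A function whose derivative decays exponentially is the sum of a constant and of a function
which decays exponentially. -/
theorem exists_expDecay_sub_const {D D' : ℝ → ℂ} (hD : ∀ y : ℝ, 0 < y → HasDerivAt D (D' y) y)
    (hc : ContinuousOn D' (Ioi 0)) (h : ExpDecay D') : ∃ d : ℂ, ExpDecay fun y => D y - d := by
  obtain ⟨δ, hδ, hO⟩ := h.exists_exp
  obtain ⟨C, hC⟩ := hO.bound
  obtain ⟨T, hT⟩ := eventually_atTop.mp hC
  set T' := max T 1 with hT'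
  have hbound : ∀ t ∈ Ioi T', ‖D' t‖ ≤ C * Real.exp (-δ * t) := fun t ht => by
    have := hT t ((le_max_left T 1).trans (le_of_lt ht))
    rwa [Real.norm_of_nonneg (Real.exp_pos _).le] at this
  have hint0 : ∀ y, IntegrableOn (fun t : ℝ => C * Real.exp (-δ * t)) (Ioi y) := fun y =>
    (exp_neg_integrableOn_Ioi y hδ).const_mul C
  have hpos : ∀ t ∈ Ioi T', 0 < t := fun t ht =>
    lt_trans (lt_of_lt_of_le zero_lt_one (le_max_right T 1)) ht
  have hint : IntegrableOn D' (Ioi T') := by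
    refine Integrable.mono' (hint0 T') ((hc.mono hpos).aestronglyMeasurable measurableSet_Ioi) ?_
    filter_upwards [ae_restrict_mem measurableSet_Ioi] with t ht using hbound t ht
  have hlim := tendsto_limUnder_of_hasDerivAt_of_integrableOn_Ioi
    (fun t ht => hD t (hpos t ht)) hint
  refine ⟨limUnder atTop D, expDecay_of_exp hδ (Asymptotics.IsBigO.of_bound (C * δ⁻¹) ?_)⟩
  filter_upwards [eventually_gt_atTop T'] with y hy
  have hsub : Ioi y ⊆ Ioi T' := Ioi_subset_Ioi (le_of_lt hy)
  have hi := integral_Ioi_of_hasDerivAt_of_tendsto'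
    (fun t (ht : t ∈ Ici y) => hD t (hpos t (lt_of_lt_of_le hy ht))) (hint.mono_set hsub) hlim
  rw [Real.norm_of_nonneg (Real.exp_pos _).le, ← norm_neg, neg_sub, ← hi]
  calc ‖∫ t in Ioi y, D' t‖ ≤ ∫ t in Ioi y, C * Real.exp (-δ * t) := by
        refine norm_integral_le_of_norm_le (hint0 y) ?_
        filter_upwards [ae_restrict_mem measurableSet_Ioi] with t ht using hbound t (hsub ht)
    _ = _ := by
        rw [integral_const_mul, integral_exp_mul_Ioi (by linarith)]
        field_simp

/-- The Eichler integral at the cusp `0`. -/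
theorem exists_expDecay_eichFun_inv {k : ℕ} (hk : 2 ≤ k) {x : UnitAddCircle × UnitAddCircle}
    (hx₁ : x.1 ≠ 0) (hx₂ : x.2 ≠ 0) :
    ∃ c d : ℂ, ExpDecay fun y : ℝ =>
      eichFun k (frac x.1) (frac x.2) (1 / y) - c * (y : ℂ) ^ (k - 1) - d := by
  set γ : ℂ := ((bernoulliFun k (frac x.2) / k : ℝ) : ℂ) with hγ
  set T : ℝ → ℂ := fun y => eisTail k (frac x.2) (frac (-x.1)) y with hT
  set c : ℂ := 2 * Real.pi * Complex.I ^ k * γ / ((k - 1 : ℕ) : ℂ) with hc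
  have hk1 : ((k - 1 : ℕ) : ℂ) ≠ 0 := by
    exact_mod_cast (by omega : k - 1 ≠ 0)
  have hder : ∀ y : ℝ, 0 < y → HasDerivAt (fun y : ℝ =>
      eichFun k (frac x.1) (frac x.2) (1 / y) - c * (y : ℂ) ^ (k - 1))
      (-(2 * Real.pi * Complex.I ^ k) * ((y : ℂ) ^ (k - 2) * T y)) y := fun y hy => by
    have hyi : 0 < 1 / y := by positivity
    have hy0 : (y : ℂ) ≠ 0 := by exact_mod_cast hy.ne'
    have hinv : HasDerivAt (fun y : ℝ => 1 / y) (-(y ^ 2)⁻¹) y := by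
      simpa using hasDerivAt_inv hy.ne'
    have h1 := (hasDerivAt_eichFun hyi hk hx₁).scomp y hinv
    have h2 := (((hasDerivAt_id y).ofReal_comp).pow (k - 1)).const_mul c
    refine (h1.sub h2).congr_deriv ?_
    rw [eisE_inv hy hk hx₁, eisE_eq_tail hy hk (x := (x.2, -x.1)) hx₂]
    obtain ⟨j, rfl⟩ := Nat.exists_eq_add_of_le' hk
    simp only [Nat.add_sub_cancel, show j + 2 - 1 = j + 1 from rfl] at hc hk1 ⊢
    rw [← hγ, hc]
    change _ • (2 * (Real.pi : ℂ) * Complex.I * ((Complex.I * y) ^ (j + 2) * (γ - T y)) *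
      Complex.I) - _ = _
    rw [mul_pow, pow_add (y : ℂ), Complex.real_smul]
    push_cast at hk1 ⊢
    generalize Complex.I ^ (j + 2) = P
    simp only [id]
    field_simp
    rw [Complex.I_sq]
    ring
  have hcont : ContinuousOn (fun y : ℝ => -(2 * Real.pi * Complex.I ^ k) *
      ((y : ℂ) ^ (k - 2) * T y)) (Ioi 0) := by
    refine continuousOn_const.mul (ContinuousOn.mul (by fun_prop) ?_)
    exact (contDiffOn_eisTail k (frac_pos hx₂) (frac_lt_one _) _).continuousOn
  have hdec : ExpDecay fun y : ℝ => -(2 * Real.pi * Complex.I ^ k) * ((y : ℂ) ^ (k - 2) * T y) :=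
    ((expDecay_eisTail k (frac_pos hx₂) (frac_lt_one _) _).pow_mul _).const_mul _
  obtain ⟨d, hd⟩ := exists_expDecay_sub_const hder hcont hdec
  exact ⟨c, d, hd⟩

/-! ### Regularised Mellin transforms -/

section

/-- The part `∫_1^∞ g(y) y^{s-1} dy` of the Mellin transform. -/
def upperMellin (g : ℝ → ℂ) (s : ℂ) : ℂ := ∫ t in Ioi (1 : ℝ), (t : ℂ) ^ (s - 1) * g t

theorem upperMellin_eq_mellin (g : ℝ → ℂ) (s : ℂ) :
    upperMellin g s = mellin (indicator (Ioi 1) g) s := by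
  have h : ∀ t : ℝ, (t : ℂ) ^ (s - 1) • indicator (Ioi 1) g t =
      indicator (Ioi 1) (fun t : ℝ => (t : ℂ) ^ (s - 1) * g t) t := fun t => by
    by_cases ht : t ∈ Ioi (1 : ℝ) <;> simp [ht]
  rw [upperMellin, mellin]
  simp only [h]
  rw [setIntegral_indicator measurableSet_Ioi, inter_eq_right.mpr (Ioi_subset_Ioi zero_le_one)]

theorem mellinConvergent_indicator_iff (g : ℝ → ℂ) (s : ℂ) :
    MellinConvergent (indicator (Ioi 1) g) s ↔
      IntegrableOn (fun t : ℝ => (t : ℂ) ^ (s - 1) * g t) (Ioi 1) := by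
  have h : (fun t : ℝ => (t : ℂ) ^ (s - 1) • indicator (Ioi 1) g t) =
      indicator (Ioi 1) (fun t : ℝ => (t : ℂ) ^ (s - 1) * g t) := by
    ext t
    by_cases ht : t ∈ Ioi (1 : ℝ) <;> simp [ht]
  rw [MellinConvergent, h, IntegrableOn, integrable_indicator_iff measurableSet_Ioi,
    IntegrableOn, Measure.restrict_restrict measurableSet_Ioi,
    inter_eq_left.mpr (Ioi_subset_Ioi zero_le_one), IntegrableOn]

theorem locallyIntegrableOn_indicator {g : ℝ → ℂ} (hc : ContinuousOn g (Ioi 0)) :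
    LocallyIntegrableOn (indicator (Ioi 1) g) (Ioi 0) := fun x hx => by
  obtain ⟨U, hU, hi⟩ := (hc.locallyIntegrableOn (μ := volume) measurableSet_Ioi) x hx
  exact ⟨U, hU, hi.indicator measurableSet_Ioi⟩

theorem isBigO_indicator_nhdsWithin (g : ℝ → ℂ) (b : ℝ) :
    indicator (Ioi 1) g =O[𝓝[>] 0] fun x : ℝ => x ^ (-b) := by
  refine Asymptotics.IsBigO.of_bound 0 ?_
  have : ∀ᶠ t : ℝ in 𝓝[>] 0, t < 1 := nhdsWithin_le_nhds (Iio_mem_nhds zero_lt_one)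
  filter_upwards [this] with t ht
  rw [indicator_of_notMem (by simpa using ht.le), norm_zero, zero_mul]

theorem ExpDecay.isBigO_indicator {g : ℝ → ℂ} (hd : ExpDecay g) (a : ℝ) :
    indicator (Ioi 1) g =O[atTop] fun x : ℝ => x ^ (-a) := by
  obtain ⟨δ, hδ, h⟩ := hd.exists_exp
  refine (Asymptotics.IsBigO.of_bound 1 (Eventually.of_forall fun t => ?_)).trans
    (h.trans (isLittleO_exp_neg_mul_rpow_atTop hδ (-a)).isBigO)
  rw [one_mul]
  exact norm_indicator_le_norm_self _ _

theorem ExpDecay.integrableOn_upper {g : ℝ → ℂ} (hd : ExpDecay g) (hc : ContinuousOn g (Ioi 0))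
    (s : ℂ) : IntegrableOn (fun t : ℝ => (t : ℂ) ^ (s - 1) * g t) (Ioi 1) := by
  rw [← mellinConvergent_indicator_iff]
  exact mellinConvergent_of_isBigO_rpow (a := s.re + 1) (b := s.re - 1)
    (locallyIntegrableOn_indicator hc) (hd.isBigO_indicator _) (by linarith)
    (isBigO_indicator_nhdsWithin _ _) (by linarith)

theorem ExpDecay.differentiable_upperMellin {g : ℝ → ℂ} (hd : ExpDecay g)
    (hc : ContinuousOn g (Ioi 0)) : Differentiable ℂ (upperMellin g) := fun s => by
  rw [funext (upperMellin_eq_mellin g)]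
  exact mellin_differentiableAt_of_isBigO_rpow (a := s.re + 1) (b := s.re - 1)
    (locallyIntegrableOn_indicator hc) (hd.isBigO_indicator _) (by linarith)
    (isBigO_indicator_nhdsWithin _ _) (by linarith)

theorem upperMellin_congr {f g : ℝ → ℂ} (h : ∀ y : ℝ, 0 < y → f y = g y) (s : ℂ) :
    upperMellin f s = upperMellin g s :=
  setIntegral_congr_fun measurableSet_Ioi fun t ht =>
    congrArg (fun z => (t : ℂ) ^ (s - 1) * z) (h t (zero_lt_one.trans ht))

theorem upperMellin_add {f g : ℝ → ℂ} (hf : ExpDecay f) (hfc : ContinuousOn f (Ioi 0))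
    (hg : ExpDecay g) (hgc : ContinuousOn g (Ioi 0)) (s : ℂ) :
    upperMellin (fun y => f y + g y) s = upperMellin f s + upperMellin g s := by
  rw [upperMellin, upperMellin, upperMellin,
    ← integral_add (hf.integrableOn_upper hfc s) (hg.integrableOn_upper hgc s)]
  simp only [mul_add]

theorem upperMellin_const_mul (a : ℂ) (f : ℝ → ℂ) (s : ℂ) :
    upperMellin (fun y => a * f y) s = a * upperMellin f s := by
  rw [upperMellin, upperMellin, ← integral_const_mul]
  simp only [mul_left_comm]

theorem upperMellin_cpow_mul {f g : ℝ → ℂ} {a : ℂ} (h : ∀ y : ℝ, 0 < y → f y = (y : ℂ) ^ a * g y)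
    (s : ℂ) : upperMellin f s = upperMellin g (s + a) := by
  refine setIntegral_congr_fun measurableSet_Ioi fun t ht => ?_
  have ht' : (0 : ℝ) < t := zero_lt_one.trans ht
  have : (t : ℂ) ≠ 0 := by exact_mod_cast ht'.ne'
  rw [h t ht', ← mul_assoc, ← Complex.cpow_add _ _ this]
  ring_nf

/-- The substitution `y ↦ 1/y` in the part of the Mellin transform over `(0, 1]`. -/
theorem integral_Ioc_inv {g : ℝ → ℂ} {s : ℂ}
    (h : IntegrableOn (fun t : ℝ => (t : ℂ) ^ (-s - 1) * g (1 / t)) (Ioi 1)) :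
    IntegrableOn (fun t : ℝ => (t : ℂ) ^ (s - 1) * g t) (Ioc 0 1) ∧
      ∫ t in Ioc (0 : ℝ) 1, (t : ℂ) ^ (s - 1) * g t = upperMellin (fun t => g (1 / t)) (-s) := by
  set k : ℝ → ℂ := indicator (Ioi 1) fun t => g (1 / t) with hk
  have hconv : MellinConvergent k (-s) := (mellinConvergent_indicator_iff _ _).mpr h
  have hconv' : MellinConvergent (fun t => k t⁻¹) s := by
    have := (MellinConvergent.comp_rpow (f := k) (s := s) (a := -1) (by norm_num)).mpr
      (by simpa [div_neg] using hconv)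
    simpa [Real.rpow_neg_one] using this
  have heq : ∀ t ∈ Ioo (0 : ℝ) 1,
      (t : ℂ) ^ (s - 1) • k t⁻¹ = (t : ℂ) ^ (s - 1) * g t := fun t ht => by
    have : t⁻¹ ∈ Ioi (1 : ℝ) := (one_lt_inv₀ ht.1).mpr ht.2
    rw [hk, indicator_of_mem this, one_div, inv_inv, smul_eq_mul]
  have hzero : ∀ t ∈ Ioi (0 : ℝ) \ Ioo 0 1, (t : ℂ) ^ (s - 1) • k t⁻¹ = 0 := fun t ht => by
    have h1 : 1 ≤ t := by
      by_contra hlt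
      exact ht.2 ⟨ht.1, not_le.mp hlt⟩
    have : t⁻¹ ∉ Ioi (1 : ℝ) := by
      rw [mem_Ioi, not_lt]
      exact inv_le_one_of_one_le₀ h1
    rw [hk, indicator_of_notMem this, smul_zero]
  constructor
  · rw [integrableOn_Ioc_iff_integrableOn_Ioo]
    exact (hconv'.mono_set Ioo_subset_Ioi_self).congr_fun heq measurableSet_Ioo
  · rw [integral_Ioc_eq_integral_Ioo, ← setIntegral_congr_fun measurableSet_Ioo heq,
      upperMellin_eq_mellin, ← hk, ← mellin_comp_inv, mellin]
    exact (setIntegral_eq_of_subset_of_forall_sdiff_eq_zero measurableSet_Ioi Ioo_subset_Ioi_self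
      hzero).symm

/-- The function `h` on the half-axis decays exponentially at `∞`, and `h(1/y) = cyⁿ + d` up to an
error of exponential decay. -/
structure HasCuspExpansion (h : ℝ → ℂ) (n : ℕ) (c d : ℂ) : Prop where
  continuousOn : ContinuousOn h (Ioi 0)
  expDecay : ExpDecay h
  expDecay_inv : ExpDecay fun y => h (1 / y) - c * (y : ℂ) ^ n - d

/-- The Mellin transform of a function with `HasCuspExpansion h n c d`, continued to `ℂ` with
possible simple poles at `n` and `0`. -/
def regMellin (h : ℝ → ℂ) (n : ℕ) (c d s : ℂ) : ℂ :=
  upperMellin h s + upperMellin (fun y => h (1 / y) - c * (y : ℂ) ^ n - d) (-s) +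
    c / (s - n) + d / s

namespace HasCuspExpansion

variable {h g : ℝ → ℂ} {n : ℕ} {c d c' d' : ℂ}

theorem continuousOn_inv (hh : HasCuspExpansion h n c d) :
    ContinuousOn (fun y : ℝ => h (1 / y)) (Ioi 0) := by
  refine hh.continuousOn.comp (continuousOn_const.div continuousOn_id fun y hy => ?_) fun y hy => ?_
  · exact (ne_of_gt hy : y ≠ 0)
  · exact one_div_pos.mpr (mem_Ioi.mp hy)

theorem continuousOn_rem (hh : HasCuspExpansion h n c d) :
    ContinuousOn (fun y : ℝ => h (1 / y) - c * (y : ℂ) ^ n - d) (Ioi 0) :=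
  (hh.continuousOn_inv.sub (by fun_prop)).sub continuousOn_const

theorem congr (hh : HasCuspExpansion h n c d) (hg : ∀ y : ℝ, 0 < y → g y = h y) :
    HasCuspExpansion g n c d :=
  ⟨hh.continuousOn.congr hg, hh.expDecay.congr hg, hh.expDecay_inv.congr fun y hy => by
    rw [hg _ (one_div_pos.mpr hy)]⟩

theorem add (hh : HasCuspExpansion h n c d) (hg : HasCuspExpansion g n c' d') :
    HasCuspExpansion (fun y => h y + g y) n (c + c') (d + d') :=
  ⟨hh.continuousOn.add hg.continuousOn, hh.expDecay.add hg.expDecay,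
    (hh.expDecay_inv.add hg.expDecay_inv).congr fun y _ => by ring⟩

theorem const_mul (hh : HasCuspExpansion h n c d) (a : ℂ) :
    HasCuspExpansion (fun y => a * h y) n (a * c) (a * d) :=
  ⟨continuousOn_const.mul hh.continuousOn, hh.expDecay.const_mul a,
    (hh.expDecay_inv.const_mul a).congr fun y _ => by ring⟩

end HasCuspExpansion

section

variable {h g : ℝ → ℂ} {n : ℕ} {c d c' d' : ℂ}

theorem regMellin_congr (hg : ∀ y : ℝ, 0 < y → g y = h y) (s : ℂ) :
    regMellin g n c d s = regMellin h n c d s := by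
  rw [regMellin, regMellin, upperMellin_congr hg,
    upperMellin_congr (f := fun y : ℝ => g (1 / y) - c * (y : ℂ) ^ n - d)
      (g := fun y : ℝ => h (1 / y) - c * (y : ℂ) ^ n - d)
      (fun y hy => by rw [hg _ (one_div_pos.mpr hy)])]

theorem regMellin_add (hh : HasCuspExpansion h n c d) (hg : HasCuspExpansion g n c' d') (s : ℂ) :
    regMellin (fun y => h y + g y) n (c + c') (d + d') s =
      regMellin h n c d s + regMellin g n c' d' s := by
  have h2 := upperMellin_add hh.expDecay_inv hh.continuousOn_rem hg.expDecay_inv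
    hg.continuousOn_rem (-s)
  have h3 := upperMellin_congr (f := fun y : ℝ =>
      h (1 / y) + g (1 / y) - (c + c') * (y : ℂ) ^ n - (d + d'))
    (g := fun y : ℝ => (h (1 / y) - c * (y : ℂ) ^ n - d) + (g (1 / y) - c' * (y : ℂ) ^ n - d'))
    (fun y _ => by ring) (-s)
  rw [regMellin, regMellin, regMellin, h3, h2,
    upperMellin_add hh.expDecay hh.continuousOn hg.expDecay hg.continuousOn]
  ring

theorem regMellin_const_mul (a : ℂ) (s : ℂ) :
    regMellin (fun y => a * h y) n (a * c) (a * d) s = a * regMellin h n c d s := by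
  have h3 := upperMellin_congr (f := fun y : ℝ => a * h (1 / y) - a * c * (y : ℂ) ^ n - a * d)
    (g := fun y : ℝ => a * (h (1 / y) - c * (y : ℂ) ^ n - d)) (fun y _ => by ring) (-s)
  rw [regMellin, regMellin, h3, upperMellin_const_mul, upperMellin_const_mul]
  ring

/-- Multiplication by `1/y` shifts the regularised Mellin transform. -/
theorem regMellin_div (s : ℂ) :
    regMellin (fun y => (y : ℂ)⁻¹ * h y) (n + 1) c 0 s = regMellin h n c 0 (s - 1) := by
  have h1 := upperMellin_cpow_mul (f := fun y : ℝ => (y : ℂ)⁻¹ * h y) (g := h) (a := -1)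
    (fun y _ => by rw [Complex.cpow_neg_one]) s
  have h2 := upperMellin_cpow_mul
    (f := fun y : ℝ => (((1 / y : ℝ)) : ℂ)⁻¹ * h (1 / y) - c * (y : ℂ) ^ (n + 1) - 0)
    (g := fun y : ℝ => h (1 / y) - c * (y : ℂ) ^ n - 0) (a := 1)
    (fun y _ => by
      rw [Complex.cpow_one]
      push_cast
      rw [one_div, inv_inv]
      ring) (-s)
  rw [regMellin, regMellin, h1, h2]
  push_cast
  rw [show s - (n + 1) = s - 1 - n by ring, show -(s - 1) = -s + 1 by ring, sub_eq_add_neg s 1]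
  simp only [zero_div]

theorem HasCuspExpansion.div (hh : HasCuspExpansion h n c 0) :
    HasCuspExpansion (fun y => (y : ℂ)⁻¹ * h y) (n + 1) c 0 := by
  refine ⟨ContinuousOn.mul (ContinuousOn.inv₀ (by fun_prop) fun y hy => ?_) hh.continuousOn, ?_, ?_⟩
  · exact_mod_cast (ne_of_gt hy : y ≠ 0)
  · refine hh.expDecay.mul_of_isBigO (N := -1) (Asymptotics.IsBigO.of_bound 1 ?_)
    filter_upwards [eventually_gt_atTop 0] with y hy
    rw [Real.rpow_neg_one, one_mul, norm_inv, norm_inv, Complex.norm_real]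
  · refine (hh.expDecay_inv.pow_mul 1).congr fun y hy => ?_
    push_cast
    rw [one_div, inv_inv]
    ring

theorem integral_Ioi_cpow_sub_one {z : ℂ} (hz : z.re < 0) :
    IntegrableOn (fun t : ℝ => (t : ℂ) ^ (z - 1)) (Ioi 1) ∧
      ∫ t in Ioi (1 : ℝ), (t : ℂ) ^ (z - 1) = -1 / z := by
  have hz' : (z - 1).re < -1 := by
    rw [Complex.sub_re, Complex.one_re]
    linarith
  refine ⟨integrableOn_Ioi_cpow_of_lt hz' zero_lt_one, ?_⟩
  rw [integral_Ioi_cpow_of_lt hz' zero_lt_one]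
  simp

/-- The part over `(0, 1]` of the Mellin transform, where it converges. -/
theorem HasCuspExpansion.integral_Ioc (hh : HasCuspExpansion h n c d) {s : ℂ}
    (hc : c = 0 ∨ n < s.re) (hd : d = 0 ∨ 0 < s.re) :
    IntegrableOn (fun t : ℝ => (t : ℂ) ^ (s - 1) * h t) (Ioc 0 1) ∧
      ∫ t in Ioc (0 : ℝ) 1, (t : ℂ) ^ (s - 1) * h t =
        upperMellin (fun y => h (1 / y) - c * (y : ℂ) ^ n - d) (-s) + c / (s - n) + d / s := by
  have hi := hh.expDecay_inv.integrableOn_upper hh.continuousOn_rem (-s)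
  have hcI : IntegrableOn (fun t : ℝ => c * (t : ℂ) ^ ((n - s) - 1)) (Ioi 1) ∧
      ∫ t in Ioi (1 : ℝ), c * (t : ℂ) ^ ((n - s) - 1) = c / (s - n) := by
    rcases hc with rfl | hc
    · simp
    · obtain ⟨h1, h2⟩ := integral_Ioi_cpow_sub_one (z := n - s) (by simpa using hc)
      refine ⟨h1.const_mul c, ?_⟩
      rw [integral_const_mul, h2, ← neg_sub s, neg_div_neg_eq, mul_one_div]
  have hdI : IntegrableOn (fun t : ℝ => d * (t : ℂ) ^ (-s - 1)) (Ioi 1) ∧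
      ∫ t in Ioi (1 : ℝ), d * (t : ℂ) ^ (-s - 1) = d / s := by
    rcases hd with rfl | hd
    · simp
    · obtain ⟨h1, h2⟩ := integral_Ioi_cpow_sub_one (z := -s) (by simpa using hd)
      refine ⟨h1.const_mul d, ?_⟩
      rw [integral_const_mul, h2, neg_div_neg_eq, mul_one_div]
  have heq : ∀ t ∈ Ioi (1 : ℝ), (t : ℂ) ^ (-s - 1) * (h (1 / t) - c * (t : ℂ) ^ n - d) +
      c * (t : ℂ) ^ ((n - s) - 1) + d * (t : ℂ) ^ (-s - 1) =
      (t : ℂ) ^ (-s - 1) * h (1 / t) := fun t ht => by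
    have ht0 : (t : ℂ) ≠ 0 := by exact_mod_cast (zero_lt_one.trans ht).ne'
    rw [show (n : ℂ) - s - 1 = n + (-s - 1) by ring, Complex.cpow_add _ _ ht0,
      Complex.cpow_natCast]
    ring
  have hint := ((hi.add hcI.1).add hdI.1).congr_fun heq measurableSet_Ioi
  refine ⟨(integral_Ioc_inv hint).1, ?_⟩
  rw [(integral_Ioc_inv hint).2, upperMellin, ← setIntegral_congr_fun measurableSet_Ioi heq]
  have e1 := integral_add (hi.add hcI.1) hdI.1
  have e2 := integral_add hi hcI.1
  simp only [Pi.add_apply] at e1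
  rw [e1, e2, hcI.2, hdI.2, upperMellin]

/-- The regularised Mellin transform continues the Mellin transform. -/
theorem HasCuspExpansion.mellin_eq (hh : HasCuspExpansion h n c d) {s : ℂ}
    (hc : c = 0 ∨ n < s.re) (hd : d = 0 ∨ 0 < s.re) :
    MellinConvergent h s ∧ mellin h s = regMellin h n c d s := by
  obtain ⟨h1, h2⟩ := hh.integral_Ioc hc hd
  have h3 := hh.expDecay.integrableOn_upper hh.continuousOn s
  constructor
  · rw [MellinConvergent, ← Ioc_union_Ioi_eq_Ioi zero_le_one]
    exact h1.union h3
  · rw [mellin, ← Ioc_union_Ioi_eq_Ioi zero_le_one]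
    simp only [smul_eq_mul]
    rw [setIntegral_union Ioc_disjoint_Ioi_same measurableSet_Ioi h1 h3, h2,
      regMellin, upperMellin.eq_def h]
    generalize upperMellin _ _ = X
    ring

theorem HasCuspExpansion.differentiableOn_regMellin (hh : HasCuspExpansion h n c d) :
    DifferentiableOn ℂ (regMellin h n c d) {(n : ℂ), 0}ᶜ := fun s hs => by
  simp only [mem_compl_iff, mem_insert_iff, mem_singleton_iff, not_or] at hs
  have h1 := hh.expDecay.differentiable_upperMellin hh.continuousOn s
  have h2 := (hh.expDecay_inv.differentiable_upperMellin hh.continuousOn_rem (-s)).comp s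
    differentiable_neg.differentiableAt
  have h3 : DifferentiableAt ℂ (fun s : ℂ => c / (s - n)) s :=
    (differentiableAt_const c).div (by fun_prop) (sub_ne_zero.mpr hs.1)
  have h4 : DifferentiableAt ℂ (fun s : ℂ => d / s) s :=
    (differentiableAt_const d).div (by fun_prop) hs.2
  exact (((h1.add h2).add h3).add h4).differentiableWithinAt

/-- If `h(1/y)` has no constant term, the generalised Mellin transform is holomorphic off `n`. -/
theorem HasCuspExpansion.isMellinContinuation (hh : HasCuspExpansion h n c 0) :
    IsMellinContinuation h {(n : ℂ)} (regMellin h n c 0) := by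
  have hA := hh.expDecay.differentiable_upperMellin hh.continuousOn
  have hM : DifferentiableOn ℂ (regMellin h n c 0) {(n : ℂ)}ᶜ := fun s hs => by
    have h2 := (hh.expDecay_inv.differentiable_upperMellin hh.continuousOn_rem (-s)).comp s
      differentiable_neg.differentiableAt
    have h3 : DifferentiableAt ℂ (fun s : ℂ => c / (s - n)) s :=
      (differentiableAt_const c).div (by fun_prop) (sub_ne_zero.mpr hs)
    have := ((hA s).add h2).add h3
    refine (this.congr_of_eventuallyEq (Eventually.of_forall fun s => ?_)).differentiableWithinAt
    rw [regMellin, zero_div, add_zero]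
    rfl
  refine ⟨finite_singleton _, hM, {(n : ℂ)}, upperMellin h,
    fun s => regMellin h n c 0 s - upperMellin h s, finite_singleton _, hA.differentiableOn,
    hM.sub hA.differentiableOn, ⟨0, fun s _ => ?_⟩, ⟨n, fun s hs => ?_⟩, fun s _ _ => by ring⟩
  · simp only [mul_comm (h _)]
    exact ⟨hh.expDecay.integrableOn_upper hh.continuousOn s, rfl⟩
  · simp only [mul_comm (h _)]
    obtain ⟨h1, h2⟩ := hh.integral_Ioc (Or.inr hs) (Or.inl rfl)
    refine ⟨h1, ?_⟩
    rw [h2, regMellin]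
    ring

/-- If the Mellin transform is `Γ(s)T(s)V(s)`, up to an exponential factor, where both `T` and `V`
vanish at `-1`, then its continuation vanishes at `-1`: the factor `Γ` has only a simple pole. -/
theorem HasCuspExpansion.regMellin_neg_one_eq_zero (hh : HasCuspExpansion h n c d) {T V : ℂ → ℂ}
    {S : Set ℂ} (hS : S.Finite) (hT : DifferentiableOn ℂ T Sᶜ) (hV : DifferentiableOn ℂ V Sᶜ)
    (hS1 : (-1 : ℂ) ∉ S) (hT1 : T (-1) = 0) (hV1 : V (-1) = 0) {σ : ℝ}
    (hm : ∀ s : ℂ, σ < s.re →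
      mellin h s = (2 * Real.pi : ℂ) ^ (-s) * Complex.Gamma s * (T s * V s)) :
    regMellin h n c d (-1) = 0 := by
  set P : Set ℂ := S ∪ {(n : ℂ), 0} with hP
  have hPf : P.Finite := hS.union (by simp)
  have hn1 : (-1 : ℂ) ≠ n := fun h => by
    have := congrArg Complex.re h
    simp only [Complex.neg_re, Complex.one_re, Complex.natCast_re] at this
    have h0 : (0 : ℝ) ≤ n := Nat.cast_nonneg n
    linarith
  have hP1 : (-1 : ℂ) ∉ P := by
    simp [hP, hS1, hn1]
  have hpi : (2 * Real.pi : ℂ) ≠ 0 := by simp [Real.pi_ne_zero]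
  have hpow : Differentiable ℂ fun s : ℂ => (2 * Real.pi : ℂ) ^ (-s) :=
    differentiable_neg.const_cpow (Or.inl hpi)
  have hF : DifferentiableOn ℂ (regMellin h n c d) Pᶜ :=
    hh.differentiableOn_regMellin.mono (compl_subset_compl.mpr subset_union_right)
  have hT' : DifferentiableOn ℂ T Pᶜ := hT.mono (compl_subset_compl.mpr subset_union_left)
  have hV' : DifferentiableOn ℂ V Pᶜ := hV.mono (compl_subset_compl.mpr subset_union_left)
  have hopen : IsOpen {s : ℂ | max σ n < s.re} := isOpen_lt continuous_const Complex.continuous_re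
  have hinf : {s : ℂ | max σ n < s.re}.Infinite :=
    infinite_of_mem_nhds ((max σ n + 1 : ℝ) : ℂ) (hopen.mem_nhds (by
      rw [mem_ofPred_eq, Complex.ofReal_re]
      linarith))
  obtain ⟨z, hz, hzP⟩ := hinf.exists_notMem_finite hPf
  have hid : EqOn (fun s => (Complex.Gamma s)⁻¹ * regMellin h n c d s)
      (fun s => (2 * Real.pi : ℂ) ^ (-s) * (T s * V s)) Pᶜ := by
    refine eq_of_eventuallyEq_off_finite hPf
      (Complex.differentiable_one_div_Gamma.differentiableOn.mul hF)
      (hpow.differentiableOn.mul (hT'.mul hV')) hzP ?_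
    filter_upwards [hopen.mem_nhds hz] with s hs
    have hs1 : σ < s.re := lt_of_le_of_lt (le_max_left _ _) hs
    have hs2 : (n : ℝ) < s.re := lt_of_le_of_lt (le_max_right _ _) hs
    have hs0 : 0 < s.re := lt_of_le_of_lt (Nat.cast_nonneg n) hs2
    rw [← (hh.mellin_eq (Or.inr hs2) (Or.inr hs0)).2, hm s hs1]
    field_simp [Complex.Gamma_ne_zero_of_re_pos hs0]
  have hnhds : Pᶜ ∈ 𝓝 (-1 : ℂ) := hPf.isClosed.isOpen_compl.mem_nhds hP1
  have hTd : DifferentiableAt ℂ T (-1) := (hT'.differentiableAt hnhds)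
  have hVc : ContinuousAt V (-1) := (hV'.differentiableAt hnhds).continuousAt
  have hFc : ContinuousAt (regMellin h n c d) (-1) := (hF.differentiableAt hnhds).continuousAt
  have hG : ContinuousAt (fun s : ℂ => Complex.Gamma (s + 2)) (-1) := by
    have h1 : ((-1 : ℂ) + 2).re = 1 := by norm_num
    have h2 : ContinuousAt Complex.Gamma ((-1 : ℂ) + 2) := by
      refine (Complex.differentiableAt_Gamma _ fun m hm => ?_).continuousAt
      have := congrArg Complex.re hm
      rw [h1] at this
      simp only [Complex.neg_re, Complex.natCast_re] at this
      have h0 : (0 : ℝ) ≤ m := Nat.cast_nonneg m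
      linarith
    exact ContinuousAt.comp (f := fun s : ℂ => s + 2) h2 (by fun_prop)
  -- `Γ(s + 2)` is regular at `-1`, and one zero of `T V` is used up by the factor `s + 1`
  have hev : (fun s : ℂ => s * regMellin h n c d s) =ᶠ[𝓝[≠] (-1)] fun s =>
      Complex.Gamma (s + 2) * ((2 * Real.pi : ℂ) ^ (-s) * (dslope T (-1) s * V s)) := by
    have h0 : ∀ᶠ s : ℂ in 𝓝[≠] (-1), s ≠ 0 :=
      nhdsWithin_le_nhds (isOpen_ne.mem_nhds (by norm_num))
    have hball : ∀ᶠ s : ℂ in 𝓝[≠] (-1), -2 < s.re :=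
      nhdsWithin_le_nhds ((isOpen_lt continuous_const Complex.continuous_re).mem_nhds (by norm_num))
    filter_upwards [self_mem_nhdsWithin, nhdsWithin_le_nhds hnhds, h0, hball] with s hs1 hsP hs0 hs2
    have hs1' : s + 1 ≠ 0 := fun h => hs1 (eq_neg_of_add_eq_zero_left h)
    have hTs : T s = (s + 1) * dslope T (-1) s := by
      rw [dslope_of_ne _ hs1, slope_def_field, hT1]
      rw [sub_zero, sub_neg_eq_add, mul_div_cancel₀ _ hs1']
    have hΓ : Complex.Gamma (s + 2) = (s + 1) * (s * Complex.Gamma s) := by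
      rw [show s + 2 = s + 1 + 1 by ring, Complex.Gamma_add_one _ hs1', Complex.Gamma_add_one _ hs0]
    have hΓ2 : Complex.Gamma (s + 2) ≠ 0 :=
      Complex.Gamma_ne_zero_of_re_pos (by
        rw [Complex.add_re]
        norm_num
        linarith)
    have hΓ0 : Complex.Gamma s ≠ 0 := fun h => by
      rw [h] at hΓ
      simp at hΓ
      exact hΓ2 hΓ
    have := hid hsP
    simp only at this
    rw [hTs, inv_mul_eq_iff_eq_mul₀ hΓ0] at this
    rw [this, hΓ]
    ring
  have hlim1 : Tendsto (fun s : ℂ => s * regMellin h n c d s) (𝓝[≠] (-1))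
      (𝓝 (-1 * regMellin h n c d (-1))) :=
    ((continuousAt_id.mul hFc).tendsto).mono_left nhdsWithin_le_nhds
  have hlim2 : Tendsto (fun s : ℂ => Complex.Gamma (s + 2) *
      ((2 * Real.pi : ℂ) ^ (-s) * (dslope T (-1) s * V s))) (𝓝[≠] (-1))
      (𝓝 (Complex.Gamma (-1 + 2) *
        ((2 * Real.pi : ℂ) ^ (-(-1 : ℂ)) * (dslope T (-1) (-1) * V (-1))))) :=
    ((hG.mul ((hpow _).continuousAt.mul
      ((continuousAt_dslope_same.mpr hTd).mul hVc))).tendsto).mono_left nhdsWithin_le_nhds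
  have := tendsto_nhds_unique (hlim1.congr' hev) hlim2
  rw [hV1] at this
  simpa using this

end

end

/-! ### Regularised integrals as regularised Mellin transforms -/

section

theorem upperMellin_one (g : ℝ → ℂ) : upperMellin g 1 = ∫ t in Ioi (1 : ℝ), g t := by
  simp [upperMellin]

theorem ExpDecay.integrableOn_Ioi {g : ℝ → ℂ} (hd : ExpDecay g) (hc : ContinuousOn g (Ioi 0)) :
    IntegrableOn g (Ioi 1) := by
  simpa using hd.integrableOn_upper hc 1

theorem continuous_eval_I_mul (p : Polynomial ℂ) :
    Continuous fun y : ℝ => p.eval (Complex.I * y) :=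
  p.continuous.comp (by fun_prop)

theorem regIntegralToInfty_one {f : ℝ → ℂ} {p : Polynomial ℂ} (hc : ContinuousOn f (Ioi 0))
    (hp : IsPolyPart f p) :
    regIntegralToInfty f 1 = Complex.I * ((∫ t in Ioi (1 : ℝ), (f t - p.eval (Complex.I * t))) -
      ∫ t in (0 : ℝ)..1, p.eval (Complex.I * t)) := by
  have hpc := continuous_eval_I_mul p
  have hcp : ContinuousOn (fun t : ℝ => f t - p.eval (Complex.I * t)) (Ioi 0) :=
    hc.sub hpc.continuousOn
  have hint := ExpDecay.integrableOn_Ioi hp hcp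
  have hlim := intervalIntegral_tendsto_integral_Ioi 1 hint tendsto_id
  rw [regIntegralToInfty, polyPart_eq hp]
  refine Tendsto.limUnder_eq (Tendsto.congr' ?_
    ((hlim.sub_const (∫ t in (0 : ℝ)..1, p.eval (Complex.I * t))).const_mul Complex.I))
  filter_upwards [eventually_ge_atTop 1] with P hP
  have hsub : uIcc 1 P ⊆ Ioi 0 := fun t ht => by
    rw [uIcc_of_le hP] at ht
    exact zero_lt_one.trans_le ht.1
  have hif : IntervalIntegrable f volume 1 P := (hc.mono hsub).intervalIntegrable
  have hip : ∀ a b, IntervalIntegrable (fun t : ℝ => p.eval (Complex.I * t)) volume a b :=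
    fun a b => hpc.intervalIntegrable a b
  rw [id, intervalIntegral.integral_sub hif (hip 1 P), intervalIntegral.integral_mul_const,
    intervalIntegral.integral_mul_const, intervalIntegral.integral_symm 0 P,
    ← intervalIntegral.integral_add_adjacent_intervals (hip 0 1) (hip 1 P)]
  ring

/-- The regularised integral in terms of absolutely convergent integrals over `(1, ∞)`. -/
theorem regIntegralDy_eq {f : ℝ → ℂ} {p q : Polynomial ℂ} (hc : ContinuousOn f (Ioi 0))
    (hc' : ContinuousOn (pullbackForm f) (Ioi 0)) (hp : IsPolyPart f p)
    (hq : IsPolyPart (pullbackForm f) q) :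
    regIntegralDy f = (∫ t in Ioi (1 : ℝ), (f t - p.eval (Complex.I * t))) -
      (∫ t in (0 : ℝ)..1, p.eval (Complex.I * t)) -
      ((∫ t in Ioi (1 : ℝ), (pullbackForm f t - q.eval (Complex.I * t))) -
      ∫ t in (0 : ℝ)..1, q.eval (Complex.I * t)) := by
  rw [regIntegralDy, regIntegral, regIntegralFromZero, div_one, regIntegralToInfty_one hc hp,
    regIntegralToInfty_one hc' hq]
  have := Complex.I_ne_zero
  field_simp
  ring

theorem continuousOn_pullbackForm {f : ℝ → ℂ} (hc : ContinuousOn f (Ioi 0)) :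
    ContinuousOn (pullbackForm f) (Ioi 0) := by
  refine ContinuousOn.div (hc.comp (continuousOn_const.div continuousOn_id fun y hy => ?_)
    fun y hy => ?_) (by fun_prop) fun y hy => ?_
  · exact (ne_of_gt hy : y ≠ 0)
  · exact one_div_pos.mpr (mem_Ioi.mp hy)
  · exact pow_ne_zero 2 (mul_ne_zero Complex.I_ne_zero (by exact_mod_cast (ne_of_gt hy : y ≠ 0)))

theorem ofReal_im_integral {g : ℝ → ℂ} {s : Set ℝ} (hg : IntegrableOn g s) :
    (((∫ t in s, g t).im : ℝ) : ℂ) = ∫ t in s, ((g t).im : ℂ) := by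
  rw [integral_complex_ofReal]
  have := integral_im hg
  exact congrArg Complex.ofReal this.symm

theorem im_intervalIntegral {g : ℝ → ℂ} (hg : Continuous g) :
    (∫ t in (0 : ℝ)..1, g t).im = ∫ t in (0 : ℝ)..1, (g t).im := by
  rw [intervalIntegral.integral_of_le zero_le_one, intervalIntegral.integral_of_le zero_le_one]
  exact (integral_im ((hg.intervalIntegrable 0 1).1)).symm

theorem pullbackForm_im (f : ℝ → ℂ) (y : ℝ) :
    (pullbackForm f y).im = -((1 / y) ^ 2 * (f (1 / y)).im) := by
  have : pullbackForm f y = ((-((1 / y) ^ 2) : ℝ) : ℂ) * f (1 / y) := by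
    rw [pullbackForm, mul_pow, Complex.I_sq]
    push_cast
    simp only [neg_one_mul, div_eq_mul_inv]
    ring
  rw [this, Complex.im_ofReal_mul, neg_mul]

section

variable {f : ℝ → ℂ} {p q : Polynomial ℂ} {n : ℕ} {c d : ℝ}

theorem sq_mul_im_inv (hqim : ∀ y : ℝ, (q.eval (Complex.I * y)).im = c * y ^ n + d) (y : ℝ) :
    (((1 / y : ℝ) : ℂ)) ^ 2 * ((f (1 / y)).im : ℂ) - ((-c : ℝ) : ℂ) * (y : ℂ) ^ n - ((-d : ℝ) : ℂ) =
      -(((pullbackForm f y - q.eval (Complex.I * y)).im : ℝ) : ℂ) := by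
  rw [Complex.sub_im, hqim, pullbackForm_im]
  push_cast
  ring

/-- The imaginary part of the regularised integral of a form whose polynomial part at `∞` is real
on the half-axis. -/
theorem im_regIntegralDy (hc : ContinuousOn f (Ioi 0)) (hp : IsPolyPart f p)
    (hq : IsPolyPart (pullbackForm f) q) (hpim : ∀ y : ℝ, (p.eval (Complex.I * y)).im = 0)
    (hqim : ∀ y : ℝ, (q.eval (Complex.I * y)).im = c * y ^ n + d) :
    (((regIntegralDy f).im : ℝ) : ℂ) =
      regMellin (fun y : ℝ => (y : ℂ) ^ 2 * ((f y).im : ℂ)) n ((-c : ℝ) : ℂ) ((-d : ℝ) : ℂ)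
        (-1) := by
  have hc' := continuousOn_pullbackForm hc
  have hpc := continuous_eval_I_mul p
  have hqc := continuous_eval_I_mul q
  have hi1 := ExpDecay.integrableOn_Ioi hp (hc.sub hpc.continuousOn)
  have hi2 := ExpDecay.integrableOn_Ioi hq (hc'.sub hqc.continuousOn)
  have hP : (∫ t in (0 : ℝ)..1, p.eval (Complex.I * t)).im = 0 := by
    rw [im_intervalIntegral hpc]
    simp [hpim]
  have hQ : (∫ t in (0 : ℝ)..1, q.eval (Complex.I * t)).im = c / (n + 1) + d := by
    rw [im_intervalIntegral hqc]
    simp only [hqim]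
    rw [intervalIntegral.integral_add (Continuous.intervalIntegrable (by fun_prop) _ _)
      (Continuous.intervalIntegrable (by fun_prop) _ _),
      intervalIntegral.integral_const_mul, integral_pow]
    simp [div_eq_mul_inv]
  have h1 : upperMellin (fun y : ℝ => (y : ℂ) ^ 2 * ((f y).im : ℂ)) (-1) =
      (((∫ t in Ioi (1 : ℝ), (f t - p.eval (Complex.I * t))).im : ℝ) : ℂ) := by
    rw [upperMellin_cpow_mul (g := fun y => ((f y).im : ℂ)) (a := 2)
      (fun y _ => by rw [Complex.cpow_ofNat]), show (-1 : ℂ) + 2 = 1 by norm_num, upperMellin_one,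
      ofReal_im_integral hi1]
    simp only [Complex.sub_im, hpim, sub_zero]
  have h2 : upperMellin (fun y : ℝ => (((1 / y : ℝ) : ℂ)) ^ 2 * ((f (1 / y)).im : ℂ) -
      ((-c : ℝ) : ℂ) * (y : ℂ) ^ n - ((-d : ℝ) : ℂ)) (-(-1)) =
      -(((∫ t in Ioi (1 : ℝ), (pullbackForm f t - q.eval (Complex.I * t))).im : ℝ) : ℂ) := by
    rw [neg_neg, upperMellin_one, ofReal_im_integral hi2, ← integral_neg]
    simp only [sq_mul_im_inv hqim]
  rw [regMellin, h1, h2, regIntegralDy_eq hc hc' hp hq]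
  simp only [Complex.sub_im, hP, hQ]
  have hn : (n : ℂ) + 1 ≠ 0 := by exact_mod_cast n.succ_ne_zero
  have hn' : (-1 : ℂ) - n ≠ 0 := by
    rw [← neg_add', neg_ne_zero, add_comm]
    exact hn
  push_cast
  rw [show (-1 : ℂ) - n = -(n + 1) by ring]
  field_simp
  ring

end

/-! ### Functions of exponential decay at `∞` and of moderate growth at `0` -/

/-- Continuous functions on the half-axis of exponential decay at `∞` and of at most polynomial
growth in `1/y` as `y → 0`. -/
structure ModerateDecay (P : ℝ → ℂ) : Prop where
  continuousOn : ContinuousOn P (Ioi 0)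
  expDecay : ExpDecay P
  growth : ∃ N : ℕ, (fun y => P (1 / y)) =O[atTop] fun y : ℝ => y ^ (N : ℝ)

theorem moderateDecay_doubleSeries {x z : ℝ} (hx : 0 < x) (hz : 0 < z) {N M : ℕ} {α β : ℕ → ℂ}
    (hα : PolyBounded x N α) (hβ : PolyBounded z M β) :
    ModerateDecay fun y : ℝ => doubleSeries x z α β y := by
  refine ⟨(contDiffOn_doubleSeries hx hz hα hβ).continuousOn, expDecay_doubleSeries hx hz hα hβ, ?_⟩
  obtain ⟨C, δ, K, hC, hδ, h⟩ := exists_norm_doubleSeries_le hx hz hα hβ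
  refine ⟨K, Asymptotics.IsBigO.of_bound C ?_⟩
  filter_upwards [eventually_gt_atTop 0] with y hy
  refine (h _ (one_div_pos.mpr hy)).trans ?_
  rw [Real.rpow_natCast, Real.norm_of_nonneg (by positivity), one_div, inv_pow, inv_inv]
  have : Real.exp (-δ * y⁻¹) ≤ 1 := Real.exp_le_one_iff.mpr (by
    have : 0 < δ * y⁻¹ := by positivity
    linarith)
  have h2 : 0 ≤ y ^ K := by positivity
  calc C * (y ^ K * Real.exp (-δ * y⁻¹)) ≤ C * (y ^ K * 1) := by gcongr
    _ = _ := by rw [mul_one]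

namespace ModerateDecay

variable {P Q : ℝ → ℂ}

theorem add (hP : ModerateDecay P) (hQ : ModerateDecay Q) :
    ModerateDecay fun y => P y + Q y := by
  refine ⟨hP.continuousOn.add hQ.continuousOn, hP.expDecay.add hQ.expDecay, ?_⟩
  obtain ⟨N, hN⟩ := hP.growth
  obtain ⟨M, hM⟩ := hQ.growth
  have key : ∀ K : ℕ, K ≤ max N M →
      (fun y : ℝ => y ^ (K : ℝ)) =O[atTop] fun y : ℝ => y ^ ((max N M : ℕ) : ℝ) := fun K hK => by
    refine Asymptotics.IsBigO.of_bound 1 ?_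
    filter_upwards [eventually_ge_atTop 1] with y hy
    rw [one_mul, Real.rpow_natCast, Real.rpow_natCast, Real.norm_of_nonneg (by positivity),
      Real.norm_of_nonneg (by positivity)]
    exact pow_le_pow_right₀ hy hK
  exact ⟨max N M, (hN.trans (key N (le_max_left _ _))).add (hM.trans (key M (le_max_right _ _)))⟩

theorem const_mul (hP : ModerateDecay P) (a : ℂ) : ModerateDecay fun y => a * P y := by
  obtain ⟨N, hN⟩ := hP.growth
  exact ⟨continuousOn_const.mul hP.continuousOn, hP.expDecay.const_mul a, N, hN.const_mul_left a⟩

theorem ofReal_im (hP : ModerateDecay P) : ModerateDecay fun y => ((P y).im : ℂ) := by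
  obtain ⟨N, hN⟩ := hP.growth
  refine ⟨Complex.continuous_ofReal.comp_continuousOn
    (Complex.continuous_im.comp_continuousOn hP.continuousOn), hP.expDecay.ofReal_im, N,
    (Asymptotics.IsBigO.of_bound 1 (Eventually.of_forall fun y => ?_)).trans hN⟩
  simpa using Complex.abs_im_le_norm (P (1 / y))

theorem continuousOn_inv (hP : ModerateDecay P) :
    ContinuousOn (fun y : ℝ => P (1 / y)) (Ioi 0) := by
  refine hP.continuousOn.comp (continuousOn_const.div continuousOn_id fun y hy => ?_) fun y hy => ?_
  · exact (ne_of_gt hy : y ≠ 0)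
  · exact one_div_pos.mpr (mem_Ioi.mp hy)

/-- The product `P(1/y) Q(y)` decays exponentially at both ends. -/
theorem hasCuspExpansion_inv_mul (hP : ModerateDecay P) (hQ : ModerateDecay Q) (n : ℕ) :
    HasCuspExpansion (fun y => P (1 / y) * Q y) n 0 0 := by
  obtain ⟨N, hN⟩ := hP.growth
  obtain ⟨M, hM⟩ := hQ.growth
  refine ⟨hP.continuousOn_inv.mul hQ.continuousOn, hQ.expDecay.mul_of_isBigO hN, ?_⟩
  refine (hP.expDecay.mul_of_isBigO hM).congr fun y _ => ?_
  rw [one_div_one_div]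
  ring

end ModerateDecay

end

/-! ### The exchange of frequencies of Rogers and Zudilin -/

theorem doubleTerm_norm_coeff (x z : ℝ) (α β : ℕ → ℂ) (y : ℝ) (p : ℕ × ℕ) :
    doubleTerm x z (fun m => (‖α m‖ : ℂ)) (fun n => (‖β n‖ : ℂ)) y p =
      (‖doubleTerm x z α β y p‖ : ℂ) := by
  rw [norm_doubleTerm, doubleTerm, Complex.ofReal_re]
  push_cast
  ring

theorem PolyBounded.norm {x : ℝ} {N : ℕ} {α : ℕ → ℂ} (h : PolyBounded x N α) :
    PolyBounded x N fun m => (‖α m‖ : ℂ) := fun m => by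
  rw [Complex.norm_real, norm_norm]
  exact h m

theorem tsum_enorm_doubleTerm {x z : ℝ} (hx : 0 < x) (hz : 0 < z) {N M : ℕ} {α β : ℕ → ℂ}
    (hα : PolyBounded x N α) (hβ : PolyBounded z M β) {y : ℝ} (hy : 0 < y) :
    ∑' p, ‖doubleTerm x z α β y p‖ₑ =
      ‖doubleSeries x z (fun m => (‖α m‖ : ℂ)) (fun n => (‖β n‖ : ℂ)) y‖ₑ := by
  have hs := summable_norm_doubleTerm hx hz hα hβ (w := y) (by simpa using hy)
  rw [doubleSeries]
  simp only [doubleTerm_norm_coeff, ← ofReal_norm]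
  rw [← ENNReal.ofReal_tsum_of_nonneg (fun _ => norm_nonneg _) hs, ← Complex.ofReal_tsum,
    Complex.norm_real, Real.norm_of_nonneg (tsum_nonneg fun _ => norm_nonneg _)]

theorem continuousOn_doubleTerm_inv (x z : ℝ) (α β : ℕ → ℂ) (p : ℕ × ℕ) :
    ContinuousOn (fun y : ℝ => doubleTerm x z α β ((1 / y : ℝ) : ℂ) p) (Ioi 0) := by
  have h : ContinuousOn (fun y : ℝ => ((1 / y : ℝ) : ℂ)) (Ioi 0) :=
    Complex.continuous_ofReal.comp_continuousOn
      (continuousOn_const.div continuousOn_id fun y hy => (ne_of_gt hy : y ≠ 0))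
  exact (differentiable_doubleTerm x z α β p).continuous.comp_continuousOn h

theorem continuousOn_cpow_ofReal (s : ℂ) : ContinuousOn (fun y : ℝ => (y : ℂ) ^ s) (Ioi 0) :=
  fun y hy => (Complex.continuousAt_ofReal_cpow_const y s
    (Or.inr (ne_of_gt hy))).continuousWithinAt

/-- Termwise integration of a product of two double series, at `1/y` and at `y`. -/
theorem mellin_doubleSeries_mul {x z x' z' : ℝ} (hx : 0 < x) (hz : 0 < z) (hx' : 0 < x')
    (hz' : 0 < z') {N M N' M' : ℕ} {α β α' β' : ℕ → ℂ} (hα : PolyBounded x N α)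
    (hβ : PolyBounded z M β) (hα' : PolyBounded x' N' α') (hβ' : PolyBounded z' M' β') (s : ℂ) :
    mellin (fun y : ℝ => doubleSeries x z α β ((1 / y : ℝ) : ℂ) * doubleSeries x' z' α' β' y) s =
      ∑' r : (ℕ × ℕ) × (ℕ × ℕ), mellin (fun y : ℝ =>
        doubleTerm x z α β ((1 / y : ℝ) : ℂ) r.1 * doubleTerm x' z' α' β' y r.2) s := by
  set F : (ℕ × ℕ) × (ℕ × ℕ) → ℝ → ℂ := fun r y => (y : ℂ) ^ (s - 1) •
    (doubleTerm x z α β ((1 / y : ℝ) : ℂ) r.1 * doubleTerm x' z' α' β' y r.2) with hF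
  have hsum : ∀ y ∈ Ioi (0 : ℝ), (y : ℂ) ^ (s - 1) •
      (doubleSeries x z α β ((1 / y : ℝ) : ℂ) * doubleSeries x' z' α' β' y) = ∑' r, F r y :=
    fun y hy => by
      have hy' : (0 : ℝ) < y := hy
      rw [hF, doubleSeries, doubleSeries, tsum_const_smul'', tsum_mul_tsum_of_summable_norm
        (summable_norm_doubleTerm hx hz hα hβ (by simpa using hy'))
        (summable_norm_doubleTerm hx' hz' hα' hβ' (by simpa using hy'))]
  have hmeas : ∀ r, AEStronglyMeasurable (F r) (volume.restrict (Ioi 0)) := fun r => by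
    refine ContinuousOn.aestronglyMeasurable ?_ measurableSet_Ioi
    refine (continuousOn_cpow_ofReal _).smul ((continuousOn_doubleTerm_inv x z α β r.1).mul ?_)
    exact ((differentiable_doubleTerm x' z' α' β' r.2).continuous.comp
      Complex.continuous_ofReal).continuousOn
  set H : ℝ → ℂ := fun y =>
    doubleSeries x z (fun m => (‖α m‖ : ℂ)) (fun n => (‖β n‖ : ℂ)) ((1 / y : ℝ) : ℂ) *
    doubleSeries x' z' (fun m => (‖α' m‖ : ℂ)) (fun n => (‖β' n‖ : ℂ)) y with hH
  have hHi : MellinConvergent H s :=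
    (((moderateDecay_doubleSeries hx hz hα.norm hβ.norm).hasCuspExpansion_inv_mul
      (moderateDecay_doubleSeries hx' hz' hα'.norm hβ'.norm) 0).mellin_eq (Or.inl rfl)
        (Or.inl rfl)).1
  have hfin : ∑' r, ∫⁻ y in Ioi (0 : ℝ), ‖F r y‖ₑ ≠ ⊤ := by
    rw [← lintegral_tsum fun r => (hmeas r).enorm]
    refine ne_of_lt (lt_of_le_of_lt (le_of_eq ?_) hHi.2)
    refine setLIntegral_congr_fun measurableSet_Ioi fun y hy => ?_
    have hy' : (0 : ℝ) < y := hy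
    simp only [hF, hH, smul_eq_mul, enorm_mul]
    rw [← tsum_enorm_doubleTerm hx hz hα hβ (one_div_pos.mpr hy'),
      ← tsum_enorm_doubleTerm hx' hz' hα' hβ' hy', ENNReal.tsum_mul_left, ENNReal.tsum_prod']
    simp only [ENNReal.tsum_mul_left, ENNReal.tsum_mul_right]
  rw [mellin, setIntegral_congr_fun measurableSet_Ioi hsum, integral_tsum hmeas hfin]
  rfl

/-- The substitution `y ↦ ((n + a) / (r + 1)) y` in a single term exchanges the frequencies
`n + a` and `r + 1`. -/
theorem mellin_doubleTerm_exchange {a : ℝ} (ha : 0 < a) (b c d : ℝ) (k m n r l : ℕ) :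
    mellin (fun y : ℝ => doubleTerm 1 a (fun m => e ((m + 1) * c))
        (fun n => ((n : ℂ) + a) ^ (2 - 1)) ((1 / y : ℝ) : ℂ) (m, n) *
      doubleTerm 1 b (fun m => e ((m + 1) * d) / (m + 1)) (fun n => ((n : ℂ) + b) ^ (k - 2)) y
        (r, l)) (-1) =
    mellin (fun y : ℝ => doubleTerm 1 1 (fun m => e ((m + 1) * c))
        (fun n => ((n : ℂ) + 1) ^ (1 - 1) * e ((n + 1) * d)) ((1 / y : ℝ) : ℂ) (m, r) *
      doubleTerm b a (fun m => ((m : ℂ) + b) ^ (k - 1 - 1)) (fun _ => 1) y (l, n)) (-1) := by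
  have hr : (0 : ℝ) < (r : ℝ) + 1 := by positivity
  have hn : (0 : ℝ) < (n : ℝ) + a := by positivity
  have hr0 : ((r : ℂ) + 1) ≠ 0 := by exact_mod_cast hr.ne'
  have hn0 : ((n : ℂ) + a) ≠ 0 := by exact_mod_cast hn.ne'
  set q : ℝ := ((n : ℝ) + a) / (r + 1) with hq
  have hq0 : 0 < q := div_pos hn hr
  set f : ℝ → ℂ := fun y : ℝ => doubleTerm 1 a (fun m => e ((m + 1) * c))
        (fun n => ((n : ℂ) + a) ^ (2 - 1)) ((1 / y : ℝ) : ℂ) (m, n) *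
      doubleTerm 1 b (fun m => e ((m + 1) * d) / (m + 1)) (fun n => ((n : ℂ) + b) ^ (k - 2)) y
        (r, l) with hf
  have h := mellin_comp_mul_left f (-1) hq0
  rw [neg_neg, Complex.cpow_one, smul_eq_mul] at h
  have hqC : (q : ℂ) ≠ 0 := by exact_mod_cast hq0.ne'
  have hcoef : (q : ℂ) = (n + a) / (r + 1) := by
    rw [hq]
    push_cast
    rfl
  rw [eq_comm, ← eq_inv_mul_iff_mul_eq₀ hqC, ← smul_eq_mul, ← mellin_const_smul] at h
  rw [h]
  refine setIntegral_congr_fun measurableSet_Ioi fun y hy => ?_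
  have hy0 : (y : ℂ) ≠ 0 := by exact_mod_cast (ne_of_gt hy : y ≠ 0)
  have he1 : Complex.exp (-((2 * Real.pi * (((m : ℝ) + 1) * (n + a)) : ℝ) : ℂ) *
      ((1 / (q * y) : ℝ) : ℂ)) =
      Complex.exp (-((2 * Real.pi * (((m : ℝ) + 1) * (r + 1)) : ℝ) : ℂ) * ((1 / y : ℝ) : ℂ)) := by
    congr 1
    push_cast
    rw [hcoef]
    field_simp
  have he2 : Complex.exp (-((2 * Real.pi * (((r : ℝ) + 1) * (l + b)) : ℝ) : ℂ) *
      ((q * y : ℝ) : ℂ)) =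
      Complex.exp (-((2 * Real.pi * (((l : ℝ) + b) * (n + a)) : ℝ) : ℂ) * y) := by
    congr 1
    push_cast
    rw [hcoef]
    field_simp
  simp only [hf, doubleTerm, smul_eq_mul, he1, he2]
  rw [Nat.sub_sub, hcoef]
  simp only [Nat.reduceAdd, Nat.reduceSub, pow_one, pow_zero, one_mul, mul_one]
  congr 1
  field_simp

/-- The exchange of frequencies for the product of an Eisenstein series and of an Eichler
integral. -/
theorem mellin_eisSeries_mul_eichSeries {a b : ℝ} (ha : 0 < a) (hb : 0 < b) (c d : ℝ) (k : ℕ) :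
    mellin (fun y : ℝ => eisSeries 2 a c ((1 / y : ℝ) : ℂ) * eichSeries k b d y) (-1) =
      mellin (fun y : ℝ => jSeries 1 c d ((1 / y : ℝ) : ℂ) * gSeries (k - 1) b a y) (-1) := by
  have h1 := mellin_doubleSeries_mul zero_lt_one ha zero_lt_one hb (polyBounded_e 1 c)
    (polyBounded_pow ha (2 - 1)) (polyBounded_e_div d) (polyBounded_pow hb (k - 2)) (-1)
  have h2 := mellin_doubleSeries_mul zero_lt_one zero_lt_one hb ha (polyBounded_e 1 c)
    (polyBounded_pow_mul_e (1 - 1) d) (polyBounded_pow hb (k - 1 - 1)) (polyBounded_one a) (-1)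
  refine h1.trans (Eq.trans ?_ h2.symm)
  let σ : (ℕ × ℕ) × (ℕ × ℕ) ≃ (ℕ × ℕ) × (ℕ × ℕ) :=
    { toFun := fun p => ((p.1.1, p.2.1), (p.2.2, p.1.2))
      invFun := fun p => ((p.1.1, p.2.2), (p.1.2, p.2.1))
      left_inv := fun _ => rfl
      right_inv := fun _ => rfl }
  rw [← σ.symm.tsum_eq]
  exact tsum_congr fun p => mellin_doubleTerm_exchange ha b c d k p.1.1 p.2.2 p.1.2 p.2.1

/-! ### Mellin transforms of double series -/

/-- The Dirichlet series `∑ α_m (m + x)⁻ˢ` over `m ≥ 0`. -/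
def dirichletSum (x : ℝ) (α : ℕ → ℂ) (s : ℂ) : ℂ := ∑' m : ℕ, α m / ((m + x : ℝ) : ℂ) ^ s

theorem norm_div_cpow {t : ℝ} (ht : 0 < t) (w s : ℂ) : ‖w / (t : ℂ) ^ s‖ = ‖w‖ / t ^ s.re := by
  rw [norm_div, Complex.norm_cpow_eq_rpow_re_of_pos ht]

theorem summable_norm_dirichlet {x : ℝ} (hx : 0 < x) {N : ℕ} {α : ℕ → ℂ}
    (hα : PolyBounded x N α) {s : ℂ} (hs : N + 1 < s.re) :
    Summable fun m : ℕ => ‖α m / ((m + x : ℝ) : ℂ) ^ s‖ := by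
  refine Summable.of_nonneg_of_le (fun _ => norm_nonneg _) (fun m => ?_)
    ((Real.summable_one_div_nat_add_rpow x (s.re - N)).mpr (by linarith))
  have hm : (0 : ℝ) < m + x := by positivity
  rw [norm_div_cpow hm, abs_of_pos hm, Real.rpow_sub hm, Real.rpow_natCast, one_div_div]
  gcongr
  exact hα m

/-- The Mellin transform of a double series is `(2π)⁻ˢ Γ(s)` times the product of the two Dirichlet
series. -/
theorem mellin_doubleSeries {x z : ℝ} (hx : 0 < x) (hz : 0 < z) {N M : ℕ} {α β : ℕ → ℂ}
    (hα : PolyBounded x N α) (hβ : PolyBounded z M β) {s : ℂ} (hN : N + 1 < s.re)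
    (hM : M + 1 < s.re) :
    mellin (fun y : ℝ => doubleSeries x z α β y) s =
      (2 * Real.pi : ℂ) ^ (-s) * Complex.Gamma s * (dirichletSum x α s * dirichletSum z β s) := by
  have h1 := summable_norm_dirichlet hx hα hN
  have h2 := summable_norm_dirichlet hz hβ hM
  have hpos1 : ∀ m : ℕ, (0 : ℝ) < m + x := fun m => by positivity
  have hpos2 : ∀ n : ℕ, (0 : ℝ) < n + z := fun n => by positivity
  have hpi : (0 : ℝ) < 2 * Real.pi := by positivity
  have hs0 : 0 < s.re := by
    have : (0 : ℝ) ≤ N := Nat.cast_nonneg N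
    linarith
  have hsum : ∀ t ∈ Ioi (0 : ℝ), HasSum (fun p : ℕ × ℕ => α p.1 * β p.2 *
      ((Real.exp (-(2 * Real.pi * ((p.1 + x) * (p.2 + z))) * t) : ℝ) : ℂ))
      (doubleSeries x z α β t) := fun t ht => by
    refine (hasSum_doubleSeries hx hz hα hβ (by simpa using ht)).congr_fun fun p => ?_
    rw [doubleTerm]
    push_cast
    rfl
  have hsm : Summable fun p : ℕ × ℕ =>
      ‖α p.1 * β p.2‖ / (2 * Real.pi * ((p.1 + x) * (p.2 + z))) ^ s.re := by
    refine ((h1.mul_of_nonneg h2 (fun _ => norm_nonneg _) (fun _ => norm_nonneg _)).mul_left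
      (((2 * Real.pi) ^ s.re)⁻¹)).congr fun p => ?_
    rw [norm_div_cpow (hpos1 _), norm_div_cpow (hpos2 _), norm_mul,
      Real.mul_rpow hpi.le (mul_pos (hpos1 _) (hpos2 _)).le,
      Real.mul_rpow (hpos1 _).le (hpos2 _).le]
    field_simp
  have h := hasSum_mellin (a := fun p : ℕ × ℕ => α p.1 * β p.2)
    (p := fun p : ℕ × ℕ => 2 * Real.pi * ((p.1 + x) * (p.2 + z)))
    (F := fun t : ℝ => doubleSeries x z α β t) (s := s)
    (fun p => Or.inr (mul_pos hpi (mul_pos (hpos1 _) (hpos2 _)))) hs0 hsum hsm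
  rw [← h.tsum_eq, dirichletSum, dirichletSum, tsum_mul_tsum_of_summable_norm h1 h2,
    ← tsum_mul_left]
  refine tsum_congr fun p => ?_
  rw [Complex.ofReal_mul (2 * Real.pi),
    Complex.mul_cpow_ofReal_nonneg hpi.le (mul_pos (hpos1 _) (hpos2 _)).le,
    Complex.ofReal_mul ((p.1 : ℝ) + x), Complex.mul_cpow_ofReal_nonneg (hpos1 _).le (hpos2 _).le,
    Complex.cpow_neg]
  push_cast
  field_simp

theorem dirichletSum_pow {a : ℝ} (ha : a ∈ Ioo (0 : ℝ) 1) (j : ℕ) {s : ℂ} (hs : j + 1 < s.re) :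
    dirichletSum a (fun m => ((m : ℂ) + a) ^ j) s = HurwitzZeta.hurwitzZeta a (s - j) := by
  have h := HurwitzZeta.hasSum_hurwitzZeta_of_one_lt_re (Ioo_subset_Icc_self ha) (s := s - j) (by
    rw [Complex.sub_re, Complex.natCast_re]
    linarith)
  rw [← h.tsum_eq, dirichletSum]
  refine tsum_congr fun m => ?_
  have hm : (m : ℂ) + a ≠ 0 := by
    have : (0 : ℝ) < m + a := by have := ha.1; positivity
    exact_mod_cast this.ne'
  push_cast
  rw [Complex.cpow_sub _ _ hm, Complex.cpow_natCast, one_div_div]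

theorem dirichletSum_one {a : ℝ} (ha : a ∈ Ioo (0 : ℝ) 1) {s : ℂ} (hs : 1 < s.re) :
    dirichletSum a (fun _ => 1) s = HurwitzZeta.hurwitzZeta a s := by
  have := dirichletSum_pow ha 0 (s := s) (by simpa using hs)
  simpa using this

theorem dirichletSum_e (b : ℝ) {s : ℂ} (hs : 1 < s.re) :
    dirichletSum 1 (fun m => e ((m + 1) * b)) s = HurwitzZeta.expZeta b s := by
  have h := HurwitzZeta.hasSum_expZeta_of_one_lt_re b hs
  have hs0 : s ≠ 0 := fun h0 => by
    rw [h0, Complex.zero_re] at hs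
    linarith
  rw [← h.tsum_eq, h.summable.tsum_eq_zero_add, dirichletSum]
  simp only [Nat.cast_zero, Complex.zero_cpow hs0, div_zero, zero_add]
  refine tsum_congr fun m => ?_
  rw [e]
  push_cast
  congr 2
  ring

theorem dirichletSum_e_div (b : ℝ) {s : ℂ} (hs : 1 < s.re) :
    dirichletSum 1 (fun m => e ((m + 1) * b) / (m + 1)) s = HurwitzZeta.expZeta b (s + 1) := by
  rw [← dirichletSum_e b (s := s + 1) (by rw [Complex.add_re, Complex.one_re]; linarith),
    dirichletSum, dirichletSum]
  refine tsum_congr fun m => ?_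
  have hm : (m : ℂ) + 1 ≠ 0 := by exact_mod_cast m.succ_ne_zero
  push_cast
  rw [Complex.cpow_add _ _ hm, Complex.cpow_one, div_div]
  congr 1
  exact mul_comm _ _

theorem mellin_eisSeries (k : ℕ) {a : ℝ} (ha : a ∈ Ioo (0 : ℝ) 1) (b : ℝ) {s : ℂ}
    (hs : (k - 1 : ℕ) + 1 < s.re) :
    mellin (fun y : ℝ => eisSeries k a b y) s = (2 * Real.pi : ℂ) ^ (-s) * Complex.Gamma s *
      (HurwitzZeta.expZeta b s * HurwitzZeta.hurwitzZeta a (s - (k - 1 : ℕ))) := by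
  have h1 : (1 : ℝ) < s.re := lt_of_le_of_lt (by simp) hs
  rw [← dirichletSum_e b h1, ← dirichletSum_pow ha _ hs]
  exact mellin_doubleSeries zero_lt_one ha.1 (polyBounded_e 1 b) (polyBounded_pow ha.1 (k - 1))
    (by simpa using h1) hs

theorem mellin_eichSeries (k : ℕ) {a : ℝ} (ha : a ∈ Ioo (0 : ℝ) 1) (b : ℝ) {s : ℂ}
    (hs : (k - 2 : ℕ) + 1 < s.re) :
    mellin (fun y : ℝ => eichSeries k a b y) s = (2 * Real.pi : ℂ) ^ (-s) * Complex.Gamma s *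
      (HurwitzZeta.expZeta b (s + 1) * HurwitzZeta.hurwitzZeta a (s - (k - 2 : ℕ))) := by
  have h1 : (1 : ℝ) < s.re := lt_of_le_of_lt (by simp) hs
  rw [← dirichletSum_e_div b h1, ← dirichletSum_pow ha _ hs]
  exact mellin_doubleSeries zero_lt_one ha.1 (polyBounded_e_div b) (polyBounded_pow ha.1 (k - 2))
    (by simpa using h1) hs

theorem mellin_gSeries (k : ℕ) {a b : ℝ} (ha : a ∈ Ioo (0 : ℝ) 1) (hb : b ∈ Ioo (0 : ℝ) 1) {s : ℂ}
    (hs : (k - 1 : ℕ) + 1 < s.re) :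
    mellin (fun y : ℝ => gSeries k a b y) s = (2 * Real.pi : ℂ) ^ (-s) * Complex.Gamma s *
      (HurwitzZeta.hurwitzZeta a (s - (k - 1 : ℕ)) * HurwitzZeta.hurwitzZeta b s) := by
  have h1 : (1 : ℝ) < s.re := lt_of_le_of_lt (by simp) hs
  rw [← dirichletSum_one hb h1, ← dirichletSum_pow ha _ hs]
  exact mellin_doubleSeries ha.1 hb.1 (polyBounded_pow ha.1 (k - 1)) (polyBounded_one b) hs
    (by simpa using h1)

/-! ### Special values of zeta functions -/

theorem hurwitzZeta_neg_eq {a : ℝ} (ha : a ∈ Ioo (0 : ℝ) 1) {k : ℕ} (hk : k ≠ 0) :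
    HurwitzZeta.hurwitzZeta a (-k) = -((bernoulliFun (k + 1) a / (k + 1) : ℝ) : ℂ) := by
  rw [HurwitzZeta.hurwitzZeta_neg_nat hk (Ioo_subset_Icc_self ha), bernoulliFun]
  have : Polynomial.eval (a : ℂ) (Polynomial.map (algebraMap ℚ ℂ) (Polynomial.bernoulli (k + 1))) =
      ((Polynomial.eval a (Polynomial.map (algebraMap ℚ ℝ) (Polynomial.bernoulli (k + 1))) : ℝ) : ℂ)
      := by
    rw [Polynomial.eval_map_algebraMap, Polynomial.eval_map_algebraMap]
    exact (Polynomial.aeval_algebraMap_apply ℂ a _).trans rfl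
  rw [this]
  push_cast
  ring

theorem e_add_I_mul (b y : ℝ) :
    e (b + y * Complex.I) = e b * (Real.exp (-(2 * Real.pi * y)) : ℝ) := by
  rw [e_add, e, e]
  congr 1
  push_cast
  congr 1
  linear_combination (2 * Real.pi * y : ℂ) * Complex.I_sq

theorem norm_e_add_I_mul (b y : ℝ) :
    ‖e (b + y * Complex.I)‖ = Real.exp (-(2 * Real.pi * y)) := by
  rw [e_add_I_mul, norm_mul, norm_e_ofReal, one_mul, Complex.norm_real,
    Real.norm_of_nonneg (Real.exp_pos _).le]

theorem norm_e_add_I_mul_lt {y : ℝ} (b : ℝ) (hy : 0 < y) : ‖e (b + y * Complex.I)‖ < 1 := by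
  rw [norm_e_add_I_mul, Real.exp_lt_one_iff]
  have : 0 < 2 * Real.pi * y := by positivity
  linarith

theorem one_sub_e_ne_zero {b y : ℝ} (hb : b ∈ Ioo (0 : ℝ) 1) (hy : 0 ≤ y) :
    1 - e (b + y * Complex.I) ≠ 0 := by
  rw [sub_ne_zero]
  rcases hy.eq_or_lt with rfl | hy
  · simpa using (e_ne_one hb.1 hb.2).symm
  · intro h
    have := norm_e_add_I_mul_lt b hy
    rw [← h, norm_one] at this
    exact lt_irrefl _ this

theorem e_natCast_mul (n : ℕ) (z : ℂ) : e (n * z) = e z ^ n := by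
  rw [e, e, ← Complex.exp_nat_mul]
  ring_nf

/-- The value at `0` of the exponential zeta function. It is read off from the Mellin transform of
`∑ n qⁿ = q/(1 - q)²` with `q = e(b + iy)`, which is the derivative of `-(2π)⁻¹ q/(1 - q)`. -/
theorem expZeta_zero {b : ℝ} (hb : b ∈ Ioo (0 : ℝ) 1) :
    HurwitzZeta.expZeta b 0 = e b / (1 - e b) := by
  set q : ℝ → ℂ := fun y => e (b + y * Complex.I) with hq
  set φ : ℝ → ℂ := fun y => q y / (1 - q y) ^ 2 with hφ
  have hqc : Continuous q := by
    simp only [hq, e]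
    fun_prop
  have hne : ∀ y : ℝ, 0 ≤ y → 1 - q y ≠ 0 := fun y hy => one_sub_e_ne_zero hb hy
  have hφc : ContinuousOn φ (Ici 0) :=
    hqc.continuousOn.div (by fun_prop) fun y hy => pow_ne_zero 2 (hne y hy)
  have hqO : q =O[atTop] fun y : ℝ => Real.exp (-(2 * Real.pi) * y) :=
    Asymptotics.IsBigO.of_bound 1 (Eventually.of_forall fun y => by
      rw [hq, norm_e_add_I_mul, one_mul, Real.norm_of_nonneg (Real.exp_pos _).le, neg_mul])
  have hexp0 : Tendsto (fun y : ℝ => Real.exp (-(2 * Real.pi) * y)) atTop (𝓝 0) :=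
    Real.tendsto_exp_atBot.comp (tendsto_id.const_mul_atTop_of_neg (by
      have := Real.pi_pos
      linarith))
  have hq0 : Tendsto q atTop (𝓝 0) := hqO.trans_tendsto hexp0
  have hinv : Tendsto (fun y => ((1 - q y) ^ 2)⁻¹) atTop (𝓝 (((1 - 0) ^ 2)⁻¹)) :=
    ((hq0.const_sub 1).pow 2).inv₀ (by norm_num)
  have hφO : φ =O[atTop] fun y : ℝ => Real.exp (-(2 * Real.pi) * y) := by
    simpa [hφ, div_eq_mul_inv] using hqO.mul (hinv.isBigO_one ℝ)
  have hφ0 : φ =O[𝓝[>] 0] fun x : ℝ => x ^ (-(0 : ℝ)) := by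
    have : Tendsto φ (𝓝[>] 0) (𝓝 (φ 0)) :=
      ((hφc 0 (by simp)).mono Ioi_subset_Ici_self).tendsto
    simpa using this.isBigO_one ℝ
  have hloc : LocallyIntegrableOn φ (Ioi 0) :=
    (hφc.mono Ioi_subset_Ici_self).locallyIntegrableOn measurableSet_Ioi
  have hpi2 : 0 < 2 * Real.pi := by positivity
  have hdiff : DifferentiableOn ℂ (mellin φ) {s : ℂ | 0 < s.re} := fun s hs =>
    (mellin_differentiableAt_of_isBigO_rpow_exp hpi2 hloc hφO hφ0 hs).differentiableWithinAt
  have hopen : IsOpen {s : ℂ | 0 < s.re} := isOpen_lt continuous_const Complex.continuous_re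
  have hb0 : (b : UnitAddCircle) ≠ 0 := fun h => by
    obtain ⟨n, hn⟩ := (AddCircle.coe_eq_zero_iff (1 : ℝ)).mp h
    rw [zsmul_eq_mul, mul_one] at hn
    have h1 : (0 : ℝ) < n := hn ▸ hb.1
    have h2 : (n : ℝ) < 1 := hn ▸ hb.2
    have h3 : 0 < n := by exact_mod_cast h1
    have h4 : n < 1 := by exact_mod_cast h2
    omega
  have hpiC : (2 * Real.pi : ℂ) ≠ 0 := by simp [Real.pi_ne_zero]
  have hR : DifferentiableOn ℂ (fun s : ℂ => (2 * Real.pi : ℂ) ^ (-s) * Complex.Gamma s *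
      HurwitzZeta.expZeta b (s - 1)) {s : ℂ | 0 < s.re} := fun s hs => by
    have h1 : DifferentiableAt ℂ Complex.Gamma s :=
      Complex.differentiableAt_Gamma _ fun m hm => by
        have hs' : 0 < s.re := hs
        rw [hm] at hs'
        simp only [Complex.neg_re, Complex.natCast_re] at hs'
        have h0 : (0 : ℝ) ≤ m := Nat.cast_nonneg m
        linarith
    have h2 : DifferentiableAt ℂ (fun s : ℂ => HurwitzZeta.expZeta b (s - 1)) s :=
      DifferentiableAt.comp (f := fun s : ℂ => s - 1) s
        (HurwitzZeta.differentiable_expZeta_of_ne_zero hb0 (s - 1)) (by fun_prop)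
    have h3 : DifferentiableAt ℂ (fun s : ℂ => (2 * Real.pi : ℂ) ^ (-s)) s :=
      (differentiable_neg.const_cpow (Or.inl hpiC)) s
    exact ((h3.mul h1).mul h2).differentiableWithinAt
  have hbig : ∀ s : ℂ, 2 < s.re → mellin φ s = (2 * Real.pi : ℂ) ^ (-s) * Complex.Gamma s *
      HurwitzZeta.expZeta b (s - 1) := fun s hs => by
    have hE := HurwitzZeta.hasSum_expZeta_of_one_lt_re b (s := s - 1) (by
      rw [Complex.sub_re, Complex.one_re]
      linarith)
    have hs0 : s ≠ 0 := fun h => by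
      rw [h, Complex.zero_re] at hs
      linarith
    have hs1 : s - 1 ≠ 0 := fun h => by
      rw [sub_eq_zero.mp h, Complex.one_re] at hs
      linarith
    have hsum : ∀ t ∈ Ioi (0 : ℝ), HasSum (fun n : ℕ => ((n : ℂ) * e (n * b)) *
        ((Real.exp (-(2 * Real.pi * n) * t) : ℝ) : ℂ)) (φ t) := fun t ht => by
      refine (hasSum_coe_mul_geometric_of_norm_lt_one (norm_e_add_I_mul_lt b ht)).congr_fun
        fun n => ?_
      rw [← e_natCast_mul, mul_add, e_add, mul_assoc]
      congr 2
      rw [e]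
      push_cast
      congr 1
      linear_combination (-(2 * Real.pi * n * t) : ℂ) * Complex.I_sq
    have hterm : ∀ n : ℕ, Complex.Gamma s * ((n : ℂ) * e (n * b)) /
        ((2 * Real.pi * n : ℝ) : ℂ) ^ s = (2 * Real.pi : ℂ) ^ (-s) * Complex.Gamma s *
        (Complex.exp (2 * Real.pi * Complex.I * b * n) / (n : ℂ) ^ (s - 1)) := fun n => by
      rcases n.eq_zero_or_pos with rfl | hn
      · simp [Complex.zero_cpow hs1]
      have hn0 : (n : ℂ) ≠ 0 := by exact_mod_cast hn.ne'
      rw [Complex.ofReal_mul, Complex.mul_cpow_ofReal_nonneg hpi2.le (Nat.cast_nonneg n),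
        Complex.ofReal_natCast, Complex.cpow_sub _ _ hn0, Complex.cpow_one, Complex.cpow_neg, e,
        show 2 * (Real.pi : ℂ) * Complex.I * (n * b) = 2 * Real.pi * Complex.I * b * n by ring]
      push_cast
      have h1 : (2 * Real.pi : ℂ) ^ s ≠ 0 := by simp [Complex.cpow_eq_zero_iff, Real.pi_ne_zero]
      have h2 : (n : ℂ) ^ s ≠ 0 := by simp [Complex.cpow_eq_zero_iff, hn0]
      field_simp
    have hsm : Summable fun n : ℕ => ‖(n : ℂ) * e (n * b)‖ / (2 * Real.pi * n) ^ s.re := by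
      have := ((Real.summable_one_div_nat_rpow (p := s.re - 1)).mpr (by linarith)).mul_left
        (((2 * Real.pi) ^ s.re)⁻¹)
      refine this.congr fun n => ?_
      have hen : ‖e (n * b)‖ = 1 := by
        have := norm_e_ofReal (n * b)
        push_cast at this
        exact this
      rcases n.eq_zero_or_pos with rfl | hn
      · have : s.re - 1 ≠ 0 := by linarith
        simp [Real.zero_rpow this]
      have hn0 : (0 : ℝ) < n := by exact_mod_cast hn
      rw [norm_mul, hen, mul_one, Complex.norm_natCast, Real.mul_rpow hpi2.le hn0.le,
        Real.rpow_sub hn0, Real.rpow_one]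
      field_simp
    have h := hasSum_mellin (a := fun n : ℕ => (n : ℂ) * e (n * b))
      (p := fun n : ℕ => 2 * Real.pi * n) (F := φ) (s := s) (fun n => by
        rcases n.eq_zero_or_pos with rfl | hn
        · left
          simp
        · right
          positivity) (by linarith) hsum hsm
    rw [← h.tsum_eq, ← hE.tsum_eq, ← tsum_mul_left]
    exact tsum_congr hterm
  have hid : EqOn (mellin φ) (fun s : ℂ => (2 * Real.pi : ℂ) ^ (-s) * Complex.Gamma s *
      HurwitzZeta.expZeta b (s - 1)) {s : ℂ | 0 < s.re} := by
    refine (hdiff.analyticOnNhd hopen).eqOn_of_preconnected_of_eventuallyEq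
      (hR.analyticOnNhd hopen) (convex_halfSpace_re_gt 0).isPreconnected (z₀ := 3) (by simp) ?_
    have hopen2 : IsOpen {s : ℂ | 2 < s.re} := isOpen_lt continuous_const Complex.continuous_re
    filter_upwards [hopen2.mem_nhds (show (3 : ℂ) ∈ {s : ℂ | 2 < s.re} by norm_num)] with s hs
    exact hbig s hs
  have hone : mellin φ 1 = (2 * Real.pi : ℂ)⁻¹ * HurwitzZeta.expZeta b 0 := by
    have := hid (show (1 : ℂ) ∈ {s : ℂ | 0 < s.re} by simp)
    simpa [Complex.cpow_neg_one] using this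
  have hderiv : ∀ y ∈ Ioi (0 : ℝ), HasDerivAt (fun y => q y / (1 - q y)) (-(2 * Real.pi) * φ y) y :=
    fun y hy => by
      have hd : HasDerivAt q (-(2 * Real.pi) * q y) y := by
        have h1 : HasDerivAt (fun y : ℝ => 2 * Real.pi * Complex.I * ((b : ℂ) + y * Complex.I))
            (2 * Real.pi * Complex.I * (1 * Complex.I)) y :=
          ((((hasDerivAt_id y).ofReal_comp).mul_const Complex.I).const_add (b : ℂ)).const_mul _
        refine h1.cexp.congr_deriv ?_
        rw [hq]
        simp only [e]
        linear_combination (2 * Real.pi * Complex.exp (2 * Real.pi * Complex.I *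
          ((b : ℂ) + y * Complex.I))) * Complex.I_sq
      have hn := hne y (le_of_lt hy)
      refine (hd.div (hd.const_sub 1) hn).congr_deriv ?_
      simp only [hφ]
      field_simp
      ring
  have hlim : Tendsto (fun y => q y / (1 - q y)) atTop (𝓝 (0 / (1 - 0))) :=
    hq0.div (hq0.const_sub 1) (by norm_num)
  have hφi : IntegrableOn φ (Ioi 0) := by
    have := mellinConvergent_of_isBigO_rpow_exp hpi2 hloc hφO hφ0 (s := 1) (by simp)
    simpa [MellinConvergent] using this
  have hcont : ContinuousWithinAt (fun y => q y / (1 - q y)) (Ici 0) 0 :=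
    (hqc.continuousOn.div (by fun_prop) hne) 0 (by simp : (0 : ℝ) ∈ Ici 0)
  have hint := integral_Ioi_of_hasDerivAt_of_tendsto hcont hderiv (hφi.const_mul _) hlim
  have hm1 : mellin φ 1 = ∫ y in Ioi (0 : ℝ), φ y := by simp [mellin]
  rw [integral_const_mul, ← hm1, hone] at hint
  have hq00 : q 0 = e b := by simp [hq]
  rw [hq00] at hint
  have h2 : -(2 * Real.pi : ℂ) * ((2 * Real.pi : ℂ)⁻¹ * HurwitzZeta.expZeta b 0) =
      -HurwitzZeta.expZeta b 0 := by
    field_simp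
  rw [h2] at hint
  simp only [zero_div, zero_sub, neg_inj] at hint
  exact hint

/-! ### Mellin transforms in a right half-plane -/

section

theorem ModerateDecay.mellinConvergent {P : ℝ → ℂ} (hP : ModerateDecay P) :
    ∃ σ : ℝ, ∀ s : ℂ, σ < s.re → MellinConvergent P s := by
  obtain ⟨N, hN⟩ := hP.growth
  obtain ⟨δ, hδ, hO⟩ := hP.expDecay.exists_exp
  have h0 : P =O[𝓝[>] 0] fun x : ℝ => x ^ (-(N : ℝ)) := by
    refine (hN.comp_tendsto tendsto_inv_nhdsGT_zero).congr' ?_ ?_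
    · exact Eventually.of_forall fun x => by simp
    · filter_upwards [self_mem_nhdsWithin] with x hx
      rw [Function.comp_apply, Real.inv_rpow (le_of_lt hx), Real.rpow_neg (le_of_lt hx)]
  exact ⟨N, fun s hs => mellinConvergent_of_isBigO_rpow_exp hδ
    (hP.continuousOn.locallyIntegrableOn measurableSet_Ioi) hO h0 hs⟩

/-- In some right half-plane the Mellin transform of `P` converges and equals
`(2π)⁻ˢ Γ(s) R(s)`. -/
def HasMellinGamma (P : ℝ → ℂ) (R : ℂ → ℂ) : Prop :=
  ∃ σ : ℝ, ∀ s : ℂ, σ < s.re → MellinConvergent P s ∧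
    mellin P s = (2 * Real.pi : ℂ) ^ (-s) * Complex.Gamma s * R s

namespace HasMellinGamma

variable {P Q : ℝ → ℂ} {R S : ℂ → ℂ}

theorem add (hP : HasMellinGamma P R) (hQ : HasMellinGamma Q S) :
    HasMellinGamma (fun y => P y + Q y) fun s => R s + S s := by
  obtain ⟨σ, h⟩ := hP
  obtain ⟨τ, h'⟩ := hQ
  refine ⟨max σ τ, fun s hs => ?_⟩
  obtain ⟨c, e⟩ := h s (lt_of_le_of_lt (le_max_left _ _) hs)
  obtain ⟨c', e'⟩ := h' s (lt_of_le_of_lt (le_max_right _ _) hs)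
  obtain ⟨h1, h2⟩ := hasMellin_add c c'
  exact ⟨h1, by rw [h2, e, e', mul_add]⟩

theorem const_mul (hP : HasMellinGamma P R) (a : ℂ) :
    HasMellinGamma (fun y => a * P y) fun s => a * R s := by
  obtain ⟨σ, h⟩ := hP
  refine ⟨σ, fun s hs => ?_⟩
  obtain ⟨c, e⟩ := h s hs
  have h1 := c.const_smul a
  have h2 := mellin_const_smul P s a
  simp only [smul_eq_mul] at h1 h2
  exact ⟨h1, by rw [h2, e]; ring⟩

theorem congr (hP : HasMellinGamma P R) (hQ : ∀ y : ℝ, 0 < y → Q y = P y)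
    (hS : ∀ s, S s = R s) : HasMellinGamma Q S := by
  obtain ⟨σ, h⟩ := hP
  have hQ' : ∀ s : ℂ, EqOn (fun t : ℝ => (t : ℂ) ^ (s - 1) • P t)
      (fun t : ℝ => (t : ℂ) ^ (s - 1) • Q t) (Ioi 0) := fun s t ht => by
    simp only
    rw [hQ t ht]
  refine ⟨σ, fun s hs => ?_⟩
  obtain ⟨c, e⟩ := h s hs
  refine ⟨IntegrableOn.congr_fun c (hQ' s) measurableSet_Ioi, ?_⟩
  rw [hS, ← e]
  exact (setIntegral_congr_fun measurableSet_Ioi (hQ' s)).symm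

/-- Multiplication by `y` shifts the Mellin transform. -/
theorem id_mul (hP : HasMellinGamma P R) :
    HasMellinGamma (fun y => (y : ℂ) * P y) fun s => (2 * Real.pi : ℂ)⁻¹ * s * R (s + 1) := by
  obtain ⟨σ, h⟩ := hP
  refine ⟨max σ 0, fun s hs => ?_⟩
  have hs0 : s ≠ 0 := fun h0 => by
    rw [h0, Complex.zero_re] at hs
    exact absurd (lt_of_le_of_lt (le_max_right _ _) hs) (lt_irrefl _)
  have hpi : (2 * Real.pi : ℂ) ≠ 0 := by simp [Real.pi_ne_zero]
  obtain ⟨c, e⟩ := h (s + 1) (by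
    rw [Complex.add_re, Complex.one_re]
    linarith [le_max_left σ 0])
  have h1 := (MellinConvergent.cpow_smul (f := P) (s := s) (a := 1)).mpr c
  have h2 := mellin_cpow_smul P s 1
  simp only [smul_eq_mul, Complex.cpow_one] at h1 h2
  refine ⟨h1, ?_⟩
  rw [h2, e, neg_add, Complex.cpow_add _ _ hpi, Complex.cpow_neg_one, Complex.Gamma_add_one _ hs0]
  ring

end HasMellinGamma

theorem hasMellinGamma_eisSeries (k : ℕ) {a : ℝ} (ha : a ∈ Ioo (0 : ℝ) 1) (b : ℝ) :
    HasMellinGamma (fun y : ℝ => eisSeries k a b y) fun s =>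
      HurwitzZeta.expZeta b s * HurwitzZeta.hurwitzZeta a (s - (k - 1 : ℕ)) := by
  obtain ⟨σ, h⟩ := (moderateDecay_doubleSeries zero_lt_one ha.1 (polyBounded_e 1 b)
    (polyBounded_pow ha.1 (k - 1))).mellinConvergent
  exact ⟨max σ ((k - 1 : ℕ) + 1), fun s hs => ⟨h s (lt_of_le_of_lt (le_max_left _ _) hs),
    mellin_eisSeries k ha b (lt_of_le_of_lt (le_max_right _ _) hs)⟩⟩

theorem hasMellinGamma_eichSeries (k : ℕ) {a : ℝ} (ha : a ∈ Ioo (0 : ℝ) 1) (b : ℝ) :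
    HasMellinGamma (fun y : ℝ => eichSeries k a b y) fun s =>
      HurwitzZeta.expZeta b (s + 1) * HurwitzZeta.hurwitzZeta a (s - (k - 2 : ℕ)) := by
  obtain ⟨σ, h⟩ := (moderateDecay_doubleSeries zero_lt_one ha.1 (polyBounded_e_div b)
    (polyBounded_pow ha.1 (k - 2))).mellinConvergent
  exact ⟨max σ ((k - 2 : ℕ) + 1), fun s hs => ⟨h s (lt_of_le_of_lt (le_max_left _ _) hs),
    mellin_eichSeries k ha b (lt_of_le_of_lt (le_max_right _ _) hs)⟩⟩

theorem hasMellinGamma_gSeries (k : ℕ) {a b : ℝ} (ha : a ∈ Ioo (0 : ℝ) 1)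
    (hb : b ∈ Ioo (0 : ℝ) 1) :
    HasMellinGamma (fun y : ℝ => gSeries k a b y) fun s =>
      HurwitzZeta.hurwitzZeta a (s - (k - 1 : ℕ)) * HurwitzZeta.hurwitzZeta b s := by
  obtain ⟨σ, h⟩ := (moderateDecay_doubleSeries ha.1 hb.1 (polyBounded_pow ha.1 (k - 1))
    (polyBounded_one b)).mellinConvergent
  exact ⟨max σ ((k - 1 : ℕ) + 1), fun s hs => ⟨h s (lt_of_le_of_lt (le_max_left _ _) hs),
    mellin_gSeries k ha hb (lt_of_le_of_lt (le_max_right _ _) hs)⟩⟩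

theorem one_sub_mem_Ioo {a : ℝ} (ha : a ∈ Ioo (0 : ℝ) 1) : 1 - a ∈ Ioo (0 : ℝ) 1 :=
  ⟨by linarith [ha.2], by linarith [ha.1]⟩

theorem hasMellinGamma_gEis (k : ℕ) {a b : ℝ} (ha : a ∈ Ioo (0 : ℝ) 1) (hb : b ∈ Ioo (0 : ℝ) 1) :
    HasMellinGamma (fun y : ℝ => gEis k a b y) fun s =>
      HurwitzZeta.hurwitzZeta a (s - (k - 1 : ℕ)) * HurwitzZeta.hurwitzZeta b s +
        (-1) ^ k * (HurwitzZeta.hurwitzZeta (1 - a : ℝ) (s - (k - 1 : ℕ)) *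
          HurwitzZeta.hurwitzZeta (1 - b : ℝ) s) :=
  (hasMellinGamma_gSeries k ha hb).add
    ((hasMellinGamma_gSeries k (one_sub_mem_Ioo ha) (one_sub_mem_Ioo hb)).const_mul _)

/-! ### Complex conjugation -/

theorem conj_e_mul (n : ℕ) (b : ℝ) :
    starRingEnd ℂ (e (((n : ℂ) + 1) * b)) = e (((n : ℂ) + 1) * (-b : ℝ)) := by
  have := conj_e ((n + 1) * b)
  push_cast at this ⊢
  rw [this, mul_neg]

theorem conj_natCast_add_pow (n j : ℕ) (a : ℝ) :
    starRingEnd ℂ (((n : ℂ) + a) ^ j) = ((n : ℂ) + a) ^ j := by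
  rw [map_pow, map_add, Complex.conj_ofReal, map_natCast]

theorem conj_eisSeries (k : ℕ) (a b y : ℝ) :
    starRingEnd ℂ (eisSeries k a b y) = eisSeries k a (-b) y := by
  rw [eisSeries, eisSeries, conj_doubleSeries]
  simp only [conj_e_mul, conj_natCast_add_pow]

theorem conj_eichSeries (k : ℕ) (a b y : ℝ) :
    starRingEnd ℂ (eichSeries k a b y) = eichSeries k a (-b) y := by
  rw [eichSeries, eichSeries, conj_doubleSeries]
  simp only [map_div₀, map_add, map_natCast, map_one, conj_e_mul, conj_natCast_add_pow]

theorem conj_gSeries (k : ℕ) (a b y : ℝ) :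
    starRingEnd ℂ (gSeries k a b y) = gSeries k a b y := by
  rw [gSeries, conj_doubleSeries]
  simp only [map_one, conj_natCast_add_pow]

theorem conj_jSeries (a b y : ℝ) :
    starRingEnd ℂ (jSeries 1 a b y) = jSeries 1 (-a) (-b) y := by
  rw [jSeries, jSeries, conj_doubleSeries]
  simp [conj_e_mul]

theorem ofReal_im_eq (z : ℂ) : ((z.im : ℝ) : ℂ) = (z - starRingEnd ℂ z) / (2 * Complex.I) := by
  rw [Complex.sub_conj]
  have := Complex.I_ne_zero
  push_cast
  field_simp

theorem e_mul_one_sub (n : ℕ) (b : ℝ) :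
    e (((n : ℂ) + 1) * (1 - b : ℝ)) = e (((n : ℂ) + 1) * (-b : ℝ)) := by
  have : ((n : ℂ) + 1) * (1 - b : ℝ) = ((n : ℂ) + 1) * (-b : ℝ) + ((n + 1 : ℤ) : ℂ) := by
    push_cast
    ring
  rw [this, e_add, e_intCast, mul_one]

theorem eisTail_one_sub (k : ℕ) (a b : ℝ) (w : ℂ) : eisTail k a (1 - b) w = eisTail k a (-b) w := by
  have h : ∀ n : ℕ, e (((n : ℂ) + 1) * (-(1 - b) : ℝ)) = e (((n : ℂ) + 1) * (-(-b) : ℝ)) :=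
    fun n => by
      have := e_mul_one_sub n (1 - b)
      rw [sub_sub_cancel] at this
      rw [← this, neg_neg]
  simp only [eisTail, eisSeries, e_mul_one_sub, h]

theorem jSeries_one_sub_right (a b : ℝ) (w : ℂ) : jSeries 1 a (1 - b) w = jSeries 1 a (-b) w := by
  simp only [jSeries, e_mul_one_sub]

/-! ### Expansions at the cusps -/

theorem HasCuspExpansion.ofReal_im {h : ℝ → ℂ} {n : ℕ} {c d : ℂ} (hh : HasCuspExpansion h n c d) :
    HasCuspExpansion (fun y => ((h y).im : ℂ)) n (c.im : ℂ) (d.im : ℂ) := by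
  refine ⟨Complex.continuous_ofReal.comp_continuousOn
    (Complex.continuous_im.comp_continuousOn hh.continuousOn), hh.expDecay.ofReal_im,
    hh.expDecay_inv.ofReal_im.congr fun y _ => ?_⟩
  rw [Complex.sub_im, Complex.sub_im, ← Complex.ofReal_pow, Complex.im_mul_ofReal]
  push_cast
  ring

theorem moderateDecay_gEis (k : ℕ) {a b : ℝ} (ha : a ∈ Ioo (0 : ℝ) 1) (hb : b ∈ Ioo (0 : ℝ) 1) :
    ModerateDecay fun y : ℝ => gEis k a b y :=
  (moderateDecay_doubleSeries ha.1 hb.1 (polyBounded_pow ha.1 (k - 1)) (polyBounded_one b)).add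
    ((moderateDecay_doubleSeries (one_sub_mem_Ioo ha).1 (one_sub_mem_Ioo hb).1
      (polyBounded_pow (one_sub_mem_Ioo ha).1 (k - 1)) (polyBounded_one (1 - b))).const_mul _)

theorem moderateDecay_jSeries (k : ℕ) (a b : ℝ) : ModerateDecay fun y : ℝ => jSeries k a b y :=
  moderateDecay_doubleSeries zero_lt_one zero_lt_one (polyBounded_e 1 a)
    (polyBounded_pow_mul_e (k - 1) b)

/-- By the inversion formulas `G^{(k)}` is a monomial at the cusp `0`, up to exponential decay. -/
theorem exists_hasCuspExpansion_gEis {k : ℕ} (hk : 1 ≤ k) {a b : ℝ} (ha : a ∈ Ioo (0 : ℝ) 1)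
    (hb : b ∈ Ioo (0 : ℝ) 1) :
    ∃ c : ℂ, HasCuspExpansion (fun y : ℝ => gEis k a b y) k c 0 := by
  have hG := moderateDecay_gEis k ha hb
  have hI := Complex.I_ne_zero
  rcases Nat.exists_eq_add_of_le' hk with ⟨j, rfl⟩
  rcases j with _ | j
  · refine ⟨(Complex.I)⁻¹ * (cotFun a + cotFun b), hG.continuousOn, hG.expDecay, ?_⟩
    have h := (((moderateDecay_jSeries 1 a b).expDecay.sub
      (moderateDecay_jSeries 1 (-a) (-b)).expDecay).pow_mul 1).const_mul (Complex.I)⁻¹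
    refine h.congr fun y hy => ?_
    have hy0 : (y : ℂ) ≠ 0 := by exact_mod_cast hy.ne'
    rw [zero_add, gEis_one_inv (one_div_pos.mpr hy) ha hb, one_div_one_div]
    push_cast
    field_simp
    ring
  · refine ⟨(Complex.I ^ (j + 2))⁻¹ * gConst j b, hG.continuousOn, hG.expDecay, ?_⟩
    have h := (((moderateDecay_jSeries (j + 2) a b).expDecay.add
      ((moderateDecay_jSeries (j + 2) (-a) (-b)).expDecay.const_mul ((-1) ^ j))).pow_mul
        (j + 2)).const_mul (Complex.I ^ (j + 2))⁻¹
    refine h.congr fun y hy => ?_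
    have hy0 : (y : ℂ) ≠ 0 := by exact_mod_cast hy.ne'
    rw [gEis_inv (one_div_pos.mpr hy) j ha.1 ha.2 hb.1 hb.2, one_div_one_div, mul_pow, mul_inv]
    push_cast
    rw [one_div, inv_pow, inv_inv]
    ring

theorem moderateDecay_eisTail (k : ℕ) {a : ℝ} (ha : a ∈ Ioo (0 : ℝ) 1) (b : ℝ) :
    ModerateDecay fun y : ℝ => eisTail k a b y :=
  (moderateDecay_doubleSeries zero_lt_one ha.1 (polyBounded_e 1 b) (polyBounded_pow ha.1 _)).add
    ((moderateDecay_doubleSeries zero_lt_one (one_sub_mem_Ioo ha).1 (polyBounded_e 1 (-b))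
      (polyBounded_pow (one_sub_mem_Ioo ha).1 _)).const_mul _)

theorem moderateDecay_eichTail (k : ℕ) {a : ℝ} (ha : a ∈ Ioo (0 : ℝ) 1) (b : ℝ) :
    ModerateDecay fun y : ℝ => eichTail k a b y :=
  (moderateDecay_doubleSeries zero_lt_one ha.1 (polyBounded_e_div b)
    (polyBounded_pow ha.1 _)).add ((moderateDecay_doubleSeries zero_lt_one (one_sub_mem_Ioo ha).1
      (polyBounded_e_div (-b)) (polyBounded_pow (one_sub_mem_Ioo ha).1 _)).const_mul _)

theorem frac_mem_Ioo {x : UnitAddCircle} (hx : x ≠ 0) : frac x ∈ Ioo (0 : ℝ) 1 :=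
  ⟨frac_pos hx, frac_lt_one x⟩

/-- The imaginary part of an Eisenstein series of weight two has no constant term at either
cusp. -/
theorem expDecay_eisTail_im_inv {x : UnitAddCircle × UnitAddCircle} (hx₁ : x.1 ≠ 0)
    (hx₂ : x.2 ≠ 0) :
    ExpDecay fun y : ℝ => ((eisTail 2 (frac x.1) (frac x.2) ((1 / y : ℝ) : ℂ)).im : ℂ) := by
  have h := ((moderateDecay_eisTail 2 (frac_mem_Ioo hx₂) (frac (-x.1))).ofReal_im.expDecay.pow_mul
    2).neg
  refine h.congr fun y hy => ?_
  have h1 := eisE_inv hy le_rfl hx₁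
  rw [eisE_eq_tail (one_div_pos.mpr hy) le_rfl hx₁,
    eisE_eq_tail hy le_rfl (x := (x.2, -x.1)) hx₂, mul_pow, Complex.I_sq] at h1
  have h2 := congrArg Complex.im h1
  rw [Complex.sub_im, Complex.ofReal_im, zero_sub, neg_one_mul, ← Complex.ofReal_pow,
    ← Complex.ofReal_neg, Complex.im_ofReal_mul, Complex.sub_im, Complex.ofReal_im] at h2
  rw [← neg_neg (Complex.im _), h2]
  push_cast
  ring

/-- The series `y Im A(y)` and `y Im A(1/y)`, where `A` is the non-constant part of an Eisenstein
series of weight two. -/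
theorem hasCuspExpansion_mul_eisTail_im {x : UnitAddCircle × UnitAddCircle} (hx₁ : x.1 ≠ 0)
    (hx₂ : x.2 ≠ 0) (n : ℕ) :
    HasCuspExpansion (fun y : ℝ => (y : ℂ) * ((eisTail 2 (frac x.1) (frac x.2) y).im : ℂ)) n 0 0 ∧
    HasCuspExpansion (fun y : ℝ =>
      (y : ℂ) * ((eisTail 2 (frac x.1) (frac x.2) ((1 / y : ℝ) : ℂ)).im : ℂ)) n 0 0 := by
  have hM := (moderateDecay_eisTail 2 (frac_mem_Ioo hx₁) (frac x.2)).ofReal_im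
  have hinv := expDecay_eisTail_im_inv hx₁ hx₂
  have hO : ∀ {g : ℝ → ℂ}, ExpDecay g → ExpDecay fun y : ℝ => (y : ℂ)⁻¹ * g y := fun hg => by
    refine hg.mul_of_isBigO (N := -1) (Asymptotics.IsBigO.of_bound 1 ?_)
    filter_upwards [eventually_gt_atTop 0] with y hy
    rw [Real.rpow_neg_one, one_mul, norm_inv, norm_inv, Complex.norm_real]
  refine ⟨⟨ContinuousOn.mul (by fun_prop) hM.continuousOn, ?_, ?_⟩,
    ⟨ContinuousOn.mul (by fun_prop) hM.continuousOn_inv, ?_, ?_⟩⟩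
  · exact (hM.expDecay.pow_mul 1).congr fun y _ => by rw [pow_one]
  · refine (hO hinv).congr fun y _ => ?_
    push_cast
    ring
  · exact (hinv.pow_mul 1).congr fun y _ => by rw [pow_one]
  · refine (hO hM.expDecay).congr fun y _ => ?_
    rw [one_div_one_div]
    push_cast
    ring

/-- At `s = -1` the Mellin transforms of `y P(1/y)` and of `y P(y)` agree. -/
theorem mellin_mul_comp_inv (P : ℝ → ℂ) :
    mellin (fun y : ℝ => (y : ℂ) * P (1 / y)) (-1) = mellin (fun y : ℝ => (y : ℂ) * P y) (-1) := by
  have h1 := mellin_comp_inv (fun y : ℝ => (y : ℂ)⁻¹ * P y) (-1)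
  have h2 := mellin_cpow_smul P (-1) 1
  have h3 := mellin_cpow_smul P 1 (-1)
  simp only [Complex.cpow_one, Complex.cpow_neg_one, smul_eq_mul] at h2 h3
  rw [neg_neg, h3] at h1
  rw [h2, show (-1 : ℂ) + 1 = 1 + -1 by ring, ← h1]
  congr 1
  ext y
  rw [Complex.ofReal_inv, inv_inv, one_div]

end

/-! ### The exchange of frequencies for imaginary parts -/

theorem mellin_four_terms {f₁ f₂ f₃ f₄ : ℝ → ℂ} {s : ℂ} (c : ℂ) (h₁ : MellinConvergent f₁ s)
    (h₂ : MellinConvergent f₂ s) (h₃ : MellinConvergent f₃ s) (h₄ : MellinConvergent f₄ s) :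
    HasMellin (fun y => f₁ y + c * f₂ y + (f₃ y + c * f₄ y)) s
      (mellin f₁ s + c * mellin f₂ s + (mellin f₃ s + c * mellin f₄ s)) := by
  have h₂' := h₂.const_smul c
  have h₄' := h₄.const_smul c
  have m₂ := mellin_const_smul f₂ s c
  have m₄ := mellin_const_smul f₄ s c
  simp only [smul_eq_mul] at h₂' h₄' m₂ m₄
  obtain ⟨a, a'⟩ := hasMellin_add h₁ h₂'
  obtain ⟨b, b'⟩ := hasMellin_add h₃ h₄'
  obtain ⟨d, d'⟩ := hasMellin_add a b
  exact ⟨d, by rw [d', a', b', m₂, m₄]⟩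

/-- For real `s`, here `s = -1`, the Mellin transform commutes with taking imaginary parts. -/
theorem mellin_ofReal_im {F : ℝ → ℂ} (hF : MellinConvergent F (-1)) :
    mellin (fun y => ((F y).im : ℂ)) (-1) = ((mellin F (-1)).im : ℂ) := by
  have hr : ∀ t ∈ Ioi (0 : ℝ), (t : ℂ) ^ ((-1 : ℂ) - 1) = (((t ^ 2)⁻¹ : ℝ) : ℂ) := fun t _ => by
    rw [show (-1 : ℂ) - 1 = -(2 : ℕ) by norm_num, Complex.cpow_neg, Complex.cpow_natCast]
    push_cast
    rfl
  rw [mellin, mellin, ofReal_im_integral hF]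
  refine setIntegral_congr_fun measurableSet_Ioi fun t ht => ?_
  simp only [smul_eq_mul]
  rw [hr t ht, Complex.im_ofReal_mul]
  push_cast
  rfl

/-- The kernel obtained from the product of an Eisenstein series and an Eichler integral by the
exchange of frequencies. -/
def exchangeKernel (k : ℕ) (a₁ a₂ b₁ b₂ y : ℝ) : ℂ :=
  ((jSeries 1 a₁ b₂ ((1 / y : ℝ) : ℂ)).im : ℂ) * gEis (k - 1) b₁ (1 - a₂) y -
    ((jSeries 1 a₁ (-b₂) ((1 / y : ℝ) : ℂ)).im : ℂ) * gEis (k - 1) b₁ a₂ y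

theorem hasCuspExpansion_exchangeKernel (k : ℕ) (a₁ b₂ : ℝ) {a₂ b₁ : ℝ} (ha₂ : a₂ ∈ Ioo (0 : ℝ) 1)
    (hb₁ : b₁ ∈ Ioo (0 : ℝ) 1) (n : ℕ) :
    HasCuspExpansion (exchangeKernel k a₁ a₂ b₁ b₂) n 0 0 := by
  have h1 := ((moderateDecay_jSeries 1 a₁ b₂).ofReal_im).hasCuspExpansion_inv_mul
    (moderateDecay_gEis (k - 1) hb₁ (one_sub_mem_Ioo ha₂)) n
  have h2 := (((moderateDecay_jSeries 1 a₁ (-b₂)).ofReal_im).hasCuspExpansion_inv_mul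
    (moderateDecay_gEis (k - 1) hb₁ ha₂) n).const_mul (-1)
  have h := h1.add h2
  rw [mul_zero, add_zero] at h
  refine h.congr fun y _ => ?_
  rw [exchangeKernel]
  ring

/-- The kernel as the imaginary part of the four products obtained by exchanging frequencies. -/
theorem exchangeKernel_eq {k : ℕ} (hk : 2 ≤ k) (a₁ a₂ b₁ b₂ y : ℝ) :
    exchangeKernel k a₁ a₂ b₁ b₂ y =
      ((jSeries 1 (-a₁) b₂ ((1 / y : ℝ) : ℂ) * gSeries (k - 1) b₁ a₂ y +
        (-1) ^ k * (jSeries 1 (-a₁) (-b₂) ((1 / y : ℝ) : ℂ) * gSeries (k - 1) (1 - b₁) a₂ y) +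
        (jSeries 1 a₁ b₂ ((1 / y : ℝ) : ℂ) * gSeries (k - 1) b₁ (1 - a₂) y +
          (-1) ^ k * (jSeries 1 a₁ (-b₂) ((1 / y : ℝ) : ℂ) *
            gSeries (k - 1) (1 - b₁) (1 - a₂) y))).im : ℂ) := by
  obtain ⟨j, rfl⟩ := Nat.exists_eq_add_of_le' hk
  have hI := Complex.I_ne_zero
  rw [exchangeKernel, ofReal_im_eq, ofReal_im_eq, ofReal_im_eq]
  simp only [map_add, map_mul, map_pow, map_neg, map_one, conj_jSeries, conj_gSeries, neg_neg, gEis,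
    sub_sub_cancel, show j + 2 - 1 = j + 1 from rfl]
  rw [pow_add, pow_add]
  field_simp
  ring

/-- The exchange of frequencies for the imaginary part of the product of an Eisenstein series at
`-1/τ` and of an Eichler integral. -/
theorem mellin_im_eisTail_mul_eichTail {k : ℕ} (hk : 2 ≤ k) (a₁ b₂ : ℝ) {a₂ b₁ : ℝ}
    (ha₂ : a₂ ∈ Ioo (0 : ℝ) 1) (hb₁ : b₁ ∈ Ioo (0 : ℝ) 1) :
    mellin (fun y : ℝ =>
      ((eisTail 2 a₂ (-a₁) ((1 / y : ℝ) : ℂ) * eichTail k b₁ b₂ y).im : ℂ)) (-1) =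
      mellin (exchangeKernel k a₁ a₂ b₁ b₂) (-1) := by
  have conv : ∀ {P Q : ℝ → ℂ}, ModerateDecay P → ModerateDecay Q →
      MellinConvergent (fun y => P (1 / y) * Q y) (-1) := fun hP hQ =>
    ((hP.hasCuspExpansion_inv_mul hQ 0).mellin_eq (Or.inl rfl) (Or.inl rfl)).1
  have hE : ∀ {a : ℝ} (b : ℝ), a ∈ Ioo (0 : ℝ) 1 → ModerateDecay fun y : ℝ => eisSeries 2 a b y :=
    fun b ha => moderateDecay_doubleSeries zero_lt_one ha.1 (polyBounded_e 1 b)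
      (polyBounded_pow ha.1 _)
  have hB : ∀ {a : ℝ} (b : ℝ), a ∈ Ioo (0 : ℝ) 1 → ModerateDecay fun y : ℝ => eichSeries k a b y :=
    fun b ha => moderateDecay_doubleSeries zero_lt_one ha.1 (polyBounded_e_div b)
      (polyBounded_pow ha.1 _)
  have hG : ∀ {a b : ℝ}, a ∈ Ioo (0 : ℝ) 1 → b ∈ Ioo (0 : ℝ) 1 →
      ModerateDecay fun y : ℝ => gSeries (k - 1) a b y :=
    fun ha hb => moderateDecay_doubleSeries ha.1 hb.1 (polyBounded_pow ha.1 _) (polyBounded_one _)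
  have ha₂' := one_sub_mem_Ioo ha₂
  have hb₁' := one_sub_mem_Ioo hb₁
  have h1 := mellin_four_terms ((-1) ^ k) (conv (hE (-a₁) ha₂) (hB b₂ hb₁))
    (conv (hE (-a₁) ha₂) (hB (-b₂) hb₁')) (conv (hE a₁ ha₂') (hB b₂ hb₁))
    (conv (hE a₁ ha₂') (hB (-b₂) hb₁'))
  have h2 := mellin_four_terms ((-1) ^ k)
    (conv (moderateDecay_jSeries 1 (-a₁) b₂) (hG hb₁ ha₂))
    (conv (moderateDecay_jSeries 1 (-a₁) (-b₂)) (hG hb₁' ha₂))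
    (conv (moderateDecay_jSeries 1 a₁ b₂) (hG hb₁ ha₂'))
    (conv (moderateDecay_jSeries 1 a₁ (-b₂)) (hG hb₁' ha₂'))
  have hL : (fun y : ℝ =>
      ((eisTail 2 a₂ (-a₁) ((1 / y : ℝ) : ℂ) * eichTail k b₁ b₂ y).im : ℂ)) = fun y : ℝ =>
      ((eisSeries 2 a₂ (-a₁) ((1 / y : ℝ) : ℂ) * eichSeries k b₁ b₂ y +
        (-1) ^ k * (eisSeries 2 a₂ (-a₁) ((1 / y : ℝ) : ℂ) * eichSeries k (1 - b₁) (-b₂) y) +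
        (eisSeries 2 (1 - a₂) a₁ ((1 / y : ℝ) : ℂ) * eichSeries k b₁ b₂ y +
        (-1) ^ k * (eisSeries 2 (1 - a₂) a₁ ((1 / y : ℝ) : ℂ) *
          eichSeries k (1 - b₁) (-b₂) y))).im : ℂ) := by
    ext y
    rw [eisTail, eichTail, neg_neg]
    congr 2
    ring
  have hR : exchangeKernel k a₁ a₂ b₁ b₂ = _ := funext fun y => exchangeKernel_eq hk a₁ a₂ b₁ b₂ y
  rw [hL, hR, mellin_ofReal_im h1.1, mellin_ofReal_im h2.1, h1.2, h2.2,
    mellin_eisSeries_mul_eichSeries ha₂.1 hb₁.1, mellin_eisSeries_mul_eichSeries ha₂.1 hb₁'.1,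
    mellin_eisSeries_mul_eichSeries ha₂'.1 hb₁.1, mellin_eisSeries_mul_eichSeries ha₂'.1 hb₁'.1]

/-! ### Vanishing of the boundary terms -/

theorem coe_ne_zero_of_mem_Ioo {b : ℝ} (hb : b ∈ Ioo (0 : ℝ) 1) : (b : UnitAddCircle) ≠ 0 :=
  fun h => by
    have := frac_coe hb.1.le hb.2
    rw [h, ← AddCircle.coe_zero, frac_coe le_rfl zero_lt_one] at this
    exact hb.1.ne this

theorem expZeta_sub_expZeta_neg {b : ℝ} (hb : b ∈ Ioo (0 : ℝ) 1) :
    HurwitzZeta.expZeta b 0 - HurwitzZeta.expZeta (-b : ℝ) 0 = 2 * cotFun b := by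
  have h1 : ((-b : ℝ) : UnitAddCircle) = ((1 - b : ℝ) : UnitAddCircle) := by
    rw [AddCircle.coe_sub, AddCircle.coe_neg, AddCircle.coe_period, zero_sub]
  have h2 : ∀ c : ℝ, e c / (1 - e c) = cotFun c - 1 / 2 := fun c => by
    rw [cotFun]
    ring
  rw [h1, expZeta_zero hb, expZeta_zero (one_sub_mem_Ioo hb), h2, h2, cotFun_one_sub hb.1 hb.2]
  ring

theorem hurwitzZeta_at_neg_one {k : ℕ} (hk : 2 ≤ k) {a : ℝ} (ha : a ∈ Ioo (0 : ℝ) 1) :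
    HurwitzZeta.hurwitzZeta a (-1 - (k - 2 : ℕ)) = -((bernoulliFun k a / k : ℝ) : ℂ) := by
  obtain ⟨j, rfl⟩ := Nat.exists_eq_add_of_le' hk
  have h := hurwitzZeta_neg_eq ha (Nat.succ_ne_zero j)
  rw [Nat.succ_eq_add_one] at h
  rw [Nat.add_sub_cancel, show (-1 : ℂ) - (j : ℕ) = -((j + 1 : ℕ) : ℂ) by push_cast; ring, h]
  push_cast
  ring_nf

theorem hurwitzZeta_at_neg_one_one_sub {k : ℕ} (hk : 2 ≤ k) {a : ℝ} (ha : a ∈ Ioo (0 : ℝ) 1) :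
    HurwitzZeta.hurwitzZeta (1 - a : ℝ) (-1 - (k - 2 : ℕ)) =
      -((-1) ^ k * ((bernoulliFun k a / k : ℝ) : ℂ)) := by
  rw [hurwitzZeta_at_neg_one hk (one_sub_mem_Ioo ha), bernoulliFun_eval_one_sub]
  push_cast
  ring

theorem hurwitzZeta_neg_one {a : ℝ} (ha : a ∈ Ioo (0 : ℝ) 1) :
    HurwitzZeta.hurwitzZeta a (-1) = -((bernoulliFun 2 a / 2 : ℝ) : ℂ) := by
  have := hurwitzZeta_at_neg_one le_rfl ha
  simpa using this

theorem hurwitzZeta_neg_one_one_sub {a : ℝ} (ha : a ∈ Ioo (0 : ℝ) 1) :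
    HurwitzZeta.hurwitzZeta (1 - a : ℝ) (-1) = -((bernoulliFun 2 a / 2 : ℝ) : ℂ) := by
  have := hurwitzZeta_at_neg_one_one_sub le_rfl ha
  simpa using this

theorem differentiableOn_hurwitzZeta_sub (a : ℝ) (j : ℕ) :
    DifferentiableOn ℂ (fun s : ℂ => HurwitzZeta.hurwitzZeta a (s - j)) {(1 : ℂ), (j : ℂ) + 1}ᶜ :=
  fun s hs => by
    simp only [mem_compl_iff, mem_insert_iff, mem_singleton_iff, not_or] at hs
    have h : s - j ≠ 1 := fun h => hs.2 (by rw [← h]; ring)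
    exact (DifferentiableAt.comp (f := fun s : ℂ => s - j) s
      (HurwitzZeta.differentiableAt_hurwitzZeta a h) (by fun_prop)).differentiableWithinAt

theorem differentiableOn_hurwitzZeta (a : ℝ) (j : ℕ) :
    DifferentiableOn ℂ (fun s : ℂ => HurwitzZeta.hurwitzZeta a s) {(1 : ℂ), (j : ℂ) + 1}ᶜ :=
  fun s hs => by
    simp only [mem_compl_iff, mem_insert_iff, mem_singleton_iff, not_or] at hs
    exact (HurwitzZeta.differentiableAt_hurwitzZeta a hs.1).differentiableWithinAt

theorem differentiable_expZeta_add_one {b : ℝ} (hb : b ∈ Ioo (0 : ℝ) 1) :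
    Differentiable ℂ (fun s : ℂ => HurwitzZeta.expZeta b (s + 1)) ∧
      Differentiable ℂ (fun s : ℂ => HurwitzZeta.expZeta (-b : ℝ) (s + 1)) := by
  have hb0 := coe_ne_zero_of_mem_Ioo hb
  have hb0' : ((-b : ℝ) : UnitAddCircle) ≠ 0 := by
    rw [AddCircle.coe_neg]
    exact neg_ne_zero.mpr hb0
  exact ⟨(HurwitzZeta.differentiable_expZeta_of_ne_zero hb0).comp (by fun_prop),
    (HurwitzZeta.differentiable_expZeta_of_ne_zero hb0').comp (by fun_prop)⟩

theorem neg_one_notMem (j : ℕ) : (-1 : ℂ) ∉ ({(1 : ℂ), (j : ℂ) + 1} : Set ℂ) := by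
  have h : (-1 : ℂ) ≠ j + 1 := fun h => by
    have := congrArg Complex.re h
    simp only [Complex.neg_re, Complex.one_re, Complex.add_re, Complex.natCast_re] at this
    have h0 : (0 : ℝ) ≤ j := Nat.cast_nonneg j
    linarith
  have h' : (-1 : ℂ) ≠ 1 := by norm_num
  simp [h, h']

theorem hasMellinGamma_eichTail_im (k : ℕ) {b₁ : ℝ} (hb₁ : b₁ ∈ Ioo (0 : ℝ) 1) (b₂ : ℝ) :
    HasMellinGamma (fun y : ℝ => ((eichTail k b₁ b₂ y).im : ℂ)) fun s =>
      (2 * Complex.I)⁻¹ *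
        (HurwitzZeta.expZeta b₂ (s + 1) - HurwitzZeta.expZeta (-b₂ : ℝ) (s + 1)) *
      (HurwitzZeta.hurwitzZeta b₁ (s - (k - 2 : ℕ)) -
        (-1) ^ k * HurwitzZeta.hurwitzZeta (1 - b₁ : ℝ) (s - (k - 2 : ℕ))) := by
  have h1 := hasMellinGamma_eichSeries k hb₁ b₂
  have h2 := (hasMellinGamma_eichSeries k hb₁ (-b₂)).const_mul (-1)
  have h3 := (hasMellinGamma_eichSeries k (one_sub_mem_Ioo hb₁) (-b₂)).const_mul ((-1) ^ k)
  have h4 := (hasMellinGamma_eichSeries k (one_sub_mem_Ioo hb₁) b₂).const_mul (-(-1) ^ k)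
  refine ((((h1.add h2).add h3).add h4).const_mul (2 * Complex.I)⁻¹).congr (fun y _ => ?_)
    fun s => by ring
  rw [ofReal_im_eq, eichTail]
  simp only [map_add, map_mul, map_pow, map_neg, map_one, conj_eichSeries, neg_neg]
  ring

theorem hasMellinGamma_eisTail_im {a₂ : ℝ} (ha₂ : a₂ ∈ Ioo (0 : ℝ) 1) (a₁ : ℝ) :
    HasMellinGamma (fun y : ℝ => ((eisTail 2 a₂ (-a₁) y).im : ℂ)) fun s =>
      -((2 * Complex.I)⁻¹ * (HurwitzZeta.expZeta a₁ s - HurwitzZeta.expZeta (-a₁ : ℝ) s)) *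
      (HurwitzZeta.hurwitzZeta a₂ (s - 1) - HurwitzZeta.hurwitzZeta (1 - a₂ : ℝ) (s - 1)) := by
  have h1 := hasMellinGamma_eisSeries 2 ha₂ (-a₁)
  have h2 := (hasMellinGamma_eisSeries 2 ha₂ a₁).const_mul (-1)
  have h3 := hasMellinGamma_eisSeries 2 (one_sub_mem_Ioo ha₂) a₁
  have h4 := (hasMellinGamma_eisSeries 2 (one_sub_mem_Ioo ha₂) (-a₁)).const_mul (-1)
  refine ((((h1.add h2).add h3).add h4).const_mul (2 * Complex.I)⁻¹).congr (fun y _ => ?_)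
    fun s => ?_
  · rw [ofReal_im_eq, eisTail]
    simp only [map_add, map_mul, map_pow, map_neg, map_one, conj_eisSeries, neg_neg]
    ring
  · simp only [Nat.reduceSub, Nat.cast_one]
    ring

/-- The boundary term involving the constant term of the weight two Eisenstein series at the cusp
`0` cancels a part of the product of the series `G`. -/
theorem regMellin_boundary_eichTail {k : ℕ} (hk : 2 ≤ k) {a₂ b₁ b₂ : ℝ} (ha₂ : a₂ ∈ Ioo (0 : ℝ) 1)
    (hb₁ : b₁ ∈ Ioo (0 : ℝ) 1) (hb₂ : b₂ ∈ Ioo (0 : ℝ) 1) {n : ℕ} {c d : ℂ}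
    (hh : HasCuspExpansion (fun y : ℝ =>
      ((bernoulliFun 2 a₂ / 2 : ℝ) : ℂ) * ((eichTail k b₁ b₂ y).im : ℂ) +
        (1 / 2) * (-Complex.I * cotFun b₂) *
          (gEis (k - 1) b₁ (1 - a₂) y + gEis (k - 1) b₁ a₂ y)) n c d) :
    regMellin (fun y : ℝ =>
      ((bernoulliFun 2 a₂ / 2 : ℝ) : ℂ) * ((eichTail k b₁ b₂ y).im : ℂ) +
        (1 / 2) * (-Complex.I * cotFun b₂) *
          (gEis (k - 1) b₁ (1 - a₂) y + gEis (k - 1) b₁ a₂ y)) n c d (-1) = 0 := by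
  set j := k - 2 with hj
  set β : ℂ := ((bernoulliFun 2 a₂ / 2 : ℝ) : ℂ) with hβ
  have hpow : (-1 : ℂ) ^ (k - 1) = -(-1) ^ k := by
    obtain ⟨i, rfl⟩ := Nat.exists_eq_add_of_le' hk
    rw [show i + 2 - 1 = i + 1 from rfl, pow_succ, pow_add]
    norm_num
  set T : ℂ → ℂ := fun s => β * ((2 * Complex.I)⁻¹ *
      (HurwitzZeta.expZeta b₂ (s + 1) - HurwitzZeta.expZeta (-b₂ : ℝ) (s + 1))) +
    (1 / 2) * (-Complex.I * cotFun b₂) *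
      (HurwitzZeta.hurwitzZeta a₂ s + HurwitzZeta.hurwitzZeta (1 - a₂ : ℝ) s) with hT
  set V : ℂ → ℂ := fun s => HurwitzZeta.hurwitzZeta b₁ (s - j) -
    (-1) ^ k * HurwitzZeta.hurwitzZeta (1 - b₁ : ℝ) (s - j) with hV
  obtain ⟨σ, hσ⟩ : HasMellinGamma (fun y : ℝ => β * ((eichTail k b₁ b₂ y).im : ℂ) +
        (1 / 2) * (-Complex.I * cotFun b₂) *
          (gEis (k - 1) b₁ (1 - a₂) y + gEis (k - 1) b₁ a₂ y)) fun s => T s * V s := by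
    refine (((hasMellinGamma_eichTail_im k hb₁ b₂).const_mul β).add
      (((hasMellinGamma_gEis (k - 1) hb₁ (one_sub_mem_Ioo ha₂)).add
        (hasMellinGamma_gEis (k - 1) hb₁ ha₂)).const_mul _)).congr (fun y _ => rfl) fun s => ?_
    simp only [hT, hV, Nat.sub_sub, sub_sub_cancel, hpow, Nat.reduceAdd, ← hj]
    ring
  obtain ⟨hd1, hd2⟩ := differentiable_expZeta_add_one hb₂
  refine hh.regMellin_neg_one_eq_zero (T := T) (V := V) (S := {(1 : ℂ), (j : ℂ) + 1}) (by simp)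
    ?_ ?_ (neg_one_notMem j) ?_ ?_ (σ := σ) fun s hs => (hσ s hs).2
  · exact ((((hd1.sub hd2).const_mul _).const_mul β).differentiableOn).add
      (((differentiableOn_hurwitzZeta a₂ j).add
        (differentiableOn_hurwitzZeta (1 - a₂) j)).const_mul _)
  · exact (differentiableOn_hurwitzZeta_sub b₁ j).sub
      ((differentiableOn_hurwitzZeta_sub (1 - b₁) j).const_mul _)
  · have hI := Complex.I_ne_zero
    simp only [hT, neg_add_cancel, expZeta_sub_expZeta_neg hb₂, hurwitzZeta_neg_one ha₂,
      hurwitzZeta_neg_one_one_sub ha₂, ← hβ]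
    field_simp
    linear_combination (2 * β * cotFun b₂) * Complex.I_sq
  · simp only [hV]
    rw [hurwitzZeta_at_neg_one hk hb₁, hurwitzZeta_at_neg_one_one_sub hk hb₁, mul_neg,
      ← mul_assoc, ← mul_pow]
    simp

/-- The boundary term involving the linear term of the Eichler integral at `∞` cancels the other
part of the product of the series `G`. -/
theorem regMellin_boundary_eisTail {k : ℕ} (hk : 2 ≤ k) {a₁ a₂ b₁ : ℝ} (ha₁ : a₁ ∈ Ioo (0 : ℝ) 1)
    (ha₂ : a₂ ∈ Ioo (0 : ℝ) 1) (hb₁ : b₁ ∈ Ioo (0 : ℝ) 1) {n : ℕ} {c d : ℂ}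
    (hh : HasCuspExpansion (fun y : ℝ =>
      -(2 * Real.pi) * ((bernoulliFun k b₁ / k : ℝ) : ℂ) *
          ((y : ℂ) * ((eisTail 2 a₂ (-a₁) y).im : ℂ)) +
        (1 / 2) * (-Complex.I * cotFun a₁) *
          (gEis (k - 1) b₁ (1 - a₂) y + -1 * gEis (k - 1) b₁ a₂ y)) n c d) :
    regMellin (fun y : ℝ =>
      -(2 * Real.pi) * ((bernoulliFun k b₁ / k : ℝ) : ℂ) *
          ((y : ℂ) * ((eisTail 2 a₂ (-a₁) y).im : ℂ)) +
        (1 / 2) * (-Complex.I * cotFun a₁) *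
          (gEis (k - 1) b₁ (1 - a₂) y + -1 * gEis (k - 1) b₁ a₂ y)) n c d (-1) = 0 := by
  set j := k - 2 with hj
  set γ : ℂ := ((bernoulliFun k b₁ / k : ℝ) : ℂ) with hγ
  have hpow : (-1 : ℂ) ^ (k - 1) = -(-1) ^ k := by
    obtain ⟨i, rfl⟩ := Nat.exists_eq_add_of_le' hk
    rw [show i + 2 - 1 = i + 1 from rfl, pow_succ, pow_add]
    norm_num
  set T : ℂ → ℂ := fun s => γ * s * ((2 * Complex.I)⁻¹ *
      (HurwitzZeta.expZeta a₁ (s + 1) - HurwitzZeta.expZeta (-a₁ : ℝ) (s + 1))) -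
    (1 / 2) * (-Complex.I * cotFun a₁) * (HurwitzZeta.hurwitzZeta b₁ (s - j) +
      (-1) ^ k * HurwitzZeta.hurwitzZeta (1 - b₁ : ℝ) (s - j)) with hT
  set V : ℂ → ℂ := fun s =>
    HurwitzZeta.hurwitzZeta a₂ s - HurwitzZeta.hurwitzZeta (1 - a₂ : ℝ) s with hV
  have hpi : (Real.pi : ℂ) ≠ 0 := by simp [Real.pi_ne_zero]
  obtain ⟨σ, hσ⟩ : HasMellinGamma (fun y : ℝ => -(2 * Real.pi) * γ *
          ((y : ℂ) * ((eisTail 2 a₂ (-a₁) y).im : ℂ)) +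
        (1 / 2) * (-Complex.I * cotFun a₁) *
          (gEis (k - 1) b₁ (1 - a₂) y + -1 * gEis (k - 1) b₁ a₂ y)) fun s => T s * V s := by
    refine (((hasMellinGamma_eisTail_im ha₂ a₁).id_mul.const_mul (-(2 * Real.pi) * γ)).add
      (((hasMellinGamma_gEis (k - 1) hb₁ (one_sub_mem_Ioo ha₂)).add
        ((hasMellinGamma_gEis (k - 1) hb₁ ha₂).const_mul (-1))).const_mul _)).congr
        (fun y _ => rfl) fun s => ?_
    simp only [hT, hV, Nat.sub_sub, sub_sub_cancel, hpow, Nat.reduceAdd, ← hj, add_sub_cancel_right]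
    field_simp
    ring
  obtain ⟨hd1, hd2⟩ := differentiable_expZeta_add_one ha₁
  refine hh.regMellin_neg_one_eq_zero (T := T) (V := V) (S := {(1 : ℂ), (j : ℂ) + 1}) (by simp)
    ?_ ?_ (neg_one_notMem j) ?_ ?_ (σ := σ) fun s hs => (hσ s hs).2
  · exact ((((differentiable_const γ).mul differentiable_id).mul
      ((hd1.sub hd2).const_mul _)).differentiableOn).sub
      (((differentiableOn_hurwitzZeta_sub b₁ j).add
        ((differentiableOn_hurwitzZeta_sub (1 - b₁) j).const_mul _)).const_mul _)
  · exact (differentiableOn_hurwitzZeta a₂ j).sub (differentiableOn_hurwitzZeta (1 - a₂) j)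
  · have hI := Complex.I_ne_zero
    have hsq : (-1 : ℂ) ^ k * -((-1) ^ k * γ) = -γ := by
      rw [mul_neg, ← mul_assoc, ← mul_pow]
      simp
    simp only [hT]
    rw [hurwitzZeta_at_neg_one hk hb₁, hurwitzZeta_at_neg_one_one_sub hk hb₁, ← hγ, hsq,
      neg_add_cancel, expZeta_sub_expZeta_neg ha₁]
    field_simp
    linear_combination (-(2 * γ * cotFun a₁)) * Complex.I_sq
  · simp only [hV]
    rw [hurwitzZeta_neg_one ha₂, hurwitzZeta_neg_one_one_sub ha₂, sub_self]

/-! ### The integrand -/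

section

theorem contDiffOn_comp_inv {g : ℝ → ℂ} (hg : ContDiffOn ℝ ∞ g (Ioi 0)) :
    ContDiffOn ℝ ∞ (fun y => g (1 / y)) (Ioi 0) := by
  refine hg.comp ?_ fun y hy => one_div_pos.mpr (mem_Ioi.mp hy)
  exact contDiffOn_const.div contDiffOn_id fun y hy => (ne_of_gt hy : y ≠ 0)

variable {k : ℕ} {u v : UnitAddCircle × UnitAddCircle} {F : ℝ → ℂ}

theorem eisE_two_swap (hu₁ : u.1 ≠ 0) (hu₂ : u.2 ≠ 0) {y : ℝ} (hy : 0 < y) :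
    eisE 2 (u.2, -u.1) (Complex.I * y) =
      ((bernoulliFun 2 (frac u.2) / 2 : ℝ) : ℂ) - eisTail 2 (frac u.2) (-frac u.1) y := by
  rw [eisE_eq_tail hy le_rfl (x := (u.2, -u.1)) hu₂, frac_neg hu₁, eisTail_one_sub]
  simp

/-- The weight two Eisenstein series in terms of its expansion at the cusp `0`. -/
theorem eisE_two_eq (hu₁ : u.1 ≠ 0) (hu₂ : u.2 ≠ 0) {y : ℝ} (hy : 0 < y) :
    eisE 2 u (Complex.I * y) = -((y : ℂ) ^ 2)⁻¹ *
      (((bernoulliFun 2 (frac u.2) / 2 : ℝ) : ℂ) -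
        eisTail 2 (frac u.2) (-frac u.1) ((1 / y : ℝ) : ℂ)) := by
  have hyi := one_div_pos.mpr hy
  have h := eisE_inv hyi le_rfl hu₁
  rw [one_div_one_div, eisE_two_swap hu₁ hu₂ hyi] at h
  rw [h, mul_pow, Complex.I_sq]
  push_cast
  rw [one_div, inv_pow]
  ring

theorem eichler_eq_eichFun (hk : 2 ≤ k) (hv₁ : v.1 ≠ 0)
    (hF : IsEichlerIntegral (fun y => eisE k v (Complex.I * y)) F) {y : ℝ} (hy : 0 < y) :
    F y = eichFun k (frac v.1) (frac v.2) y :=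
  hF.eq (isEichlerIntegral_eichFun hk hv₁) hy

theorem contDiffOn_integrand (hk : 2 ≤ k) (hu₁ : u.1 ≠ 0) (hv₁ : v.1 ≠ 0)
    (hF : IsEichlerIntegral (fun y => eisE k v (Complex.I * y)) F) :
    ContDiffOn ℝ ∞ (fun y : ℝ => eisE 2 u (Complex.I * y) * F y) (Ioi 0) := by
  have h1 := contDiffOn_eisTail 2 (frac_pos hu₁) (frac_lt_one u.1) (frac u.2)
  have h2 := contDiffOn_eichFun k (frac_pos hv₁) (frac_lt_one v.1) (frac v.2)
  refine ((contDiffOn_const (c := ((bernoulliFun 2 (frac u.1) / 2 : ℝ) : ℂ))).sub h1 |>.mul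
    h2).congr fun y hy => ?_
  rw [eichler_eq_eichFun hk hv₁ hF hy, eisE_eq_tail hy le_rfl hu₁]
  simp

theorem pullbackForm_integrand (hk : 2 ≤ k) (hu₁ : u.1 ≠ 0) (hu₂ : u.2 ≠ 0) (hv₁ : v.1 ≠ 0)
    (hF : IsEichlerIntegral (fun y => eisE k v (Complex.I * y)) F) {y : ℝ} (hy : 0 < y) :
    pullbackForm (fun y : ℝ => eisE 2 u (Complex.I * y) * F y) y =
      (((bernoulliFun 2 (frac u.2) / 2 : ℝ) : ℂ) - eisTail 2 (frac u.2) (-frac u.1) y) *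
        eichFun k (frac v.1) (frac v.2) (1 / y) := by
  have hy0 : (y : ℂ) ≠ 0 := by exact_mod_cast hy.ne'
  have hI := Complex.I_ne_zero
  rw [pullbackForm, eichler_eq_eichFun hk hv₁ hF (one_div_pos.mpr hy), eisE_inv hy le_rfl hu₁,
    eisE_two_swap hu₁ hu₂ hy]
  field_simp

theorem contDiffOn_pullbackForm_integrand (hk : 2 ≤ k) (hu₁ : u.1 ≠ 0) (hu₂ : u.2 ≠ 0)
    (hv₁ : v.1 ≠ 0) (hF : IsEichlerIntegral (fun y => eisE k v (Complex.I * y)) F) :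
    ContDiffOn ℝ ∞ (pullbackForm fun y : ℝ => eisE 2 u (Complex.I * y) * F y) (Ioi 0) := by
  have h1 := contDiffOn_eisTail 2 (frac_pos hu₂) (frac_lt_one u.2) (-frac u.1)
  have h2 := contDiffOn_comp_inv
    (contDiffOn_eichFun k (frac_pos hv₁) (frac_lt_one v.1) (frac v.2))
  exact ((contDiffOn_const (c := ((bernoulliFun 2 (frac u.2) / 2 : ℝ) : ℂ))).sub h1 |>.mul
    h2).congr fun y hy => pullbackForm_integrand hk hu₁ hu₂ hv₁ hF hy

theorem isPolyPart_integrand (hk : 2 ≤ k) (hu₁ : u.1 ≠ 0) (hv₁ : v.1 ≠ 0)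
    (hF : IsEichlerIntegral (fun y => eisE k v (Complex.I * y)) F) :
    IsPolyPart (fun y : ℝ => eisE 2 u (Complex.I * y) * F y)
      (Polynomial.C (((bernoulliFun 2 (frac u.1) / 2 : ℝ) : ℂ) *
        (2 * Real.pi * Complex.I * (bernoulliFun k (frac v.1) / k : ℝ))) * Polynomial.X) := by
  set β : ℂ := ((bernoulliFun 2 (frac u.1) / 2 : ℝ) : ℂ) with hβ
  set γ : ℂ := ((bernoulliFun k (frac v.1) / k : ℝ) : ℂ) with hγ
  have hT := expDecay_eisTail 2 (frac_pos hu₁) (frac_lt_one u.1) (frac u.2)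
  have hB := expDecay_eichTail k (frac_pos hv₁) (frac_lt_one v.1) (frac v.2)
  refine (((hB.const_mul (-β)).add (hT.mul hB)).add
    ((hT.pow_mul 1).const_mul (2 * Real.pi * γ))).congr fun y hy => ?_
  have hE : eisE 2 u (Complex.I * y) = β - eisTail 2 (frac u.1) (frac u.2) y := by
    rw [eisE_eq_tail hy le_rfl hu₁, hβ]
    simp
  beta_reduce
  rw [eichler_eq_eichFun hk hv₁ hF hy, hE, eichFun, ← hγ]
  simp only [Polynomial.eval_mul, Polynomial.eval_C, Polynomial.eval_X]
  linear_combination (-(β * (2 * Real.pi * γ) * y)) * Complex.I_sq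

theorem isPolyPart_pullbackForm_integrand (hk : 2 ≤ k) (hu₁ : u.1 ≠ 0) (hu₂ : u.2 ≠ 0)
    (hv₁ : v.1 ≠ 0) (hF : IsEichlerIntegral (fun y => eisE k v (Complex.I * y)) F) {c d : ℂ}
    (hcd : ExpDecay fun y : ℝ =>
      eichFun k (frac v.1) (frac v.2) (1 / y) - c * (y : ℂ) ^ (k - 1) - d) :
    IsPolyPart (pullbackForm fun y : ℝ => eisE 2 u (Complex.I * y) * F y)
      (Polynomial.C ((bernoulliFun 2 (frac u.2) / 2 : ℝ) : ℂ) *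
        (Polynomial.C (c * (-Complex.I) ^ (k - 1)) * Polynomial.X ^ (k - 1) + Polynomial.C d)) := by
  set β : ℂ := ((bernoulliFun 2 (frac u.2) / 2 : ℝ) : ℂ) with hβ
  have hT := expDecay_eisTail 2 (frac_pos hu₂) (frac_lt_one u.2) (-frac u.1)
  refine ((hcd.const_mul β).sub (((hT.mul hcd).add ((hT.pow_mul (k - 1)).const_mul c)).add
    (hT.const_mul d))).congr fun y hy => ?_
  have hpow : (-Complex.I) ^ (k - 1) * (Complex.I * y) ^ (k - 1) = (y : ℂ) ^ (k - 1) := by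
    rw [← mul_pow, ← mul_assoc, neg_mul, Complex.I_mul_I, neg_neg, one_mul]
  rw [pullbackForm_integrand hk hu₁ hu₂ hv₁ hF hy, ← hβ]
  simp only [Polynomial.eval_mul, Polynomial.eval_add, Polynomial.eval_C, Polynomial.eval_pow,
    Polynomial.eval_X]
  linear_combination (-(β * c)) * hpow

theorem admissibleForm_integrand (hk : 2 ≤ k) (hu₁ : u.1 ≠ 0) (hu₂ : u.2 ≠ 0) (hv₁ : v.1 ≠ 0)
    (hv₂ : v.2 ≠ 0) (hF : IsEichlerIntegral (fun y => eisE k v (Complex.I * y)) F) :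
    AdmissibleForm fun y : ℝ => eisE 2 u (Complex.I * y) * F y := by
  obtain ⟨c, d, hcd⟩ := exists_expDecay_eichFun_inv hk hv₁ hv₂
  exact ⟨⟨contDiffOn_integrand hk hu₁ hv₁ hF, _, isPolyPart_integrand hk hu₁ hv₁ hF⟩,
    contDiffOn_pullbackForm_integrand hk hu₁ hu₂ hv₁ hF, _,
    isPolyPart_pullbackForm_integrand hk hu₁ hu₂ hv₁ hF hcd⟩

/-- The imaginary part of the integrand. The product of the constant term of `E` at the cusp `0` and
of the linear term of the Eichler integral is real, and drops out. -/
theorem sq_mul_integrand_im (hk : 2 ≤ k) (hu₁ : u.1 ≠ 0) (hu₂ : u.2 ≠ 0) (hv₁ : v.1 ≠ 0)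
    (hF : IsEichlerIntegral (fun y => eisE k v (Complex.I * y)) F) {y : ℝ} (hy : 0 < y) :
    (y : ℂ) ^ 2 * ((eisE 2 u (Complex.I * y) * F y).im : ℂ) =
      ((bernoulliFun 2 (frac u.2) / 2 : ℝ) : ℂ) *
          ((eichTail k (frac v.1) (frac v.2) y).im : ℂ) +
        (-(2 * Real.pi) * ((bernoulliFun k (frac v.1) / k : ℝ) : ℂ) *
          ((y : ℂ) * ((eisTail 2 (frac u.2) (-frac u.1) ((1 / y : ℝ) : ℂ)).im : ℂ)) +
        -1 * ((eisTail 2 (frac u.2) (-frac u.1) ((1 / y : ℝ) : ℂ) *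
          eichTail k (frac v.1) (frac v.2) y).im : ℂ)) := by
  have hy0 : (y : ℂ) ≠ 0 := by exact_mod_cast hy.ne'
  rw [eichler_eq_eichFun hk hv₁ hF hy, eisE_two_eq hu₁ hu₂ hy, eichFun]
  generalize eisTail 2 (frac u.2) (-frac u.1) ((1 / y : ℝ) : ℂ) = A
  generalize eichTail k (frac v.1) (frac v.2) y = B
  generalize bernoulliFun 2 (frac u.2) / 2 = β
  generalize bernoulliFun k (frac v.1) / (k : ℝ) = γ
  simp only [ofReal_im_eq, map_mul, map_sub, map_neg, map_inv₀, map_pow, Complex.conj_ofReal,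
    map_ofNat]
  have hI := Complex.I_ne_zero
  field_simp
  ring

theorem hasCuspExpansion_eichTail_im (hv₁ : v.1 ≠ 0) {c d : ℂ}
    (hcd : ExpDecay fun y : ℝ =>
      eichFun k (frac v.1) (frac v.2) (1 / y) - c * (y : ℂ) ^ (k - 1) - d) :
    HasCuspExpansion (fun y : ℝ => ((eichTail k (frac v.1) (frac v.2) y).im : ℂ)) (k - 1)
      ((-c.im : ℝ) : ℂ) ((-d.im : ℝ) : ℂ) := by
  have h := (moderateDecay_eichTail k (frac_mem_Ioo hv₁) (frac v.2)).ofReal_im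
  refine ⟨h.continuousOn, h.expDecay, hcd.ofReal_im.neg.congr fun y _ => ?_⟩
  have h1 : (-(2 * Real.pi) * ((bernoulliFun k (frac v.1) / k : ℝ) : ℂ) * ((1 / y : ℝ) : ℂ)) =
      ((-(2 * Real.pi) * (bernoulliFun k (frac v.1) / k) * (1 / y) : ℝ) : ℂ) := by
    push_cast
    ring
  rw [eichFun, h1, Complex.sub_im, Complex.sub_im, Complex.sub_im, Complex.ofReal_im,
    ← Complex.ofReal_pow, Complex.im_mul_ofReal]
  push_cast
  ring

/-- The difference of products of series `G`, after the series of weight one are replaced by their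
expansions at the cusp `0`. -/
theorem gEis_product_eq {a₁ a₂ b₁ b₂ : ℝ} (ha₁ : a₁ ∈ Ioo (0 : ℝ) 1) (hb₂ : b₂ ∈ Ioo (0 : ℝ) 1)
    {y : ℝ} (hy : 0 < y) :
    gEis 1 a₁ b₂ y * gEis (k - 1) b₁ (1 - a₂) y - gEis 1 a₁ (1 - b₂) y * gEis (k - 1) b₁ a₂ y =
      (y : ℂ)⁻¹ *
        (-Complex.I * cotFun b₂ * (gEis (k - 1) b₁ (1 - a₂) y + gEis (k - 1) b₁ a₂ y) +
          (-Complex.I * cotFun a₁ * (gEis (k - 1) b₁ (1 - a₂) y + -1 * gEis (k - 1) b₁ a₂ y) +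
          2 * exchangeKernel k a₁ a₂ b₁ b₂ y)) := by
  have hy0 : (y : ℂ) ≠ 0 := by exact_mod_cast hy.ne'
  have hI := Complex.I_ne_zero
  have h1 : ∀ b : ℝ, jSeries 1 a₁ b ((1 / y : ℝ) : ℂ) - jSeries 1 (-a₁) (-b) ((1 / y : ℝ) : ℂ) =
      2 * Complex.I * ((jSeries 1 a₁ b ((1 / y : ℝ) : ℂ)).im : ℂ) := fun b => by
    rw [ofReal_im_eq, conj_jSeries]
    field_simp
  rw [gEis_one_inv hy ha₁ hb₂, gEis_one_inv hy ha₁ (one_sub_mem_Ioo hb₂), h1, h1,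
    cotFun_one_sub hb₂.1 hb₂.2, jSeries_one_sub_right, exchangeKernel]
  generalize gEis (k - 1) b₁ (1 - a₂) y = G₁
  generalize gEis (k - 1) b₁ a₂ y = G₂
  have hinv : (Complex.I * (y : ℂ))⁻¹ = -Complex.I * (y : ℂ)⁻¹ := by
    rw [mul_inv, Complex.inv_I]
  rw [hinv]
  linear_combination (-(2 * (y : ℂ)⁻¹ * (((jSeries 1 a₁ b₂ ((1 / y : ℝ) : ℂ)).im : ℂ) * G₁ -
    ((jSeries 1 a₁ (-b₂) ((1 / y : ℝ) : ℂ)).im : ℂ) * G₂))) * Complex.I_sq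

/-- The difference of products of series `G` has a holomorphic Mellin transform at `0`, and its
value there is minus twice the imaginary part of the regularised integral. -/
theorem exists_isMellinContinuation (hk : 2 ≤ k) (hu₁ : u.1 ≠ 0) (hu₂ : u.2 ≠ 0) (hv₁ : v.1 ≠ 0)
    (hv₂ : v.2 ≠ 0) (hF : IsEichlerIntegral (fun y => eisE k v (Complex.I * y)) F) :
    ∃ (S : Set ℂ) (M : ℂ → ℂ), IsMellinContinuation (fun y : ℝ =>
        gEis 1 (frac u.1) (frac v.2) y * gEis (k - 1) (frac v.1) (1 - frac u.2) y -
          gEis 1 (frac u.1) (1 - frac v.2) y * gEis (k - 1) (frac v.1) (frac u.2) y) S M ∧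
      (0 : ℂ) ∉ S ∧
      (((regIntegralDy fun y : ℝ => eisE 2 u (Complex.I * y) * F y).im : ℝ) : ℂ) =
        -(1 / 2) * M 0 := by
  obtain ⟨c, d, hcd⟩ := exists_expDecay_eichFun_inv hk hv₁ hv₂
  have hl := im_regIntegralDy (n := k - 1)
    (c := bernoulliFun 2 (frac u.2) / 2 * c.im) (d := bernoulliFun 2 (frac u.2) / 2 * d.im)
    (contDiffOn_integrand hk hu₁ hv₁ hF).continuousOn (isPolyPart_integrand hk hu₁ hv₁ hF)
    (isPolyPart_pullbackForm_integrand hk hu₁ hu₂ hv₁ hF hcd) (fun y => by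
      have : Polynomial.eval (Complex.I * y)
          (Polynomial.C (((bernoulliFun 2 (frac u.1) / 2 : ℝ) : ℂ) *
        (2 * Real.pi * Complex.I * (bernoulliFun k (frac v.1) / k : ℝ))) * Polynomial.X) =
        ((-(bernoulliFun 2 (frac u.1) / 2 * (2 * Real.pi * (bernoulliFun k (frac v.1) / k)) * y) :
          ℝ) : ℂ) := by
        simp only [Polynomial.eval_mul, Polynomial.eval_C, Polynomial.eval_X]
        push_cast
        linear_combination ((bernoulliFun 2 (frac u.1) : ℂ) / 2 *
          (2 * Real.pi * ((bernoulliFun k (frac v.1) : ℂ) / k)) * y) * Complex.I_sq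
      rw [this, Complex.ofReal_im]) fun y => by
      have hpow : (-Complex.I) ^ (k - 1) * (Complex.I * y) ^ (k - 1) = ((y ^ (k - 1) : ℝ) : ℂ) := by
        rw [← mul_pow, ← mul_assoc, neg_mul, Complex.I_mul_I, neg_neg, one_mul, Complex.ofReal_pow]
      simp only [Polynomial.eval_mul, Polynomial.eval_add, Polynomial.eval_C, Polynomial.eval_pow,
        Polynomial.eval_X]
      rw [mul_assoc c, hpow, Complex.im_ofReal_mul, Complex.add_im, Complex.im_mul_ofReal]
      ring
  have ha₁ := frac_mem_Ioo hu₁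
  have ha₂ := frac_mem_Ioo hu₂
  have hb₁ := frac_mem_Ioo hv₁
  have hb₂ := frac_mem_Ioo hv₂
  have hB := hasCuspExpansion_eichTail_im hv₁ hcd
  have hAA := hasCuspExpansion_mul_eisTail_im (x := (u.2, -u.1)) hu₂ (neg_ne_zero.mpr hu₁) (k - 1)
  simp only [frac_neg hu₁, eisTail_one_sub] at hAA
  obtain ⟨hA, hAi⟩ := hAA
  have hP := ((moderateDecay_eisTail 2 ha₂ (-frac u.1)).hasCuspExpansion_inv_mul
    (moderateDecay_eichTail k hb₁ (frac v.2)) (k - 1)).ofReal_im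
  have hK := hasCuspExpansion_exchangeKernel k (frac u.1) (frac v.2) ha₂ hb₁ (k - 1)
  obtain ⟨c₁, hG₁⟩ := exists_hasCuspExpansion_gEis (by omega : 1 ≤ k - 1) hb₁ (one_sub_mem_Ioo ha₂)
  obtain ⟨c₂, hG₂⟩ := exists_hasCuspExpansion_gEis (by omega : 1 ≤ k - 1) hb₁ ha₂
  simp only [Complex.zero_im, Complex.ofReal_zero] at hP
  set β : ℂ := ((bernoulliFun 2 (frac u.2) / 2 : ℝ) : ℂ) with hβ
  set γ : ℂ := ((bernoulliFun k (frac v.1) / k : ℝ) : ℂ) with hγ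
  -- the imaginary part of the regularised integral as a sum of regularised Mellin transforms
  have hL : (((regIntegralDy fun y : ℝ => eisE 2 u (Complex.I * y) * F y).im : ℝ) : ℂ) = _ :=
    hl.trans (regMellin_congr (fun y hy => sq_mul_integrand_im hk hu₁ hu₂ hv₁ hF hy) (-1))
  have hc : ∀ x : ℝ, ((-(bernoulliFun 2 (frac u.2) / 2 * x) : ℝ) : ℂ) =
      β * ((-x : ℝ) : ℂ) + (-(2 * Real.pi) * γ * 0 + -1 * 0) := fun x => by
    rw [hβ, ← Complex.ofReal_mul]
    simp
  rw [hc, hc, ← hβ, ← hγ, regMellin_add (hB.const_mul β)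
    ((hAi.const_mul (-(2 * Real.pi) * γ)).add (hP.const_mul (-1))),
    regMellin_add (hAi.const_mul (-(2 * Real.pi) * γ)) (hP.const_mul (-1)),
    regMellin_const_mul, regMellin_const_mul, regMellin_const_mul,
    ← (hAi.mellin_eq (Or.inl rfl) (Or.inl rfl)).2, ← (hP.mellin_eq (Or.inl rfl) (Or.inl rfl)).2,
    mellin_mul_comp_inv (fun y : ℝ => ((eisTail 2 (frac u.2) (-frac u.1) y).im : ℂ)),
    mellin_im_eisTail_mul_eichTail hk _ _ ha₂ hb₁, (hA.mellin_eq (Or.inl rfl) (Or.inl rfl)).2,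
    (hK.mellin_eq (Or.inl rfl) (Or.inl rfl)).2] at hL
  -- the Mellin transform of the product of the series `G`
  have hG₂' := hG₂.const_mul (-1)
  have hX₁ := (hG₁.add hG₂).const_mul (-Complex.I * cotFun (frac v.2))
  have hX₂ := (hG₁.add hG₂').const_mul (-Complex.I * cotFun (frac u.1))
  have hK₂ := hK.const_mul 2
  have hX := hX₁.add (hX₂.add hK₂)
  have hR := regMellin_add hX₁ (hX₂.add hK₂) (-1)
  rw [regMellin_add hX₂ hK₂, regMellin_const_mul, regMellin_const_mul, regMellin_const_mul,
    regMellin_add hG₁ hG₂, regMellin_add hG₁ hG₂', regMellin_const_mul] at hR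
  -- the two boundary terms, whose transforms vanish at `-1`
  have h₁ := hB.const_mul β
  have h₂ := (hG₁.add hG₂).const_mul ((1 / 2) * (-Complex.I * cotFun (frac v.2)))
  have h₃ := hA.const_mul (-(2 * Real.pi) * γ)
  have h₄ := (hG₁.add hG₂').const_mul ((1 / 2) * (-Complex.I * cotFun (frac u.1)))
  have e₁ := regMellin_boundary_eichTail hk ha₂ hb₁ hb₂ (h₁.add h₂)
  have e₂ := regMellin_boundary_eisTail hk ha₁ ha₂ hb₁ (h₃.add h₄)
  rw [← hβ, regMellin_add h₁ h₂, regMellin_const_mul, regMellin_const_mul,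
    regMellin_add hG₁ hG₂] at e₁
  rw [← hγ, regMellin_add h₃ h₄, regMellin_const_mul, regMellin_const_mul,
    regMellin_add hG₁ hG₂', regMellin_const_mul] at e₂
  have hd : -Complex.I * cotFun (frac v.2) * ((0 : ℂ) + 0) +
      (-Complex.I * cotFun (frac u.1) * (0 + -1 * 0) + 2 * 0) = 0 := by ring
  rw [hd] at hX hR
  refine ⟨_, _, (hX.div.congr fun y hy => gEis_product_eq ha₁ hb₂ hy).isMellinContinuation,
    ?_, ?_⟩
  · rw [mem_singleton_iff, eq_comm, Nat.cast_eq_zero]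
    omega
  · rw [regMellin_congr (fun y hy => gEis_product_eq ha₁ hb₂ hy), regMellin_div, zero_sub, hR, hL]
    linear_combination e₁ + e₂

end

end

end EisensteinRZ

theorem theorem6p2 (ℓ : ℕ) (hℓ : 2 ≤ ℓ) (u₁ u₂ v₁ v₂ : UnitAddCircle)
    (hu₁ : u₁ ≠ 0) (hu₂ : u₂ ≠ 0) (hv₁ : v₁ ≠ 0) (hv₂ : v₂ ≠ 0) :
    -- the Eichler integral of the weight `ℓ` series exists
    (∃ F : ℝ → ℂ, EisensteinRZ.IsEichlerIntegral
      (fun y => EisensteinRZ.eisE ℓ (v₁, v₂) (Complex.I * y)) F) ∧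
    -- the Mellin transform on the right-hand side is holomorphic at `0`
    EisensteinRZ.MellinHolomorphicAt (fun y : ℝ =>
      EisensteinRZ.eisG 1 (u₁, v₂) (Complex.I * y) *
          EisensteinRZ.eisG (ℓ - 1) (v₁, -u₂) (Complex.I * y) -
        EisensteinRZ.eisG 1 (u₁, -v₂) (Complex.I * y) *
          EisensteinRZ.eisG (ℓ - 1) (v₁, u₂) (Complex.I * y)) 0 ∧
    ∀ F : ℝ → ℂ, EisensteinRZ.IsEichlerIntegral
        (fun y => EisensteinRZ.eisE ℓ (v₁, v₂) (Complex.I * y)) F →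
      -- the integrand is admissible, so that its regularised integral makes sense
      EisensteinRZ.AdmissibleForm
        (fun y => EisensteinRZ.eisE 2 (u₁, u₂) (Complex.I * y) * F y) ∧
      (((EisensteinRZ.regIntegralDy
          (fun y => EisensteinRZ.eisE 2 (u₁, u₂) (Complex.I * y) * F y)).im : ℝ) : ℂ) =
        -(1 / 2) * EisensteinRZ.genMellin (fun y : ℝ =>
          EisensteinRZ.eisG 1 (u₁, v₂) (Complex.I * y) *
              EisensteinRZ.eisG (ℓ - 1) (v₁, -u₂) (Complex.I * y) -
            EisensteinRZ.eisG 1 (u₁, -v₂) (Complex.I * y) *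
              EisensteinRZ.eisG (ℓ - 1) (v₁, u₂) (Complex.I * y)) 0 := by
  have hG : (fun y : ℝ =>
      EisensteinRZ.eisG 1 (u₁, v₂) (Complex.I * y) *
          EisensteinRZ.eisG (ℓ - 1) (v₁, -u₂) (Complex.I * y) -
        EisensteinRZ.eisG 1 (u₁, -v₂) (Complex.I * y) *
          EisensteinRZ.eisG (ℓ - 1) (v₁, u₂) (Complex.I * y)) = _ := funext fun y => by
    rw [EisensteinRZ.eisG_eq (x := (u₁, v₂)) hu₁ hv₂,
      EisensteinRZ.eisG_eq (x := (v₁, -u₂)) hv₁ (neg_ne_zero.mpr hu₂),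
      EisensteinRZ.eisG_eq (x := (u₁, -v₂)) hu₁ (neg_ne_zero.mpr hv₂),
      EisensteinRZ.eisG_eq (x := (v₁, u₂)) hv₁ hu₂,
      EisensteinRZ.frac_neg hu₂, EisensteinRZ.frac_neg hv₂]
  have hF₀ := EisensteinRZ.isEichlerIntegral_eichFun (x := (v₁, v₂)) hℓ hv₁
  obtain ⟨S, M, hM, h0, -⟩ := EisensteinRZ.exists_isMellinContinuation (u := (u₁, u₂))
    (v := (v₁, v₂)) hℓ hu₁ hu₂ hv₁ hv₂ hF₀
  refine ⟨⟨_, hF₀⟩, ⟨M, S, by rw [hG]; exact hM, h0⟩, fun F hF =>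
    ⟨EisensteinRZ.admissibleForm_integrand (u := (u₁, u₂)) (v := (v₁, v₂)) hℓ hu₁ hu₂ hv₁ hv₂ hF,
      ?_⟩⟩
  obtain ⟨S, M, hM, h0, h⟩ := EisensteinRZ.exists_isMellinContinuation (u := (u₁, u₂))
    (v := (v₁, v₂)) hℓ hu₁ hu₂ hv₁ hv₂ hF
  rw [h, hG, EisensteinRZ.genMellin_eq hM h0]
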